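/- Let $u,b\in C^5([-1,1];\mathbb R)$ with $u(0)=b(0)=0$ and $b'(y)-|u'(y)|\ge c_0>0$ on $[-1,1]$, and let $\alpha\in\mathbb R$, $|\alpha|\ge 1$. Put $W_\pm=u\pm b$, so $W_+'>0>W_-'$ and $W_\pm(0)=0$, and $D_0=[c_{\min},c_{\max}]$ with $c_{\min}=\min\{W_-(1),W_+(-1)\}$, $c_{\max}=\max\{W_+(1),W_-(-1)\}$. *Extension.* Let $a_-\le-1$, $a_+\ge1$, and let $W_\pm$ also denote $C^5$ extensions to $[a_-,a_+]$ with $W_+'>0>W_-'$ there, such that: if $W_+(1)<W_-(-1)$ then $W_+(a_+)=W_-(-1)$; if $W_+(-1)<W_-(1)$ then $W_-(a_+)=W_+(-1)$; if neither holds, $a_+=1$; if $W_-(-1)<W_+(1)$ then $W_-(a_-)=W_+(1)$; if $W_-(1)<W_+(-1)$ then $W_+(a_-)=W_-(1)$; if neither holds, $a_-=-1$. *Domain.* For $\epsilon_0>0$ let $\Omega_{\epsilon_0}=D_0\cup D_{\epsilon_0}\cup B^l_{\epsilon_0}\cup B^r_{\epsilon_0}$, where $D_{\epsilon_0}=\{c+i\epsilon: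 c\in D_0,\,0<|\epsilon|<\epsilon_0\}$, $B^l_{\epsilon_0}=\{c_{\min}+\epsilon e^{i\theta}:0<\epsilon<\epsilon_0,\ \frac\pi2\le\theta\le\frac{3\pi}2\}$, $B^r_{\epsilon_0}=\{c_{\max}-\epsilon e^{i\theta}:0<\epsilon<\epsilon_0,\ \frac\pi2\le\theta\le\frac{3\pi}2\}$. Let $c_r=\mathrm{Re}\,c$ on $D_0\cup D_{\epsilon_0}$, $c_r=c_{\min}$ on $B^l_{\epsilon_0}$, $c_r=c_{\max}$ on $B^r_{\epsilon_0}$. Let $y_{c_+}\in[0,a_+]$ and $y_{c_-}\in[a_-,0]$ be given by $W_+(y_{c_+})=c_r=W_-(y_{c_-})$ if $c_r\ge0$ and $W_-(y_{c_+})=c_r=W_+(y_{c_-})$ if $c_r\le0$. *Wronskian.* Let $\mathcal H(y,c)=(W_+(y)-c)(W_-(y)-c)$, and let $\varphi_\pm(\cdot,c)$ be the $C^1$ solution, on the interval spanned by $0$, $\pm1$ and $y_{c_\pm}$, of $$\partial_y(\mathcal H\,\partial_y\varphi_\pm)=\alpha^2\mathcal H\,\varphi_\pm,\qquad \varphi_\pm(y_{c_\pm},c)=1,\quad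 \partial_y\varphi_\pm(y_{c_\pm},c)=0 .$$ Put $P(c)=\varphi_-(0,c)^2(\varphi_+\partial_y\varphi_+)(0,c)-\varphi_+(0,c)^2(\varphi_-\partial_y\varphi_-)(0,c)$ and, for $c\in\Omega_{\epsilon_0}\setminus D_0$, $$I_+(c)=\int_0^1\frac{dy}{\mathcal H\varphi_+^2},\qquad I_-(c)=\int_{-1}^0\frac{dy}{\mathcal H\varphi_-^2},$$ $$\mathcal D(c)=c^2P(c)I_+(c)I_-(c)-\varphi_+(0,c)^2I_+(c)-\varphi_-(0,c)^2I_-(c).$$ *Boundary quantities.* Let $\sigma_\pm(c)=W_+'(y_{c_\pm})(W_-(y_{c_\pm})-c)-W_-'(y_{c_\pm})(W_+(y_{c_\pm})-c)$, $J_+=[0,1]$, $J_-=[-1,0]$, and for $c\in D_0\setminus\{0,W_+(\pm1),W_-(\pm1)\}$ let $$\Pi_\pm(c)=\int_{J_\pm}\frac1{\mathcal H}\Big(\frac1{\varphi_\pm^2}-1\Big)dy,$$ $$R^1_\pm(c)=\int_{J_\pm}\frac{W_+'(y_{c_\pm})[W_-(y_{c_\pm})-W_-(y)]-W_-'(y_{c_\pm})[W_+(y_{c_\pm})-W_+(y)]}{(W_+(y)-c)(W_-(y)-c)}dy,$$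 $$R^2_\pm(c)=\int_{J_\pm}\Big(\frac{W_+'(y_{c_\pm})-W_+'(y)}{W_+(y)-c}-\frac{W_-'(y_{c_\pm})-W_-'(y)}{W_-(y)-c}\Big)dy,$$ $$I_+^{re}=\Pi_++\frac1{\sigma_+}\Big(R_+^1+R_+^2+\tfrac12\ln\Big(\tfrac{W_+(1)-c}{c-W_-(1)}\Big)^2\Big),\quad I_-^{re}=\Pi_-+\frac1{\sigma_-}\Big(R_-^1+R_-^2+\tfrac12\ln\Big(\tfrac{W_-(-1)-c}{c-W_+(-1)}\Big)^2\Big),$$ let $\chi_+$, $\chi_-$ be the indicator functions of $(W_-(1),W_+(1))$ and $(W_+(-1),W_-(-1))$, and let $$\mathcal D^{re}(c)=c^2P\Big(I_+^{re}I_-^{re}-\frac{\pi^2\chi_+\chi_-}{\sigma_+\sigma_-}\Big)-\varphi_+(0,c)^2I_+^{re}-\varphi_-(0,c)^2I_-^{re},$$ $$\mathcal D^{im}(c)=c^2P\Big(\frac{\pi I_+^{re}\chi_-}{\sigma_-}+\frac{\pi I_-^{re}\chi_+}{\sigma_+}\Big)-\frac{\pi\varphi_+(0,c)^2\chi_+}{\sigma_+}-\frac{\pi\varphi_-(0,c)^2\chi_-}{\sigma_-}.$$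 Finally let $l(x)=\ln(e+|x|^{-1})$. **Proposition.** There are $\epsilon_0\in(0,1)$, $\delta_0>0$ and $C\ge1$ (depending on $u$, $b$, $\alpha$ and the extensions) such that: 1. For every $c\in D_0\setminus\{0,W_+(1),W_-(1),W_+(-1),W_-(-1)\}$ the numbers $\mathcal D^{re}(c),\mathcal D^{im}(c)$ are real, $\lim_{\epsilon\to0^\pm}\mathcal D(c+i\epsilon)=\mathcal D^{re}(c)\pm i\,\mathcal D^{im}(c)$, and $\mathcal D^{re}(c)^2+\mathcal D^{im}(c)^2\ge C^{-1}$. 2. For real $c,\epsilon$ with $|c|<\delta_0$, $0<|\epsilon|<\epsilon_0$ and $c_\epsilon=c+i\epsilon\in\Omega_{\epsilon_0}\setminus D_0$: $|\mathcal D(c_\epsilon)|\ge C^{-1}/|c_\epsilon|$. 3. For every $c_\epsilon\in\Omega_{\epsilon_0}\setminus D_0$: $$|\mathcal D(c_\epsilon)|\ge\frac{l(c_\epsilon-W_-(-1))\,l(W_+(-1)-c_\epsilon)\,l(c_\epsilon-W_-(1))\,l(W_+(1)-c_\epsilon)}{C|c_\epsilon|}.$$ -/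

import Mathlib

open Set Filter Topology

noncomputable section

/-- Admissible monotone `C⁵` extensions `Wp`, `Wm` to `[am, ap] ⊇ [-1, 1]` of `W₊ = u + b` and
`W₋ = u - b`. The end `ap` is where the branch `W₊` (if `W₊(1) < W₋(-1)`) reaches `W₋(-1)` and where
the branch `W₋` (if `W₊(-1) < W₋(1)`) reaches `W₊(-1)`; if neither branch has to be extended to the
right, `ap = 1`. The end `am` is described in the same way. -/
structure WExtension (u b : ℝ → ℝ) where
  am : ℝ
  ap : ℝ
  Wp : ℝ → ℝ
  Wm : ℝ → ℝ
  am_le : am ≤ -1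
  le_ap : 1 ≤ ap
  contDiffOn_Wp : ContDiffOn ℝ 5 Wp (Icc am ap)
  contDiffOn_Wm : ContDiffOn ℝ 5 Wm (Icc am ap)
  Wp_eq : ∀ y ∈ Icc (-1 : ℝ) 1, Wp y = u y + b y
  Wm_eq : ∀ y ∈ Icc (-1 : ℝ) 1, Wm y = u y - b y
  deriv_Wp_pos : ∀ y ∈ Icc am ap, 0 < derivWithin Wp (Icc am ap) y
  deriv_Wm_neg : ∀ y ∈ Icc am ap, derivWithin Wm (Icc am ap) y < 0
  Wp_ap : Wp 1 < Wm (-1) → Wp ap = Wm (-1)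
  Wm_ap : Wp (-1) < Wm 1 → Wm ap = Wp (-1)
  ap_eq : Wm (-1) ≤ Wp 1 → Wm 1 ≤ Wp (-1) → ap = 1
  Wm_am : Wm (-1) < Wp 1 → Wm am = Wp 1
  Wp_am : Wm 1 < Wp (-1) → Wp am = Wm 1
  am_eq : Wp 1 ≤ Wm (-1) → Wp (-1) ≤ Wm 1 → am = -1

/-- `f` is a `C¹` solution on the interval `J` of the (possibly singular) Sturmian Cauchy problem
`(H f')' = α² H f`, `f(y₀) = 1`, `f'(y₀) = 0`; derivatives are one-sided at the ends of `J`. -/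
structure IsSturmSol (α : ℝ) (H : ℝ → ℂ) (J : Set ℝ) (y₀ : ℝ) (f : ℝ → ℂ) : Prop where
  differentiableOn : DifferentiableOn ℝ f J
  continuousOn_deriv : ContinuousOn (derivWithin f J) J
  ode : ∀ y ∈ J,
    HasDerivWithinAt (fun z => H z * derivWithin f J z) ((α : ℂ) ^ 2 * H y * f y) J y
  value : f y₀ = 1
  slope : derivWithin f J y₀ = 0

namespace WExtension

/-- The derivative of the extended `W₊`. -/
def dWp {u b : ℝ → ℝ} (E : WExtension u b) (y : ℝ) : ℝ := derivWithin E.Wp (Icc E.am E.ap) y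

/-- The derivative of the extended `W₋`. -/
def dWm {u b : ℝ → ℝ} (E : WExtension u b) (y : ℝ) : ℝ := derivWithin E.Wm (Icc E.am E.ap) y

/-- The left end of the real segment `D₀`. -/
def cMin {u b : ℝ → ℝ} (E : WExtension u b) : ℝ := min (E.Wm 1) (E.Wp (-1))

/-- The right end of the real segment `D₀`. -/
def cMax {u b : ℝ → ℝ} (E : WExtension u b) : ℝ := max (E.Wp 1) (E.Wm (-1))

/-- The segment `D₀`, as a subset of the complex plane. -/
def D0 {u b : ℝ → ℝ} (E : WExtension u b) : Set ℂ :=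
  {z | ∃ c ∈ Icc E.cMin E.cMax, z = (c : ℂ)}

/-- `D_{ε₀}`: the points `c + i ε` with `c ∈ D₀`, `0 < |ε| < ε₀`. -/
def Dstrip {u b : ℝ → ℝ} (E : WExtension u b) (ε₀ : ℝ) : Set ℂ :=
  {z | ∃ c ∈ Icc E.cMin E.cMax, ∃ ε : ℝ, 0 < |ε| ∧ |ε| < ε₀ ∧ z = (c : ℂ) + (ε : ℂ) * Complex.I}

/-- The left half disc `B^l_{ε₀}`. -/
def Bl {u b : ℝ → ℝ} (E : WExtension u b) (ε₀ : ℝ) : Set ℂ :=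
  {z | ∃ ε θ : ℝ, 0 < ε ∧ ε < ε₀ ∧ Real.pi / 2 ≤ θ ∧ θ ≤ 3 * Real.pi / 2 ∧
    z = (E.cMin : ℂ) + (ε : ℂ) * Complex.exp ((θ : ℂ) * Complex.I)}

/-- The right half disc `B^r_{ε₀}`. -/
def Br {u b : ℝ → ℝ} (E : WExtension u b) (ε₀ : ℝ) : Set ℂ :=
  {z | ∃ ε θ : ℝ, 0 < ε ∧ ε < ε₀ ∧ Real.pi / 2 ≤ θ ∧ θ ≤ 3 * Real.pi / 2 ∧
    z = (E.cMax : ℂ) - (ε : ℂ) * Complex.exp ((θ : ℂ) * Complex.I)}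

/-- The neighbourhood `Ω_{ε₀}` of `D₀`. -/
def Omega {u b : ℝ → ℝ} (E : WExtension u b) (ε₀ : ℝ) : Set ℂ :=
  E.D0 ∪ E.Dstrip ε₀ ∪ E.Bl ε₀ ∪ E.Br ε₀

/-- `c_r`: the real part of `c` above `D₀`, and the corresponding end of `D₀` on the half discs,
that is, the real part clamped to `[cMin, cMax]`. -/
def cr {u b : ℝ → ℝ} (E : WExtension u b) (c : ℂ) : ℝ := max E.cMin (min c.re E.cMax)

/-- `y_{c₊} ∈ [0, ap]`: the zero of `W₊ - c_r` if `c_r ≥ 0`, of `W₋ - c_r` if `c_r ≤ 0`. -/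
def yp {u b : ℝ → ℝ} (E : WExtension u b) (c : ℂ) : ℝ :=
  if 0 ≤ E.cr c then Function.invFunOn E.Wp (Icc 0 E.ap) (E.cr c)
  else Function.invFunOn E.Wm (Icc 0 E.ap) (E.cr c)

/-- `y_{c₋} ∈ [am, 0]`: the zero of `W₋ - c_r` if `c_r ≥ 0`, of `W₊ - c_r` if `c_r ≤ 0`. -/
def ym {u b : ℝ → ℝ} (E : WExtension u b) (c : ℂ) : ℝ :=
  if 0 ≤ E.cr c then Function.invFunOn E.Wm (Icc E.am 0) (E.cr c)
  else Function.invFunOn E.Wp (Icc E.am 0) (E.cr c)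

/-- `𝓗(y, c) = (W₊(y) - c) (W₋(y) - c)`. -/
def H {u b : ℝ → ℝ} (E : WExtension u b) (c : ℂ) (y : ℝ) : ℂ :=
  ((E.Wp y : ℂ) - c) * ((E.Wm y : ℂ) - c)

/-- The interval spanned by `[0, 1]` and `y_{c₊}`. -/
def Jp {u b : ℝ → ℝ} (E : WExtension u b) (c : ℂ) : Set ℝ := Icc 0 (max 1 (E.yp c))

/-- The interval spanned by `[-1, 0]` and `y_{c₋}`. -/
def Jm {u b : ℝ → ℝ} (E : WExtension u b) (c : ℂ) : Set ℝ := Icc (min (-1) (E.ym c)) 0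

/-- `φ₊(·, c)`: the solution on `Jp` of `(𝓗 φ')' = α² 𝓗 φ`, `φ(y_{c₊}) = 1`, `φ'(y_{c₊}) = 0`.
(The operator `Classical.epsilon` picks a function satisfying the predicate when there is one.) -/
def phip {u b : ℝ → ℝ} (E : WExtension u b) (α : ℝ) (c : ℂ) : ℝ → ℂ :=
  Classical.epsilon fun f => IsSturmSol α (E.H c) (E.Jp c) (E.yp c) f

/-- `φ₋(·, c)`: the solution on `Jm` of `(𝓗 φ')' = α² 𝓗 φ`, `φ(y_{c₋}) = 1`, `φ'(y_{c₋}) = 0`. -/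
def phim {u b : ℝ → ℝ} (E : WExtension u b) (α : ℝ) (c : ℂ) : ℝ → ℂ :=
  Classical.epsilon fun f => IsSturmSol α (E.H c) (E.Jm c) (E.ym c) f

/-- `I₊(c)`. -/
def Ip {u b : ℝ → ℝ} (E : WExtension u b) (α : ℝ) (c : ℂ) : ℂ :=
  ∫ y in (0 : ℝ)..1, 1 / (E.H c y * E.phip α c y ^ 2)

/-- `I₋(c)`. -/
def Im {u b : ℝ → ℝ} (E : WExtension u b) (α : ℝ) (c : ℂ) : ℂ :=
  ∫ y in (-1 : ℝ)..0, 1 / (E.H c y * E.phim α c y ^ 2)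

/-- `P(c) = φ₋(0,c)² (φ₊ ∂φ₊)(0,c) - φ₊(0,c)² (φ₋ ∂φ₋)(0,c)`. -/
def P {u b : ℝ → ℝ} (E : WExtension u b) (α : ℝ) (c : ℂ) : ℂ :=
  E.phim α c 0 ^ 2 * (E.phip α c 0 * derivWithin (E.phip α c) (E.Jp c) 0)
    - E.phip α c 0 ^ 2 * (E.phim α c 0 * derivWithin (E.phim α c) (E.Jm c) 0)

/-- The Wronskian `𝓓(c)`. -/
def wronskian {u b : ℝ → ℝ} (E : WExtension u b) (α : ℝ) (c : ℂ) : ℂ :=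
  c ^ 2 * E.P α c * E.Ip α c * E.Im α c
    - E.phip α c 0 ^ 2 * E.Ip α c - E.phim α c 0 ^ 2 * E.Im α c

/-- `σ₊(c)`. -/
def sigmap {u b : ℝ → ℝ} (E : WExtension u b) (c : ℂ) : ℂ :=
  (E.dWp (E.yp c) : ℂ) * ((E.Wm (E.yp c) : ℂ) - c)
    - (E.dWm (E.yp c) : ℂ) * ((E.Wp (E.yp c) : ℂ) - c)

/-- `σ₋(c)`. -/
def sigmam {u b : ℝ → ℝ} (E : WExtension u b) (c : ℂ) : ℂ :=
  (E.dWp (E.ym c) : ℂ) * ((E.Wm (E.ym c) : ℂ) - c)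
    - (E.dWm (E.ym c) : ℂ) * ((E.Wp (E.ym c) : ℂ) - c)

/-- `Π₊(c)`. -/
def Pip {u b : ℝ → ℝ} (E : WExtension u b) (α : ℝ) (c : ℂ) : ℂ :=
  ∫ y in (0 : ℝ)..1, 1 / E.H c y * (1 / E.phip α c y ^ 2 - 1)

/-- `Π₋(c)`. -/
def Pim {u b : ℝ → ℝ} (E : WExtension u b) (α : ℝ) (c : ℂ) : ℂ :=
  ∫ y in (-1 : ℝ)..0, 1 / E.H c y * (1 / E.phim α c y ^ 2 - 1)

/-- `R₊¹(c)`, for real `c`. -/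
def Rp1 {u b : ℝ → ℝ} (E : WExtension u b) (c : ℝ) : ℝ :=
  ∫ y in (0 : ℝ)..1,
    (E.dWp (E.yp c) * (E.Wm (E.yp c) - E.Wm y) - E.dWm (E.yp c) * (E.Wp (E.yp c) - E.Wp y))
      / ((E.Wp y - c) * (E.Wm y - c))

/-- `R₊²(c)`, for real `c`. -/
def Rp2 {u b : ℝ → ℝ} (E : WExtension u b) (c : ℝ) : ℝ :=
  ∫ y in (0 : ℝ)..1,
    ((E.dWp (E.yp c) - E.dWp y) / (E.Wp y - c) - (E.dWm (E.yp c) - E.dWm y) / (E.Wm y - c))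

/-- `R₋¹(c)`, for real `c`. -/
def Rm1 {u b : ℝ → ℝ} (E : WExtension u b) (c : ℝ) : ℝ :=
  ∫ y in (-1 : ℝ)..0,
    (E.dWp (E.ym c) * (E.Wm (E.ym c) - E.Wm y) - E.dWm (E.ym c) * (E.Wp (E.ym c) - E.Wp y))
      / ((E.Wp y - c) * (E.Wm y - c))

/-- `R₋²(c)`, for real `c`. -/
def Rm2 {u b : ℝ → ℝ} (E : WExtension u b) (c : ℝ) : ℝ :=
  ∫ y in (-1 : ℝ)..0,
    ((E.dWp (E.ym c) - E.dWp y) / (E.Wp y - c) - (E.dWm (E.ym c) - E.dWm y) / (E.Wm y - c))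

open Classical in
/-- `χ₊`: the indicator function of `(W₋(1), W₊(1))`. -/
def chip {u b : ℝ → ℝ} (E : WExtension u b) (c : ℝ) : ℂ :=
  if c ∈ Ioo (E.Wm 1) (E.Wp 1) then 1 else 0

open Classical in
/-- `χ₋`: the indicator function of `(W₊(-1), W₋(-1))`. -/
def chim {u b : ℝ → ℝ} (E : WExtension u b) (c : ℝ) : ℂ :=
  if c ∈ Ioo (E.Wp (-1)) (E.Wm (-1)) then 1 else 0

/-- `I₊^re(c)`, for real `c`. -/
def Ipre {u b : ℝ → ℝ} (E : WExtension u b) (α : ℝ) (c : ℝ) : ℂ :=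
  E.Pip α c + 1 / E.sigmap c *
    ((E.Rp1 c + E.Rp2 c + 1 / 2 * Real.log (((E.Wp 1 - c) / (c - E.Wm 1)) ^ 2) : ℝ) : ℂ)

/-- `I₋^re(c)`, for real `c`. -/
def Imre {u b : ℝ → ℝ} (E : WExtension u b) (α : ℝ) (c : ℝ) : ℂ :=
  E.Pim α c + 1 / E.sigmam c *
    ((E.Rm1 c + E.Rm2 c + 1 / 2 * Real.log (((E.Wm (-1) - c) / (c - E.Wp (-1))) ^ 2) : ℝ) : ℂ)

/-- `𝓓^re(c)`, for real `c`, as a complex number (with imaginary part zero on the segment). -/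
def Dre {u b : ℝ → ℝ} (E : WExtension u b) (α : ℝ) (c : ℝ) : ℂ :=
  (c : ℂ) ^ 2 * E.P α c *
      (E.Ipre α c * E.Imre α c
        - (Real.pi : ℂ) ^ 2 * E.chip c * E.chim c / (E.sigmap c * E.sigmam c))
    - E.phip α c 0 ^ 2 * E.Ipre α c - E.phim α c 0 ^ 2 * E.Imre α c

/-- `𝓓^im(c)`, for real `c`, as a complex number (with imaginary part zero on the segment). -/
def Dim {u b : ℝ → ℝ} (E : WExtension u b) (α : ℝ) (c : ℝ) : ℂ :=
  (c : ℂ) ^ 2 * E.P α c *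
      ((Real.pi : ℂ) * E.Ipre α c * E.chim c / E.sigmam c
        + (Real.pi : ℂ) * E.Imre α c * E.chip c / E.sigmap c)
    - (Real.pi : ℂ) * E.phip α c 0 ^ 2 * E.chip c / E.sigmap c
    - (Real.pi : ℂ) * E.phim α c 0 ^ 2 * E.chim c / E.sigmam c

end WExtension

/-- `l(x) = ln (e + |x|⁻¹)`. -/
def logWeight (x : ℂ) : ℝ := Real.log (Real.exp 1 + ‖x‖⁻¹)

end

/-!
The two halves `y ≥ 0` and `y ≤ 0` of the channel only meet at `y = 0`, and each can be put into the
same form: a branch `p` increases and a branch `m` decreases from `p 0 = m 0 = 0` on `[0, L]`, and `c`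
has nonnegative real part (`HalfProfile`). The side `c_r ≤ 0` is the side `c_r ≥ 0` for the profile
`-u` and the point `-c` (`WExtension.negate`). For one half let `f` be the regular solution with
critical point `yc`, `H = (p - c) (m - c)`, `X = f(0)² ∫₀¹ 1 / (H f²)` and `A = -c² f'(0) / f(0)`. Then
`-𝓓 = X₁ X₂ (A₁ + A₂) + X₁ + X₂` (`reducedWronskian`), and the proof bounds this from below.

*Regular solutions.* Although `H` may vanish at `yc`, it is monotone in modulus away from `yc` up to a
constant factor, uniformly in `c` and also as `c → 0`. So the equation is a regular Volterra equation
(`SturmKernel`), and `f` and `f'` are bounded uniformly. Since `p` increases and `m` decreases,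
`Re (H(s) / H(t)) ≥ 0` for `s` between `yc` and `t`; the energy identity then gives `1 ≤ |f|`
(`HalfProfile.exists_regularBounds`).

*Flux.* For non-real `c` the function `g = f ∫_y^1 1 / (H f²)` solves the equation and vanishes at
`1`, and `Im (c̄ H) = Im c (|c|² - p m)` has the sign of `Im c` because `p m ≤ 0`. The imaginary part of
`c̄` times the energy identity of `g` shows that `Im (c̄ B)`, with `B = |X|² A + X̄`, has the sign of
`Im c`. If `yc` lies in `[0, 1]`, then `|g'|` is comparable to `1 / |H|` on an interval of length
`|Im c|` next to `yc`, and this bounds `|Im (c̄ B)|` below uniformly (`HalfProfile.exists_halfB_im_ge`). Because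
`-𝓓 conj (X₁ X₂) = |X₂|² B₁ + |X₁|² B₂`, the two fluxes add up without cancellation
(`flux_le_reducedWronskian`): with both critical points in `[0, 1]` the inequality between arithmetic
and geometric mean yields `|c| |𝓓| ≥ 2 n₀`, near the origin as well, and with one of them there
`|c| |𝓓|` dominates `|X₁| / |X₂|`.

*End points.* Away from the origin, `σ I` is the sum of bounded integrals and
`log (c - p 1) - log (c - m 1)` (`HalfProfile.sigma_mul_halfI`), hence `|X|` is comparable to the
logarithmic weight near `p 1` and bounded elsewhere. There `Re A` is bounded below by the energy of `f`
on `[0, yc]` (`HalfProfile.exists_halfA_re_ge`), and beyond `p 1` the number `X` is nearly positive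
(`HalfProfile.exists_halfX_re_ge`), so the largest terms of `-𝓓` cannot cancel. Combined with the flux,
this gives the weighted lower bound off the segment (`HalfProfile.exists_lower_bound`).

*Boundary values.* In the same splitting the integrals converge by bounded convergence as `c` approaches
the real axis, with continuous dependence of `f` on `c`, and the logarithm has the boundary values
`ln |c - p 1| ± i π` for `c < p 1` (`HalfProfile.tendsto_halfI`). The logarithmic weights are at least
`1`, so the bound near the origin and the bound for the boundary values follow from the weighted one.
-/

/-! ### Calculus on a compact interval -/

section Calculus

variable {F : Type*} [NormedAddCommGroup F] [NormedSpace ℝ F]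

theorem hasDerivWithinAt_primitive [CompleteSpace F] {h : ℝ → F} {a b y₀ t : ℝ} (hh : ContinuousOn h (Icc a b))
    (h0 : y₀ ∈ Icc a b) (ht : t ∈ Icc a b) :
    HasDerivWithinAt (fun x => ∫ s in y₀..x, h s) (h t) (Icc a b) t := by
  have : Fact (t ∈ Icc a b) := ⟨ht⟩
  refine intervalIntegral.integral_hasDerivWithinAt_right ?_ ?_ (hh t ht)
  · exact (hh.mono (uIcc_subset_Icc h0 ht)).intervalIntegrable
  · exact ⟨Icc a b, self_mem_nhdsWithin, hh.aestronglyMeasurable measurableSet_Icc⟩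

theorem integral_eq_sub_of_hasDerivWithinAt_Icc [CompleteSpace F] {f f' : ℝ → F} {a b x y : ℝ}
    (hf : ∀ t ∈ Icc a b, HasDerivWithinAt f (f' t) (Icc a b) t) (hc : ContinuousOn f' (Icc a b))
    (hx : x ∈ Icc a b) (hy : y ∈ Icc a b) : ∫ t in x..y, f' t = f y - f x := by
  have key : ∀ x ∈ Icc a b, ∀ y ∈ Icc a b, x ≤ y → ∫ t in x..y, f' t = f y - f x := by
    intro x hx y hy hxy
    have hsub : Icc x y ⊆ Icc a b := Icc_subset_Icc hx.1 hy.2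
    refine intervalIntegral.integral_eq_sub_of_hasDerivAt_of_le hxy
      (fun t ht => ((hf t (hsub ht)).continuousWithinAt).mono hsub) (fun t ht => ?_)
      (by rw [← uIcc_of_le hxy] at hsub; exact (hc.mono hsub).intervalIntegrable)
    exact (hf t (hsub (Ioo_subset_Icc_self ht))).hasDerivAt
      (Icc_mem_nhds (hx.1.trans_lt ht.1) (ht.2.trans_le hy.2))
  rcases le_total x y with h | h
  · exact key x hx y hy h
  · rw [intervalIntegral.integral_symm, key y hy x hx h, neg_sub]

/-- A weighted form of Grönwall's inequality: a nonnegative function on a compact set obeys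
`g ≤ 2 A w` as soon as every bound `g ≤ m w` improves itself to `g ≤ A + (m / 2) w`. -/
theorem le_two_mul_of_improve {g w : ℝ → ℝ} {s : Set ℝ} (hs : IsCompact s)
    (hg : ContinuousOn g s) (hw : ContinuousOn w s) (hw1 : ∀ t ∈ s, 1 ≤ w t)
    (hg0 : ∀ t ∈ s, 0 ≤ g t) {A : ℝ}
    (h : ∀ m, 0 ≤ m → (∀ t ∈ s, g t ≤ m * w t) → ∀ y ∈ s, g y ≤ A + m / 2 * w y) :
    ∀ y ∈ s, g y ≤ 2 * A * w y := by
  intro y hy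
  obtain ⟨z, hz, hmax⟩ := hs.exists_isMaxOn ⟨y, hy⟩
    (hg.div hw fun t ht => (zero_lt_one.trans_le (hw1 t ht)).ne')
  have hwz := hw1 z hz
  have hwy := hw1 y hy
  set m := g z / w z with hm
  have hm0 : 0 ≤ m := div_nonneg (hg0 z hz) (by linarith)
  have hle : ∀ t ∈ s, g t ≤ m * w t := fun t ht =>
    (div_le_iff₀ (zero_lt_one.trans_le (hw1 t ht))).1 (hmax ht)
  have h1 := h m hm0 hle z hz
  have h2 : g z = m * w z := by rw [hm, div_mul_cancel₀ _ (by linarith)]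
  have h3 : m ≤ 2 * A := by nlinarith
  exact (hle y hy).trans (by gcongr)

/-- Integration gains a factor `1 / l` in the norm weighted by `exp (l |t - y₀|)`. -/
theorem norm_integral_le_exp_weight {g : ℝ → F} {y₀ y m l : ℝ} (hl : 0 < l) (hm : 0 ≤ m)
    (hg : ∀ t ∈ uIcc y₀ y, ‖g t‖ ≤ m * Real.exp (l * |t - y₀|)) :
    ‖∫ t in y₀..y, g t‖ ≤ m / l * Real.exp (l * |y - y₀|) := by
  have hexp : ∀ t ∈ uIcc y₀ y, |t - y₀| ≤ |y - y₀| := fun t ht => by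
    simpa [abs_sub_comm] using abs_sub_left_of_mem_uIcc ht
  rcases le_total y₀ y with h | h
  · have hd : ∀ t ∈ uIcc y₀ y, HasDerivAt (fun t => m / l * Real.exp (l * (t - y₀)))
        (m * Real.exp (l * (t - y₀))) t := fun t _ => by
      have := ((((hasDerivAt_id t).sub_const y₀).const_mul l).exp).const_mul (m / l)
      exact this.congr_deriv (by field_simp; rfl)
    have hi := intervalIntegral.integral_eq_sub_of_hasDerivAt hd
      (by apply Continuous.intervalIntegrable; fun_prop)
    have hb := intervalIntegral.norm_integral_le_of_norm_le (μ := MeasureTheory.volume) h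
      (f := g) (g := fun t => m * Real.exp (l * (t - y₀)))
      (Eventually.of_forall fun t ht => by
        have := hg t (by rw [uIcc_of_le h]; exact Ioc_subset_Icc_self ht)
        rwa [abs_of_nonneg (by linarith [ht.1])] at this)
      (by apply Continuous.intervalIntegrable; fun_prop)
    rw [hi] at hb
    rw [abs_of_nonneg (by linarith)]
    have : 0 ≤ m / l * Real.exp (l * (y₀ - y₀)) := by positivity
    linarith
  · have hd : ∀ t ∈ uIcc y y₀, HasDerivAt (fun t => -(m / l * Real.exp (l * (y₀ - t))))
        (m * Real.exp (l * (y₀ - t))) t := fun t _ => by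
      have := ((((hasDerivAt_id t).const_sub y₀).const_mul l).exp).const_mul (m / l)
      exact this.neg.congr_deriv (by field_simp; rfl)
    have hi := intervalIntegral.integral_eq_sub_of_hasDerivAt hd
      (by apply Continuous.intervalIntegrable; fun_prop)
    have hb := intervalIntegral.norm_integral_le_of_norm_le (μ := MeasureTheory.volume) h
      (f := g) (g := fun t => m * Real.exp (l * (y₀ - t)))
      (Eventually.of_forall fun t ht => by
        have := hg t (by rw [uIcc_of_ge h]; exact Ioc_subset_Icc_self ht)
        rwa [abs_of_nonpos (by linarith [ht.2]), neg_sub] at this)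
      (by apply Continuous.intervalIntegrable; fun_prop)
    rw [hi] at hb
    rw [intervalIntegral.integral_symm, norm_neg, abs_of_nonpos (by linarith), neg_sub]
    have : 0 ≤ m / l * Real.exp (l * (y₀ - y₀)) := by positivity
    linarith

end Calculus

/-! ### The singular Sturm problem as a Volterra equation -/

/-- A coefficient `H` on `[a, b]` which vanishes at most at `y₀` and is, up to the factor `K`,
monotone in modulus away from `y₀`. This makes `(H f')' = α² H f`, `f'(y₀) = 0`, a regular Volterra
equation even when `H y₀ = 0`. -/
structure SturmKernel (H : ℝ → ℂ) (a b y₀ K : ℝ) : Prop where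
  lt : a < b
  mem : y₀ ∈ Icc a b
  nonneg : 0 ≤ K
  cont : ContinuousOn H (Icc a b)
  ne : ∀ y ∈ Icc a b, y ≠ y₀ → H y ≠ 0
  ratio : ∀ y ∈ Icc a b, ∀ s ∈ uIcc y₀ y, ‖H s‖ ≤ K * ‖H y‖

/-- The Volterra operator `f ↦ H⁻¹ ∫_{y₀} H f`, which sends a solution `f` to `α⁻² f'`. -/
noncomputable def volterra (H : ℝ → ℂ) (y₀ : ℝ) (f : ℝ → ℂ) (t : ℝ) : ℂ :=
  (∫ s in y₀..t, H s * f s) / H t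

namespace SturmKernel

variable {H : ℝ → ℂ} {a b y₀ K : ℝ}

theorem uIcc_subset (k : SturmKernel H a b y₀ K) {t : ℝ} (ht : t ∈ Icc a b) :
    uIcc y₀ t ⊆ Icc a b := uIcc_subset_Icc k.mem ht

theorem norm_volterra_le (k : SturmKernel H a b y₀ K) {f : ℝ → ℂ} {t M : ℝ} (ht : t ∈ Icc a b)
    (hf : ∀ s ∈ uIcc y₀ t, ‖f s‖ ≤ M) : ‖volterra H y₀ f t‖ ≤ K * M * |t - y₀| := by
  by_cases h : t = y₀
  · simp [volterra, h]
  have hH : 0 < ‖H t‖ := norm_pos_iff.2 (k.ne t ht h)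
  rw [volterra, norm_div, div_le_iff₀ hH]
  have := intervalIntegral.norm_integral_le_of_norm_le_const (a := y₀) (b := t)
    (f := fun s => H s * f s) (C := K * ‖H t‖ * M) (fun s hs => by
      have hs' := uIoc_subset_uIcc hs
      rw [norm_mul]
      exact mul_le_mul (k.ratio t ht s hs') (hf s hs') (norm_nonneg _)
        (mul_nonneg k.nonneg hH.le))
  linarith

theorem volterra_sub (k : SturmKernel H a b y₀ K) {f g : ℝ → ℂ} {t : ℝ} (ht : t ∈ Icc a b)
    (hf : ContinuousOn f (Icc a b)) (hg : ContinuousOn g (Icc a b)) :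
    volterra H y₀ f t - volterra H y₀ g t = volterra H y₀ (fun s => f s - g s) t := by
  have hs := k.uIcc_subset ht
  rw [volterra, volterra, volterra, ← sub_div, ← intervalIntegral.integral_sub]
  · simp only [mul_sub]
  · exact ((k.cont.mul hf).mono hs).intervalIntegrable
  · exact ((k.cont.mul hg).mono hs).intervalIntegrable

/-- At `y₀`, where the quotient is singular and has the junk value `0`, continuity follows from
`norm_volterra_le`. -/
theorem continuousOn_volterra (k : SturmKernel H a b y₀ K) {f : ℝ → ℂ}
    (hf : ContinuousOn f (Icc a b)) : ContinuousOn (volterra H y₀ f) (Icc a b) := by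
  intro t ht
  by_cases h : t = y₀
  · subst h
    obtain ⟨M, hM⟩ := isCompact_Icc.exists_bound_of_continuousOn hf
    have h0 : volterra H t f t = 0 := by simp [volterra]
    rw [ContinuousWithinAt, h0]
    refine squeeze_zero_norm' (a := fun s => K * M * |s - t|) ?_ ?_
    · filter_upwards [self_mem_nhdsWithin] with s hs
      exact k.norm_volterra_le hs fun x hx => hM x (k.uIcc_subset hs hx)
    · have : Continuous fun s => K * M * |s - t| := by fun_prop
      simpa using (this.tendsto t).mono_left nhdsWithin_le_nhds
  · exact ((hasDerivWithinAt_primitive (k.cont.mul hf) k.mem ht).continuousWithinAt).div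
      (k.cont t ht) (k.ne t ht h)

/-- In the norm weighted by `exp (l |t - y₀|)` the Volterra map `f ↦ α² ∫ volterra f` has norm at
most `1 / 2`. -/
theorem norm_integral_volterra_le (k : SturmKernel H a b y₀ K) (α : ℝ) {f : ℝ → ℂ} {m y l : ℝ}
    (hl : l = 2 * (α ^ 2 * K * (b - a)) + 1) (hm : 0 ≤ m) (hy : y ∈ Icc a b)
    (hf : ∀ s ∈ Icc a b, ‖f s‖ ≤ m * Real.exp (l * |s - y₀|)) :
    ‖(α : ℂ) ^ 2 * ∫ t in y₀..y, volterra H y₀ f t‖ ≤ m / 2 * Real.exp (l * |y - y₀|) := by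
  have hab := k.lt
  have hK := k.nonneg
  have h1 : 0 ≤ α ^ 2 * K * (b - a) := by
    have : 0 ≤ b - a := by linarith
    positivity
  have hl0 : 0 < l := by linarith
  have h2 : ‖∫ t in y₀..y, volterra H y₀ f t‖
      ≤ (K * m * (b - a)) / l * Real.exp (l * |y - y₀|) := by
    refine norm_integral_le_exp_weight hl0 (by
      have : 0 ≤ b - a := by linarith
      positivity) fun t ht => ?_
    have ht' := k.uIcc_subset hy ht
    refine (k.norm_volterra_le (M := m * Real.exp (l * |t - y₀|)) ht' fun s hs => ?_).trans ?_
    · refine (hf s (k.uIcc_subset ht' hs)).trans ?_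
      have : |s - y₀| ≤ |t - y₀| := by simpa [abs_sub_comm] using abs_sub_left_of_mem_uIcc hs
      gcongr
    · have : |t - y₀| ≤ b - a := by
        rw [abs_le]; constructor <;> linarith [ht'.1, ht'.2, k.mem.1, k.mem.2]
      calc K * (m * Real.exp (l * |t - y₀|)) * |t - y₀|
          ≤ K * (m * Real.exp (l * |t - y₀|)) * (b - a) := by gcongr
        _ = _ := by ring
  rw [norm_mul, norm_pow, Complex.norm_real, Real.norm_eq_abs, sq_abs]
  calc α ^ 2 * ‖∫ t in y₀..y, volterra H y₀ f t‖
      ≤ α ^ 2 * ((K * m * (b - a)) / l * Real.exp (l * |y - y₀|)) := by gcongr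
    _ = (α ^ 2 * K * (b - a) / l) * m * Real.exp (l * |y - y₀|) := by ring
    _ ≤ (1 / 2) * m * Real.exp (l * |y - y₀|) := by
        have : α ^ 2 * K * (b - a) / l ≤ 1 / 2 := by
          rw [div_le_div_iff₀ hl0 two_pos]; linarith
        gcongr
    _ = _ := by ring

/-- The solution is the fixed point of the Volterra equation, found as the fixed point of a
contraction of `C([a, b])` after division by the weight `exp (l |y - y₀|)`. -/
theorem exists_isSturmSol (k : SturmKernel H a b y₀ K) (α : ℝ) :
    ∃ f, IsSturmSol α H (Icc a b) y₀ f := by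
  have hab := k.lt.le
  obtain ⟨l, hl⟩ : ∃ l, l = 2 * (α ^ 2 * K * (b - a)) + 1 := ⟨_, rfl⟩
  set w : ℝ → ℂ := fun s => (Real.exp (l * |s - y₀|) : ℂ) with hw
  have hwc : Continuous w := by fun_prop
  have hwne : ∀ s, w s ≠ 0 := fun s => by simp [hw]
  have hwn : ∀ s, ‖w s‖ = Real.exp (l * |s - y₀|) := fun s => by
    simp only [hw, Complex.norm_real, Real.norm_eq_abs, Real.abs_exp]
  -- `ext g` is `w g`, extended to the line by constants in `g`; `S` is the Volterra map applied to
  -- it, and `T` is the Volterra map conjugated by the weight.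
  let ext : C(Icc a b, ℂ) → ℝ → ℂ := fun g s => w s * g (projIcc a b hab s)
  have hext : ∀ g, Continuous (ext g) := fun g =>
    hwc.mul (g.continuous.comp continuous_projIcc)
  let S : C(Icc a b, ℂ) → ℝ → ℂ := fun g y =>
    1 + (α : ℂ) ^ 2 * ∫ t in y₀..y, volterra H y₀ (ext g) t
  have hSd : ∀ g, ∀ t ∈ Icc a b,
      HasDerivWithinAt (S g) ((α : ℂ) ^ 2 * volterra H y₀ (ext g) t) (Icc a b) t := fun g t ht =>
    ((hasDerivWithinAt_primitive (k.continuousOn_volterra (hext g).continuousOn) k.mem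
      ht).const_mul _).const_add _
  have hSc : ∀ g, ContinuousOn (S g) (Icc a b) := fun g t ht => (hSd g t ht).continuousWithinAt
  let T : C(Icc a b, ℂ) → C(Icc a b, ℂ) := fun g =>
    ⟨fun y => (w y)⁻¹ * S g y, by
      refine Continuous.mul ?_ (continuousOn_iff_continuous_domRestrict.1 (hSc g))
      exact (hwc.inv₀ hwne).comp continuous_subtype_val⟩
  have hT : ContractingWith (1 / 2) T := by
    refine ⟨by rw [← NNReal.coe_lt_coe]; norm_num, LipschitzWith.of_dist_le_mul fun g₁ g₂ => ?_⟩
    refine (ContinuousMap.dist_le (by positivity)).2 fun y => ?_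
    have hv : S g₁ y - S g₂ y
        = (α : ℂ) ^ 2 * ∫ t in y₀..(y : ℝ), volterra H y₀ (fun s => ext g₁ s - ext g₂ s) t := by
      have hy := k.uIcc_subset y.2
      have e : ∫ t in y₀..(y : ℝ), volterra H y₀ (fun s => ext g₁ s - ext g₂ s) t
          = ∫ t in y₀..(y : ℝ), (volterra H y₀ (ext g₁) t - volterra H y₀ (ext g₂) t) := by
        refine intervalIntegral.integral_congr fun t ht => ?_
        exact (k.volterra_sub (hy ht) (hext g₁).continuousOn (hext g₂).continuousOn).symm
      rw [e, intervalIntegral.integral_sub]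
      · simp only [S]; ring
      · exact ((k.continuousOn_volterra (hext g₁).continuousOn).mono hy).intervalIntegrable
      · exact ((k.continuousOn_volterra (hext g₂).continuousOn).mono hy).intervalIntegrable
    have hb := k.norm_integral_volterra_le α (f := fun s => ext g₁ s - ext g₂ s)
      (m := dist g₁ g₂) hl dist_nonneg y.2 (fun s hs => by
        simp only [ext]
        rw [← mul_sub, norm_mul, hwn, mul_comm, ← dist_eq_norm]
        gcongr
        exact ContinuousMap.dist_apply_le_dist _)
    change dist ((w y)⁻¹ * S g₁ y) ((w y)⁻¹ * S g₂ y) ≤ _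
    rw [dist_eq_norm, ← mul_sub, hv, norm_mul, norm_inv, hwn]
    have hpos : 0 < Real.exp (l * |(y : ℝ) - y₀|) := Real.exp_pos _
    rw [inv_mul_le_iff₀ hpos]
    calc _ ≤ _ := hb
      _ = _ := by push_cast; ring
  have : Nonempty (C(Icc a b, ℂ)) := ⟨0⟩
  set g := ContractingWith.fixedPoint T hT
  have hg : T g = g := hT.fixedPoint_isFixedPt
  -- The fixed point equation says that `ext g` and `S g` agree on `[a, b]`.
  have hfix : ∀ y ∈ Icc a b, ext g y = S g y := fun y hy => by
    have := congrArg (fun h : C(Icc a b, ℂ) => h ⟨y, hy⟩) hg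
    simp only [T, ContinuousMap.coe_mk] at this
    simp only [ext, projIcc_of_mem hab hy]
    rw [← this, mul_inv_cancel_left₀ (hwne y)]
  have hdw : ∀ t ∈ Icc a b, derivWithin (S g) (Icc a b) t = (α : ℂ) ^ 2 * volterra H y₀ (ext g) t :=
    fun t ht => (hSd g t ht).derivWithin (uniqueDiffOn_Icc k.lt t ht)
  refine ⟨S g, fun t ht => (hSd g t ht).differentiableWithinAt, ?_, fun t ht => ?_, ?_, ?_⟩
  · exact ((k.continuousOn_volterra (hext g).continuousOn).const_smul ((α : ℂ) ^ 2)).congr hdw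
  · have h1 := (hasDerivWithinAt_primitive
      (k.cont.mul (hext g).continuousOn) k.mem ht).const_mul ((α : ℂ) ^ 2)
    rw [mul_assoc, ← hfix t ht]
    refine h1.congr_of_mem (fun s hs => ?_) ht
    rw [hdw s hs, volterra]
    by_cases h : s = y₀
    · simp [h]
    · have := k.ne s hs h
      field_simp
      rfl
  · simp [S]
  · rw [hdw y₀ k.mem]; simp [volterra]

end SturmKernel

namespace IsSturmSol

variable {H : ℝ → ℂ} {α a b y₀ K : ℝ} {f : ℝ → ℂ}

theorem continuousOn {J : Set ℝ} (hf : IsSturmSol α H J y₀ f) : ContinuousOn f J :=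
  hf.differentiableOn.continuousOn

theorem hasDerivWithinAt {J : Set ℝ} (hf : IsSturmSol α H J y₀ f) {t : ℝ} (ht : t ∈ J) :
    HasDerivWithinAt f (derivWithin f J t) J t :=
  (hf.differentiableOn t ht).hasDerivWithinAt

theorem derivWithin_eq (hf : IsSturmSol α H (Icc a b) y₀ f) (k : SturmKernel H a b y₀ K)
    {t : ℝ} (ht : t ∈ Icc a b) :
    derivWithin f (Icc a b) t = (α : ℂ) ^ 2 * volterra H y₀ f t := by
  by_cases h : t = y₀
  · rw [h, hf.slope]; simp [volterra]
  have h1 := integral_eq_sub_of_hasDerivWithinAt_Icc hf.ode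
    ((continuousOn_const.mul k.cont).mul hf.continuousOn) k.mem ht
  rw [hf.slope, mul_zero, sub_zero] at h1
  simp only [mul_assoc] at h1
  rw [intervalIntegral.integral_const_mul] at h1
  rw [volterra, ← mul_div_assoc, h1, mul_div_cancel_left₀ _ (k.ne t ht h)]

theorem eq_volterra (hf : IsSturmSol α H (Icc a b) y₀ f) (k : SturmKernel H a b y₀ K)
    {y : ℝ} (hy : y ∈ Icc a b) :
    f y = 1 + (α : ℂ) ^ 2 * ∫ t in y₀..y, volterra H y₀ f t := by
  have h1 := integral_eq_sub_of_hasDerivWithinAt_Icc (fun t ht => hf.hasDerivWithinAt ht)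
    hf.continuousOn_deriv k.mem hy
  rw [hf.value] at h1
  rw [← intervalIntegral.integral_const_mul, ← intervalIntegral.integral_congr (f := fun t =>
    derivWithin f (Icc a b) t) (fun t ht => hf.derivWithin_eq k (k.uIcc_subset hy ht)), h1]
  ring

/-- The exponential bound for solutions of the Volterra equation with a bounded forcing. -/
theorem _root_.SturmKernel.norm_le_of_volterra (k : SturmKernel H a b y₀ K) (α : ℝ) {d : ℝ → ℂ}
    {A : ℝ} (hd : ContinuousOn d (Icc a b))
    (h : ∀ y ∈ Icc a b, ‖d y - (α : ℂ) ^ 2 * ∫ t in y₀..y, volterra H y₀ d t‖ ≤ A) :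
    ∀ y ∈ Icc a b, ‖d y‖ ≤ 2 * A * Real.exp ((2 * (α ^ 2 * K * (b - a)) + 1) * (b - a)) := by
  obtain ⟨l, hl⟩ : ∃ l, l = 2 * (α ^ 2 * K * (b - a)) + 1 := ⟨_, rfl⟩
  have hba : 0 ≤ b - a := by linarith [k.lt]
  have hK := k.nonneg
  have hl0 : 0 ≤ l := by rw [hl]; positivity
  intro y hy
  have hA : 0 ≤ A := (norm_nonneg _).trans (h y hy)
  have := le_two_mul_of_improve (A := A) (g := fun y => ‖d y‖)
    (w := fun y => Real.exp (l * |y - y₀|)) isCompact_Icc hd.norm (by fun_prop)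
    (fun t _ => Real.one_le_exp (by positivity)) (fun t _ => norm_nonneg _)
    (fun m hm hle y hy => by
      have h1 := k.norm_integral_volterra_le α hl hm hy hle
      calc ‖d y‖ = ‖(d y - (α : ℂ) ^ 2 * ∫ t in y₀..y, volterra H y₀ d t)
            + (α : ℂ) ^ 2 * ∫ t in y₀..y, volterra H y₀ d t‖ := by rw [sub_add_cancel]
        _ ≤ _ := (norm_add_le _ _).trans (add_le_add (h y hy) h1)) y hy
  refine this.trans ?_
  rw [← hl]
  have : |y - y₀| ≤ b - a := by
    rw [abs_le]; constructor <;> linarith [hy.1, hy.2, k.mem.1, k.mem.2]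
  gcongr

theorem norm_le (hf : IsSturmSol α H (Icc a b) y₀ f) (k : SturmKernel H a b y₀ K) {y : ℝ}
    (hy : y ∈ Icc a b) : ‖f y‖ ≤ 2 * Real.exp ((2 * (α ^ 2 * K * (b - a)) + 1) * (b - a)) := by
  have := k.norm_le_of_volterra α (A := 1) hf.continuousOn (fun y hy => by
    rw [sub_eq_of_eq_add (hf.eq_volterra k hy), norm_one]) y hy
  simpa using this

theorem norm_derivWithin_le (hf : IsSturmSol α H (Icc a b) y₀ f) (k : SturmKernel H a b y₀ K)
    {y M : ℝ} (hy : y ∈ Icc a b) (hM : ∀ s ∈ Icc a b, ‖f s‖ ≤ M) :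
    ‖derivWithin f (Icc a b) y‖ ≤ α ^ 2 * K * M * |y - y₀| := by
  rw [hf.derivWithin_eq k hy, norm_mul, norm_pow, Complex.norm_real, Real.norm_eq_abs, sq_abs]
  have := k.norm_volterra_le hy fun s hs => hM s (k.uIcc_subset hy hs)
  calc _ ≤ α ^ 2 * (K * M * |y - y₀|) := by gcongr
    _ = _ := by ring

theorem norm_sub_one_le (hf : IsSturmSol α H (Icc a b) y₀ f) (k : SturmKernel H a b y₀ K)
    {y M : ℝ} (hy : y ∈ Icc a b) (hM : ∀ s ∈ Icc a b, ‖f s‖ ≤ M) :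
    ‖f y - 1‖ ≤ α ^ 2 * K * M * |y - y₀| ^ 2 := by
  have h1 := integral_eq_sub_of_hasDerivWithinAt_Icc (fun t ht => hf.hasDerivWithinAt ht)
    hf.continuousOn_deriv k.mem hy
  rw [hf.value] at h1
  have hM0 : 0 ≤ M := (norm_nonneg _).trans (hM y hy)
  have hK := k.nonneg
  rw [← h1, sq |y - y₀|, ← mul_assoc]
  refine intervalIntegral.norm_integral_le_of_norm_le_const fun t ht => ?_
  have ht' := uIoc_subset_uIcc ht
  refine (hf.norm_derivWithin_le k (k.uIcc_subset hy ht') hM).trans ?_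
  have : |t - y₀| ≤ |y - y₀| := by simpa [abs_sub_comm] using abs_sub_left_of_mem_uIcc ht'
  gcongr

/-- The energy identity: `(v ḡ)' = H (|g'|² + α² |g|²)` when `v = H g'` and `v' = α² H g`. -/
theorem _root_.hasDerivWithinAt_energy {H g g' : ℝ → ℂ} {α : ℝ} {J : Set ℝ} {t : ℝ}
    (hg : HasDerivWithinAt g (g' t) J t)
    (hv : HasDerivWithinAt (fun s => H s * g' s) ((α : ℂ) ^ 2 * H t * g t) J t) :
    HasDerivWithinAt (fun s => H s * g' s * (starRingEnd ℂ) (g s))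
      (H t * ((‖g' t‖ ^ 2 + α ^ 2 * ‖g t‖ ^ 2 : ℝ) : ℂ)) J t := by
  have hc : HasDerivWithinAt (fun s => (starRingEnd ℂ) (g s)) ((starRingEnd ℂ) (g' t)) J t :=
    hg.star
  refine (hv.mul hc).congr_deriv ?_
  push_cast
  rw [← Complex.mul_conj', ← Complex.mul_conj']
  ring

/-- If `Re (H(s) / H(t)) ≥ 0` for `s` between `y₀` and `t`, then `|f|` increases away from `y₀`,
because `Re (f' f̄)(t) = Re ∫_{y₀}^t (H(s) / H(t)) (|f'|² + α² |f|²) ds`. -/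
theorem one_le_norm (hf : IsSturmSol α H (Icc a b) y₀ f) (k : SturmKernel H a b y₀ K)
    (hre : ∀ t ∈ Icc a b, ∀ s ∈ uIcc y₀ t, 0 ≤ (H s * (starRingEnd ℂ) (H t)).re)
    {y : ℝ} (hy : y ∈ Icc a b) : 1 ≤ ‖f y‖ := by
  set J := Icc a b with hJ
  set f' := derivWithin f J with hf'
  set Q : ℝ → ℝ := fun t => ‖f' t‖ ^ 2 + α ^ 2 * ‖f t‖ ^ 2 with hQ
  have hQc : ContinuousOn Q J :=
    (hf.continuousOn_deriv.norm.pow 2).add (continuousOn_const.mul (hf.continuousOn.norm.pow 2))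
  have hQ0 : ∀ t, 0 ≤ Q t := fun t => by positivity
  have hHQ : ContinuousOn (fun t => H t * (Q t : ℂ)) J :=
    k.cont.mul (Complex.continuous_ofReal.comp_continuousOn hQc)
  have hflux : ∀ t ∈ J, ∫ s in y₀..t, H s * (Q s : ℂ) = H t * f' t * (starRingEnd ℂ) (f t) := by
    intro t ht
    rw [integral_eq_sub_of_hasDerivWithinAt_Icc
      (fun t ht => hasDerivWithinAt_energy (hf.hasDerivWithinAt ht) (hf.ode t ht)) hHQ k.mem ht]
    simp [hf.slope, hf']
  -- The integrand below has a sign, so the derivative of `|f|²` has the sign of `t - y₀`.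
  have hreal : ∀ t ∈ J, ‖H t‖ ^ 2 * (f' t * (starRingEnd ℂ) (f t)).re
      = ∫ s in y₀..t, (H s * (starRingEnd ℂ) (H t)).re * Q s := by
    intro t ht
    have h1 : ‖H t‖ ^ 2 * (f' t * (starRingEnd ℂ) (f t)).re
        = ((∫ s in y₀..t, H s * (Q s : ℂ)) * (starRingEnd ℂ) (H t)).re := by
      rw [hflux t ht, ← Complex.re_ofReal_mul]
      congr 1
      push_cast
      rw [← Complex.mul_conj']
      ring
    have hi : IntervalIntegrable (fun s => H s * (Q s : ℂ) * (starRingEnd ℂ) (H t))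
        MeasureTheory.volume y₀ t :=
      ((hHQ.mul continuousOn_const).mono (k.uIcc_subset ht)).intervalIntegrable
    rw [h1, ← intervalIntegral.integral_mul_const]
    have h2 := Complex.reCLM.intervalIntegral_comp_comm hi
    simp only [Complex.reCLM_apply] at h2
    rw [← h2]
    refine intervalIntegral.integral_congr fun s _ => ?_
    simp only [Complex.mul_re, Complex.ofReal_re, Complex.ofReal_im, Complex.mul_im]
    ring
  have hnd : ∀ t ∈ J, HasDerivWithinAt (fun s => ‖f s‖ ^ 2)
      (2 * (f' t * (starRingEnd ℂ) (f t)).re) J t := by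
    intro t ht
    refine ((hf.hasDerivWithinAt ht).norm_sq).congr_deriv ?_
    rw [Complex.inner]
  have hcontn : ContinuousOn (fun s => ‖f s‖ ^ 2) J := fun t ht => (hnd t ht).continuousWithinAt
  have hda : ∀ t ∈ interior J, HasDerivAt (fun s => ‖f s‖ ^ 2)
      (2 * (f' t * (starRingEnd ℂ) (f t)).re) t := fun t ht =>
    (hnd t (interior_subset ht)).hasDerivAt (mem_interior_iff_mem_nhds.1 ht)
  have hone : (fun s => ‖f s‖ ^ 2) y₀ = 1 := by simp [hf.value]
  suffices h : 1 ≤ ‖f y‖ ^ 2 by nlinarith [norm_nonneg (f y)]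
  rcases le_total y₀ y with h | h
  · have hsub : Icc y₀ b ⊆ J := Icc_subset_Icc_left k.mem.1
    have hmono : MonotoneOn (fun s => ‖f s‖ ^ 2) (Icc y₀ b) := by
      refine monotoneOn_of_deriv_nonneg (convex_Icc _ _) (hcontn.mono hsub)
        (fun t ht => (hda t (interior_mono hsub ht)).differentiableAt.differentiableWithinAt)
        fun t ht => ?_
      rw [(hda t (interior_mono hsub ht)).deriv]
      rw [interior_Icc] at ht
      have htJ : t ∈ J := hsub (Ioo_subset_Icc_self ht)
      have hH : 0 < ‖H t‖ ^ 2 := by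
        have := norm_pos_iff.2 (k.ne t htJ ht.1.ne'); positivity
      have h3 := hreal t htJ
      have h4 : 0 ≤ ∫ s in y₀..t, (H s * (starRingEnd ℂ) (H t)).re * Q s :=
        intervalIntegral.integral_nonneg ht.1.le fun s hs =>
          mul_nonneg (hre t htJ s (by rwa [uIcc_of_le ht.1.le])) (hQ0 s)
      rw [← h3] at h4
      have := nonneg_of_mul_nonneg_right h4 hH
      linarith
    rw [← hone]
    exact hmono (left_mem_Icc.2 (h.trans hy.2)) ⟨h, hy.2⟩ h
  · have hsub : Icc a y₀ ⊆ J := Icc_subset_Icc_right k.mem.2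
    have hanti : AntitoneOn (fun s => ‖f s‖ ^ 2) (Icc a y₀) := by
      refine antitoneOn_of_deriv_nonpos (convex_Icc _ _) (hcontn.mono hsub)
        (fun t ht => (hda t (interior_mono hsub ht)).differentiableAt.differentiableWithinAt)
        fun t ht => ?_
      rw [(hda t (interior_mono hsub ht)).deriv]
      rw [interior_Icc] at ht
      have htJ : t ∈ J := hsub (Ioo_subset_Icc_self ht)
      have hH : 0 < ‖H t‖ ^ 2 := by
        have := norm_pos_iff.2 (k.ne t htJ ht.2.ne); positivity
      have h3 := hreal t htJ
      have h4 : 0 ≤ ∫ s in t..y₀, (H s * (starRingEnd ℂ) (H t)).re * Q s :=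
        intervalIntegral.integral_nonneg ht.2.le fun s hs =>
          mul_nonneg (hre t htJ s (by rwa [uIcc_of_ge ht.2.le])) (hQ0 s)
      rw [intervalIntegral.integral_symm] at h3
      have : 0 ≤ ‖H t‖ ^ 2 * -(f' t * (starRingEnd ℂ) (f t)).re := by linarith
      have := nonneg_of_mul_nonneg_right this hH
      linarith
    rw [← hone]
    exact hanti ⟨hy.1, h⟩ (right_mem_Icc.2 (hy.1.trans h)) h

/-- If `H(s) / H(t)` is nearly real for `s` between `y₀` and `t`, then the solution is nearly
real: with `V` the Volterra operator, `f - f̄` solves the Volterra equation with the small forcing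
`α² ∫ (V f̄ - conj (V f))`. -/
theorem abs_im_le (hf : IsSturmSol α H (Icc a b) y₀ f) (k : SturmKernel H a b y₀ K) {M ρ : ℝ}
    (hM : ∀ s ∈ Icc a b, ‖f s‖ ≤ M)
    (him : ∀ t ∈ Icc a b, ∀ s ∈ uIcc y₀ t,
      |(H s * (starRingEnd ℂ) (H t)).im| * |t - y₀| ≤ ρ * ‖H t‖ ^ 2)
    {y : ℝ} (hy : y ∈ Icc a b) :
    |(f y).im| ≤ 2 * (α ^ 2 * M * (b - a)) *
      Real.exp ((2 * (α ^ 2 * K * (b - a)) + 1) * (b - a)) * ρ := by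
  set g : ℝ → ℂ := fun s => (starRingEnd ℂ) (f s) with hg
  have hgc : ContinuousOn g (Icc a b) := Complex.continuous_conj.comp_continuousOn hf.continuousOn
  have hM0 : 0 ≤ M := (norm_nonneg _).trans (hM y hy)
  -- `V f̄ - conj (V f)` is the integral of `2 i Im (H(s) / H(t)) f̄(s)`.
  have hpt : ∀ t ∈ Icc a b, ‖volterra H y₀ g t - (starRingEnd ℂ) (volterra H y₀ f t)‖
      ≤ 2 * ρ * M := by
    intro t ht
    by_cases h : t = y₀
    · -- Both operators vanish at `y₀`; a second point of `[a, b]` shows that `0 ≤ ρ`.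
      subst h
      have h0 := him t ht t left_mem_uIcc
      simp only [sub_self, abs_zero, mul_zero] at h0
      obtain ⟨s, hs, hst⟩ : ∃ s ∈ Icc a b, s ≠ t := by
        by_cases hta : a = t
        · exact ⟨b, ⟨k.lt.le, le_rfl⟩, fun h => k.lt.ne (hta.trans h.symm)⟩
        · exact ⟨a, ⟨le_rfl, k.lt.le⟩, hta⟩
      have h1 := him s hs s right_mem_uIcc
      have h2 : 0 < ‖H s‖ ^ 2 := by have := norm_pos_iff.2 (k.ne s hs hst); positivity
      have h3 : 0 ≤ ρ := nonneg_of_mul_nonneg_left (le_trans (by positivity) h1) h2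
      simp only [volterra, intervalIntegral.integral_same, zero_div, map_zero, sub_self, norm_zero]
      positivity
    have hH : 0 < ‖H t‖ := norm_pos_iff.2 (k.ne t ht h)
    have ht0 : 0 < |t - y₀| := abs_pos.2 (sub_ne_zero.2 h)
    have hconj : (starRingEnd ℂ) (∫ s in y₀..t, H s * f s)
        = ∫ s in y₀..t, (starRingEnd ℂ) (H s) * g s := by
      have := Complex.conjCLE.toContinuousLinearMap.intervalIntegral_comp_comm
        (((k.cont.mul hf.continuousOn).mono (k.uIcc_subset ht)).intervalIntegrable
          (μ := MeasureTheory.volume))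
      simpa [hg] using this.symm
    have hcH : ContinuousOn (fun s => (starRingEnd ℂ) (H s)) (Icc a b) :=
      Complex.continuous_conj.comp_continuousOn k.cont
    have hrep : volterra H y₀ g t - (starRingEnd ℂ) (volterra H y₀ f t)
        = (∫ s in y₀..t, 2 * Complex.I * ((H s * (starRingEnd ℂ) (H t)).im : ℂ) * g s)
          / ((‖H t‖ ^ 2 : ℝ) : ℂ) := by
      have hne : H t ≠ 0 := k.ne t ht h
      have hne' : (starRingEnd ℂ) (H t) ≠ 0 := by simpa using hne
      have e : ∫ s in y₀..t, 2 * Complex.I * ((H s * (starRingEnd ℂ) (H t)).im : ℂ) * g s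
          = (∫ s in y₀..t, H s * g s) * (starRingEnd ℂ) (H t)
            - (∫ s in y₀..t, (starRingEnd ℂ) (H s) * g s) * H t := by
        rw [← intervalIntegral.integral_mul_const, ← intervalIntegral.integral_mul_const,
          ← intervalIntegral.integral_sub]
        · refine intervalIntegral.integral_congr fun s _ => ?_
          have : (2 : ℂ) * Complex.I * ((H s * (starRingEnd ℂ) (H t)).im : ℂ)
              = H s * (starRingEnd ℂ) (H t) - (starRingEnd ℂ) (H s * (starRingEnd ℂ) (H t)) := by
            rw [Complex.sub_conj]; push_cast; ring
          simp only [this, map_mul, Complex.conj_conj]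
          ring
        · exact (((k.cont.mul hgc).mul continuousOn_const).mono
            (k.uIcc_subset ht)).intervalIntegrable
        · exact (((hcH.mul hgc).mul continuousOn_const).mono
            (k.uIcc_subset ht)).intervalIntegrable
      rw [e, volterra, volterra, map_div₀, hconj]
      push_cast
      rw [← Complex.mul_conj']
      field_simp
    have hb := intervalIntegral.norm_integral_le_of_norm_le_const (a := y₀) (b := t)
      (f := fun s => 2 * Complex.I * ((H s * (starRingEnd ℂ) (H t)).im : ℂ) * g s)
      (C := 2 * (ρ * ‖H t‖ ^ 2 / |t - y₀|) * M) (fun s hs => by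
        have hs' := uIoc_subset_uIcc hs
        have h1 : |(H s * (starRingEnd ℂ) (H t)).im| ≤ ρ * ‖H t‖ ^ 2 / |t - y₀| := by
          rw [le_div_iff₀ ht0]; exact him t ht s hs'
        have h2 : ‖g s‖ ≤ M := by
          simpa [hg] using hM s (k.uIcc_subset ht hs')
        rw [norm_mul, norm_mul, norm_mul, Complex.norm_I, Complex.norm_real, Real.norm_eq_abs]
        simp only [Complex.norm_ofNat, mul_one]
        have := (abs_nonneg _).trans h1
        gcongr)
    rw [hrep, norm_div, Complex.norm_real, Real.norm_of_nonneg (by positivity),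
      div_le_iff₀ (by positivity)]
    refine hb.trans (le_of_eq ?_)
    field_simp
  set d : ℝ → ℂ := fun s => f s - g s with hd
  have hdc : ContinuousOn d (Icc a b) := hf.continuousOn.sub hgc
  have hvf := k.continuousOn_volterra hf.continuousOn
  have hvg := k.continuousOn_volterra hgc
  have hmain := k.norm_le_of_volterra α (A := α ^ 2 * (2 * ρ * M * (b - a))) hdc (fun y hy => by
    have hs := k.uIcc_subset hy
    have e1 : ∫ t in y₀..y, volterra H y₀ d t
        = (∫ t in y₀..y, volterra H y₀ f t) - ∫ t in y₀..y, volterra H y₀ g t := by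
      rw [← intervalIntegral.integral_sub (hvf.mono hs).intervalIntegrable
        (hvg.mono hs).intervalIntegrable]
      exact intervalIntegral.integral_congr fun t ht =>
        (k.volterra_sub (hs ht) hf.continuousOn hgc).symm
    have e2 : g y = 1 + (α : ℂ) ^ 2 * ∫ t in y₀..y, (starRingEnd ℂ) (volterra H y₀ f t) := by
      have := Complex.conjCLE.toContinuousLinearMap.intervalIntegral_comp_comm
        ((hvf.mono hs).intervalIntegrable (μ := MeasureTheory.volume))
      simp only [ContinuousLinearEquiv.coe_coe, Complex.conjCLE_apply] at this
      rw [this]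
      simp only [hg]
      nth_rewrite 1 [hf.eq_volterra k hy]
      simp
    have e3 : d y - (α : ℂ) ^ 2 * ∫ t in y₀..y, volterra H y₀ d t
        = (α : ℂ) ^ 2 * ∫ t in y₀..y,
          (volterra H y₀ g t - (starRingEnd ℂ) (volterra H y₀ f t)) := by
      have hvc : ContinuousOn (fun t => (starRingEnd ℂ) (volterra H y₀ f t)) (Icc a b) :=
        Complex.continuous_conj.comp_continuousOn hvf
      rw [intervalIntegral.integral_sub (hvg.mono hs).intervalIntegrable
        (hvc.mono hs).intervalIntegrable, e1]
      simp only [hd]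
      rw [e2, hf.eq_volterra k hy]
      ring
    have hb := intervalIntegral.norm_integral_le_of_norm_le_const (a := y₀) (b := y)
      (f := fun t => volterra H y₀ g t - (starRingEnd ℂ) (volterra H y₀ f t)) (C := 2 * ρ * M)
      (fun t ht => hpt t (hs (uIoc_subset_uIcc ht)))
    have h0 : 0 ≤ 2 * ρ * M := (norm_nonneg _).trans (hpt y hy)
    have : |y - y₀| ≤ b - a := by
      rw [abs_le]; constructor <;> linarith [hy.1, hy.2, k.mem.1, k.mem.2]
    rw [e3, norm_mul, norm_pow, Complex.norm_real, Real.norm_eq_abs, sq_abs]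
    gcongr
    exact hb.trans (by gcongr)) y hy
  have hdy : ‖d y‖ = 2 * |(f y).im| := by
    simp only [hd, hg]
    rw [Complex.sub_conj, norm_mul, Complex.norm_I, Complex.norm_real, Real.norm_eq_abs, abs_mul]
    simp
  rw [hdy] at hmain
  linarith

end IsSturmSol

/-! ### Half-channel profiles and their critical points -/

/-- The pair of branches on one side of the origin: `p` increases and `m` decreases from the common
value `0`, with derivatives `dp`, `dm` bounded below by `κ` and above by `Λ` in modulus, and with
Lipschitz constant `Λ`. The side `y ≥ 0` of the channel gives `p = W₊`, `m = W₋`; the side `y ≤ 0`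
gives `p = W₋(-·)`, `m = W₊(-·)`. -/
structure HalfProfile (κ Λ L : ℝ) (p m dp dm : ℝ → ℝ) : Prop where
  κ_pos : 0 < κ
  one_le : 1 ≤ L
  p_zero : p 0 = 0
  m_zero : m 0 = 0
  hasDeriv_p : ∀ y ∈ Icc 0 L, HasDerivWithinAt p (dp y) (Icc 0 L) y
  hasDeriv_m : ∀ y ∈ Icc 0 L, HasDerivWithinAt m (dm y) (Icc 0 L) y
  dp_bound : ∀ y ∈ Icc 0 L, κ ≤ dp y ∧ dp y ≤ Λ
  dm_bound : ∀ y ∈ Icc 0 L, κ ≤ -dm y ∧ -dm y ≤ Λ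
  dp_lip : ∀ x ∈ Icc 0 L, ∀ y ∈ Icc 0 L, |dp x - dp y| ≤ Λ * |x - y|
  dm_lip : ∀ x ∈ Icc 0 L, ∀ y ∈ Icc 0 L, |dm x - dm y| ≤ Λ * |x - y|

/-- `yc` is the critical point of `c` on the branch `p`: `p yc` is the real part of `c`, except
that `c` may lie to the right of `p yc` when `yc ≥ 1`. -/
structure CritPoint (p : ℝ → ℝ) (L : ℝ) (c : ℂ) (yc : ℝ) : Prop where
  mem : yc ∈ Icc 0 L
  le : p yc ≤ c.re
  eq : yc < 1 → c.re = p yc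

/-- The coefficient `(p - c) (m - c)`. -/
noncomputable def profileH (p m : ℝ → ℝ) (c : ℂ) (y : ℝ) : ℂ := ((p y : ℂ) - c) * ((m y : ℂ) - c)

/-- `f` is the regular solution of the Sturm problem which is `1` at the critical point `yc`. -/
structure HalfSol (α : ℝ) (p m : ℝ → ℝ) (L : ℝ) (c : ℂ) (yc : ℝ) (f : ℝ → ℂ) : Prop where
  crit : CritPoint p L c yc
  sol : IsSturmSol α (profileH p m c) (Icc 0 (max 1 yc)) yc f

theorem mul_sub_le_of_hasDerivWithinAt {g g' : ℝ → ℝ} {a b k : ℝ}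
    (hg : ∀ y ∈ Icc a b, HasDerivWithinAt g (g' y) (Icc a b) y) (hk : ∀ y ∈ Icc a b, k ≤ g' y)
    {x y : ℝ} (hx : x ∈ Icc a b) (hy : y ∈ Icc a b) (hxy : x ≤ y) : k * (y - x) ≤ g y - g x := by
  have hm : MonotoneOn (fun t => g t - k * t) (Icc a b) := by
    have hd : ∀ t ∈ Icc a b, HasDerivWithinAt (fun t => g t - k * t) (g' t - k) (Icc a b) t := by
      intro t ht
      have := (hg t ht).sub ((hasDerivWithinAt_id t (Icc a b)).const_mul k)
      exact this.congr_deriv (by ring)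
    have hi : ∀ t ∈ interior (Icc a b), HasDerivAt (fun t => g t - k * t) (g' t - k) t :=
      fun t ht => (hd t (interior_subset ht)).hasDerivAt (mem_interior_iff_mem_nhds.1 ht)
    refine monotoneOn_of_deriv_nonneg (convex_Icc _ _) (fun t ht => (hd t ht).continuousWithinAt)
      (fun t ht => (hi t ht).differentiableAt.differentiableWithinAt) fun t ht => ?_
    rw [(hi t ht).deriv]
    linarith [hk t (interior_subset ht)]
  have := hm hx hy hxy
  simp only at this
  linarith

theorem Complex.norm_le_norm_of_re_im {x z : ℂ} (hr : |x.re| ≤ |z.re|) (hi : |x.im| ≤ |z.im|) :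
    ‖x‖ ≤ ‖z‖ := by
  rw [Complex.norm_eq_sqrt_sq_add_sq, Complex.norm_eq_sqrt_sq_add_sq]
  exact Real.sqrt_le_sqrt (add_le_add (sq_le_sq.2 hr) (sq_le_sq.2 hi))

namespace HalfProfile

variable {κ Λ L : ℝ} {p m dp dm : ℝ → ℝ}

theorem zero_mem (h : HalfProfile κ Λ L p m dp dm) : (0 : ℝ) ∈ Icc 0 L :=
  ⟨le_rfl, zero_le_one.trans h.one_le⟩

theorem one_mem (h : HalfProfile κ Λ L p m dp dm) : (1 : ℝ) ∈ Icc 0 L := ⟨zero_le_one, h.one_le⟩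

theorem κ_le (h : HalfProfile κ Λ L p m dp dm) : κ ≤ Λ :=
  (h.dp_bound 0 h.zero_mem).1.trans (h.dp_bound 0 h.zero_mem).2

theorem Λ_pos (h : HalfProfile κ Λ L p m dp dm) : 0 < Λ := h.κ_pos.trans_le h.κ_le

theorem p_lower (h : HalfProfile κ Λ L p m dp dm) {x y : ℝ} (hx : x ∈ Icc 0 L) (hy : y ∈ Icc 0 L)
    (hxy : x ≤ y) : κ * (y - x) ≤ p y - p x :=
  mul_sub_le_of_hasDerivWithinAt h.hasDeriv_p (fun y hy => (h.dp_bound y hy).1) hx hy hxy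

theorem p_upper (h : HalfProfile κ Λ L p m dp dm) {x y : ℝ} (hx : x ∈ Icc 0 L) (hy : y ∈ Icc 0 L)
    (hxy : x ≤ y) : p y - p x ≤ Λ * (y - x) := by
  have := mul_sub_le_of_hasDerivWithinAt (g := fun t => -p t) (fun y hy => (h.hasDeriv_p y hy).neg)
    (k := -Λ) (fun y hy => neg_le_neg (h.dp_bound y hy).2) hx hy hxy
  linarith

theorem m_lower (h : HalfProfile κ Λ L p m dp dm) {x y : ℝ} (hx : x ∈ Icc 0 L) (hy : y ∈ Icc 0 L)
    (hxy : x ≤ y) : κ * (y - x) ≤ m x - m y := by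
  have := mul_sub_le_of_hasDerivWithinAt (g := fun t => -m t) (fun y hy => (h.hasDeriv_m y hy).neg)
    (fun y hy => (h.dm_bound y hy).1) hx hy hxy
  linarith

theorem m_upper (h : HalfProfile κ Λ L p m dp dm) {x y : ℝ} (hx : x ∈ Icc 0 L) (hy : y ∈ Icc 0 L)
    (hxy : x ≤ y) : m x - m y ≤ Λ * (y - x) := by
  have := mul_sub_le_of_hasDerivWithinAt h.hasDeriv_m
    (k := -Λ) (fun y hy => by linarith [(h.dm_bound y hy).2]) hx hy hxy
  linarith

theorem abs_p_sub_le (h : HalfProfile κ Λ L p m dp dm) {x y : ℝ} (hx : x ∈ Icc 0 L)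
    (hy : y ∈ Icc 0 L) : |p x - p y| ≤ Λ * |x - y| := by
  have hκ := h.κ_pos
  rcases le_total x y with hxy | hxy
  · rw [abs_of_nonpos (by nlinarith [h.p_lower hx hy hxy]), abs_of_nonpos (by linarith)]
    linarith [h.p_upper hx hy hxy]
  · rw [abs_of_nonneg (by nlinarith [h.p_lower hy hx hxy]), abs_of_nonneg (by linarith)]
    exact h.p_upper hy hx hxy

theorem abs_m_sub_le (h : HalfProfile κ Λ L p m dp dm) {x y : ℝ} (hx : x ∈ Icc 0 L)
    (hy : y ∈ Icc 0 L) : |m x - m y| ≤ Λ * |x - y| := by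
  have hκ := h.κ_pos
  rcases le_total x y with hxy | hxy
  · rw [abs_of_nonneg (by nlinarith [h.m_lower hx hy hxy]), abs_of_nonpos (by linarith)]
    linarith [h.m_upper hx hy hxy]
  · rw [abs_of_nonpos (by nlinarith [h.m_lower hy hx hxy]), abs_of_nonneg (by linarith)]
    linarith [h.m_upper hy hx hxy]

theorem p_nonneg (h : HalfProfile κ Λ L p m dp dm) {y : ℝ} (hy : y ∈ Icc 0 L) : κ * y ≤ p y := by
  have := h.p_lower h.zero_mem hy hy.1
  rw [h.p_zero] at this; linarith

theorem p_le (h : HalfProfile κ Λ L p m dp dm) {y : ℝ} (hy : y ∈ Icc 0 L) : p y ≤ Λ * y := by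
  have := h.p_upper h.zero_mem hy hy.1
  rw [h.p_zero] at this; linarith

theorem m_nonpos (h : HalfProfile κ Λ L p m dp dm) {y : ℝ} (hy : y ∈ Icc 0 L) : κ * y ≤ -m y := by
  have := h.m_lower h.zero_mem hy hy.1
  rw [h.m_zero] at this; linarith

theorem m_ge (h : HalfProfile κ Λ L p m dp dm) {y : ℝ} (hy : y ∈ Icc 0 L) : -m y ≤ Λ * y := by
  have := h.m_upper h.zero_mem hy hy.1
  rw [h.m_zero] at this; linarith

theorem continuousOn_p (h : HalfProfile κ Λ L p m dp dm) : ContinuousOn p (Icc 0 L) :=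
  fun y hy => (h.hasDeriv_p y hy).continuousWithinAt

theorem continuousOn_m (h : HalfProfile κ Λ L p m dp dm) : ContinuousOn m (Icc 0 L) :=
  fun y hy => (h.hasDeriv_m y hy).continuousWithinAt

theorem continuousOn_of_lip {g : ℝ → ℝ} {s : Set ℝ} {C : ℝ}
    (h : ∀ x ∈ s, ∀ y ∈ s, |g x - g y| ≤ C * |x - y|) : ContinuousOn g s := by
  intro x hx
  refine tendsto_iff_norm_sub_tendsto_zero.2
    (squeeze_zero' (g := fun y => C * |y - x|) (Eventually.of_forall fun _ => norm_nonneg _) ?_ ?_)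
  · filter_upwards [self_mem_nhdsWithin] with y hy using h y hy x hx
  · have : Continuous fun y => C * |y - x| := by fun_prop
    simpa using (this.tendsto x).mono_left nhdsWithin_le_nhds

theorem continuousOn_dp (h : HalfProfile κ Λ L p m dp dm) : ContinuousOn dp (Icc 0 L) :=
  continuousOn_of_lip h.dp_lip

theorem continuousOn_dm (h : HalfProfile κ Λ L p m dp dm) : ContinuousOn dm (Icc 0 L) :=
  continuousOn_of_lip h.dm_lip

theorem continuousOn_profileH (h : HalfProfile κ Λ L p m dp dm) (c : ℂ) :
    ContinuousOn (profileH p m c) (Icc 0 L) :=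
  ((Complex.continuous_ofReal.comp_continuousOn h.continuousOn_p).sub continuousOn_const).mul
    ((Complex.continuous_ofReal.comp_continuousOn h.continuousOn_m).sub continuousOn_const)

variable {c : ℂ} {yc y s : ℝ}

theorem subset (h : HalfProfile κ Λ L p m dp dm) (k : CritPoint p L c yc) :
    Icc 0 (max 1 yc) ⊆ Icc 0 L := Icc_subset_Icc_right (max_le h.one_le k.mem.2)

theorem re_nonneg (h : HalfProfile κ Λ L p m dp dm) (k : CritPoint p L c yc) : 0 ≤ c.re := by
  have := h.p_nonneg k.mem
  have := mul_nonneg h.κ_pos.le k.mem.1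
  linarith [k.le]

/-- To the right of the critical point, `c` has real part exactly `p yc`. -/
theorem _root_.CritPoint.eq_of_lt_of_mem (k : CritPoint p L c yc) (hy : y ∈ Icc 0 (max 1 yc))
    (h : yc < y) : c.re = p yc :=
  k.eq (by
    rcases le_max_iff.1 hy.2 with h1 | h1
    · linarith
    · linarith)

theorem abs_re_lower (h : HalfProfile κ Λ L p m dp dm) (k : CritPoint p L c yc)
    (hy : y ∈ Icc 0 (max 1 yc)) : κ * |y - yc| ≤ |p y - c.re| := by
  rcases le_or_gt y yc with hle | hlt
  · have := h.p_lower (h.subset k hy) k.mem hle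
    rw [abs_of_nonpos (by linarith), abs_sub_comm]
    refine le_trans ?_ (le_abs_self _)
    linarith [k.le]
  · have := h.p_lower k.mem (h.subset k hy) hlt.le
    rw [abs_of_nonneg (by linarith), k.eq_of_lt_of_mem hy hlt]
    exact this.trans (le_abs_self _)

/-- Moving away from the critical point, `p - Re c` keeps its sign and grows in modulus. -/
theorem abs_re_mono (h : HalfProfile κ Λ L p m dp dm) (k : CritPoint p L c yc)
    (hy : y ∈ Icc 0 (max 1 yc)) (hs : s ∈ uIcc yc y) :
    |p s - c.re| ≤ |p y - c.re| ∧ 0 ≤ (p s - c.re) * (p y - c.re) := by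
  have hκ := h.κ_pos
  have hyL := h.subset k hy
  rcases le_or_gt y yc with hle | hlt
  · rw [uIcc_of_ge hle] at hs
    have hsL : s ∈ Icc 0 L := ⟨hyL.1.trans hs.1, hs.2.trans k.mem.2⟩
    have h1 := h.p_lower hyL hsL hs.1
    have h2 := h.p_lower hsL k.mem hs.2
    have h3 := k.le
    have h4 : 0 ≤ κ * (s - y) := mul_nonneg hκ.le (by linarith [hs.1])
    have h5 : 0 ≤ κ * (yc - s) := mul_nonneg hκ.le (by linarith [hs.2])
    rw [abs_of_nonpos (by linarith), abs_of_nonpos (by linarith)]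
    exact ⟨by linarith, mul_nonneg_of_nonpos_of_nonpos (by linarith) (by linarith)⟩
  · rw [uIcc_of_le hlt.le] at hs
    have hsL : s ∈ Icc 0 L := ⟨k.mem.1.trans hs.1, hs.2.trans hyL.2⟩
    have h1 := h.p_lower k.mem hsL hs.1
    have h2 := h.p_lower hsL hyL hs.2
    have h4 : 0 ≤ κ * (s - yc) := mul_nonneg hκ.le (by linarith [hs.1])
    have h5 : 0 ≤ κ * (y - s) := mul_nonneg hκ.le (by linarith [hs.2])
    rw [k.eq_of_lt_of_mem hy hlt, abs_of_nonneg (by linarith), abs_of_nonneg (by linarith)]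
    exact ⟨by linarith, mul_nonneg (by linarith) (by linarith)⟩

theorem norm_p_sub_ge (h : HalfProfile κ Λ L p m dp dm) (k : CritPoint p L c yc)
    (hy : y ∈ Icc 0 (max 1 yc)) : κ * |y - yc| ≤ ‖(p y : ℂ) - c‖ := by
  refine (h.abs_re_lower k hy).trans ?_
  simpa using Complex.abs_re_le_norm ((p y : ℂ) - c)

theorem norm_m_sub_ge (h : HalfProfile κ Λ L p m dp dm) (k : CritPoint p L c yc)
    (hy : y ∈ Icc 0 L) : ‖c‖ ≤ ‖(m y : ℂ) - c‖ := by
  have h1 := h.m_nonpos hy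
  have h2 := mul_nonneg h.κ_pos.le hy.1
  have h3 := h.re_nonneg k
  refine Complex.norm_le_norm_of_re_im ?_ ?_
  · simp only [Complex.sub_re, Complex.ofReal_re]
    rw [abs_of_nonneg h3, abs_of_nonpos (by linarith)]; linarith
  · simp

theorem crit_le (h : HalfProfile κ Λ L p m dp dm) (k : CritPoint p L c yc) : κ * yc ≤ ‖c‖ :=
  (h.p_nonneg k.mem).trans (k.le.trans (Complex.re_le_norm c))

/-- Between `yc` and `y` the factor `p - c` is monotone in modulus. The factor `m - c` is so only for
`y ≥ yc`; for `y ≤ yc` it still satisfies `|m s - c| ≤ (1 + Λ / κ) |c|` with `|c| ≤ |m y - c|`, since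
`|m s| ≤ Λ yc` and `κ yc ≤ Re c`. The constant does not degenerate as `c → 0`. -/
theorem sturmKernel (h : HalfProfile κ Λ L p m dp dm) (k : CritPoint p L c yc) :
    SturmKernel (profileH p m c) 0 (max 1 yc) yc (1 + Λ / κ) := by
  have hκ := h.κ_pos
  have hΛ := h.Λ_pos
  have hsub := h.subset k
  refine ⟨by positivity, ⟨k.mem.1, le_max_right _ _⟩, by positivity,
    (h.continuousOn_profileH c).mono hsub, fun y hy hne => ?_, fun y hy s hs => ?_⟩
  · have h1 : 0 < κ * |y - yc| := mul_pos hκ (abs_pos.2 (sub_ne_zero.2 hne))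
    refine mul_ne_zero (norm_pos_iff.1 (h1.trans_le (h.norm_p_sub_ge k hy))) fun h0 => ?_
    -- `m y = c` forces `y = yc = 0`.
    have h2 := congrArg Complex.re h0
    simp only [Complex.sub_re, Complex.ofReal_re, Complex.zero_re] at h2
    have h3 := h.m_nonpos (hsub hy)
    have h4 := h.re_nonneg k
    have h5 := mul_nonneg hκ.le hy.1
    have h6 := h.p_nonneg k.mem
    have h7 := mul_nonneg hκ.le k.mem.1
    have h8 : κ * yc = 0 := by linarith [k.le]
    have h9 : κ * y = 0 := by linarith
    rw [mul_eq_zero_iff_left hκ.ne'] at h8 h9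
    exact hne (h9.trans h8.symm)
  · have hsJ : s ∈ Icc 0 (max 1 yc) := uIcc_subset_Icc ⟨k.mem.1, le_max_right _ _⟩ hy hs
    have hsL := hsub hsJ
    have hyL := hsub hy
    have h1 : ‖(p s : ℂ) - c‖ ≤ ‖(p y : ℂ) - c‖ :=
      Complex.norm_le_norm_of_re_im (by simpa using (h.abs_re_mono k hy hs).1) (by simp)
    have h2 : ‖(m s : ℂ) - c‖ ≤ (1 + Λ / κ) * ‖(m y : ℂ) - c‖ := by
      have hmy := h.norm_m_sub_ge k hyL
      rcases le_or_gt s y with hsy | hsy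
      · have : ‖(m s : ℂ) - c‖ ≤ ‖(m y : ℂ) - c‖ := by
          have e1 := h.m_lower hsL hyL hsy
          have e2 := h.m_nonpos hsL
          have e3 := mul_nonneg hκ.le hsL.1
          have e4 : 0 ≤ κ * (y - s) := mul_nonneg hκ.le (by linarith)
          have e5 := h.re_nonneg k
          refine Complex.norm_le_norm_of_re_im ?_ (by simp)
          simp only [Complex.sub_re, Complex.ofReal_re]
          rw [abs_of_nonpos (by linarith), abs_of_nonpos (by linarith)]; linarith
        have h0 : 0 ≤ Λ / κ * ‖(m y : ℂ) - c‖ := by positivity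
        linarith
      · have hsyc : s ≤ yc := by
          rcases le_total yc y with h' | h'
          · rw [uIcc_of_le h'] at hs; linarith [hs.1, hs.2]
          · rw [uIcc_of_ge h'] at hs; exact hs.2
        have e1 := h.m_ge hsL
        have e2 := h.m_nonpos hsL
        have e3 := mul_nonneg hκ.le hsL.1
        have e4 := h.crit_le k
        have e5 : ‖(m s : ℂ)‖ ≤ Λ / κ * ‖c‖ := by
          rw [Complex.norm_real, Real.norm_eq_abs, abs_of_nonpos (by linarith)]
          calc -m s ≤ Λ * s := e1
            _ ≤ Λ * yc := by gcongr
            _ = Λ / κ * (κ * yc) := by field_simp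
            _ ≤ _ := by gcongr
        calc ‖(m s : ℂ) - c‖ ≤ ‖(m s : ℂ)‖ + ‖c‖ := norm_sub_le _ _
          _ ≤ (1 + Λ / κ) * ‖c‖ := by linarith
          _ ≤ _ := by gcongr
    rw [profileH, profileH, norm_mul, norm_mul]
    calc ‖(p s : ℂ) - c‖ * ‖(m s : ℂ) - c‖
        ≤ ‖(p y : ℂ) - c‖ * ((1 + Λ / κ) * ‖(m y : ℂ) - c‖) := by gcongr
      _ = _ := by ring

/-- The product `H(s) conj H(t)`. The last term of its real part is nonnegative for `p` increasing and
`m` decreasing, and its imaginary part has the factor `Im c`. -/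
theorem profileH_mul_conj (p m : ℝ → ℝ) (c : ℂ) (s t : ℝ) :
    (profileH p m c s * (starRingEnd ℂ) (profileH p m c t)).re
        = ((p s - c.re) * (p t - c.re) + c.im ^ 2) * ((m s - c.re) * (m t - c.re) + c.im ^ 2)
          - c.im ^ 2 * ((p s - p t) * (m s - m t)) ∧
      (profileH p m c s * (starRingEnd ℂ) (profileH p m c t)).im
        = c.im * (((p s - c.re) * (p t - c.re) + c.im ^ 2) * (m s - m t)
          + (p s - p t) * ((m s - c.re) * (m t - c.re) + c.im ^ 2)) := by
  constructor <;>
  · simp only [profileH, map_mul, map_sub, Complex.conj_ofReal, Complex.mul_re, Complex.mul_im,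
      Complex.sub_re, Complex.sub_im, Complex.ofReal_re, Complex.ofReal_im, Complex.conj_re,
      Complex.conj_im]
    ring

theorem m_sub_mul_nonneg (h : HalfProfile κ Λ L p m dp dm) (k : CritPoint p L c yc)
    (hs : s ∈ Icc 0 L) (hy : y ∈ Icc 0 L) : 0 ≤ (m s - c.re) * (m y - c.re) := by
  have h1 := h.m_nonpos hs
  have h2 := h.m_nonpos hy
  have h3 := mul_nonneg h.κ_pos.le hs.1
  have h4 := mul_nonneg h.κ_pos.le hy.1
  have h5 := h.re_nonneg k
  exact mul_nonneg_of_nonpos_of_nonpos (by linarith) (by linarith)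

/-- `Re (H(s) / H(y)) ≥ 0` for `s` between the critical point and `y`. -/
theorem re_mul_conj_nonneg (h : HalfProfile κ Λ L p m dp dm) (k : CritPoint p L c yc)
    (hy : y ∈ Icc 0 (max 1 yc)) (hs : s ∈ uIcc yc y) :
    0 ≤ (profileH p m c s * (starRingEnd ℂ) (profileH p m c y)).re := by
  have hsL : s ∈ Icc 0 L := h.subset k (uIcc_subset_Icc ⟨k.mem.1, le_max_right _ _⟩ hy hs)
  have hyL := h.subset k hy
  have hκ := h.κ_pos
  rw [(profileH_mul_conj p m c s y).1]
  have h1 := (h.abs_re_mono k hy hs).2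
  have h2 := h.m_sub_mul_nonneg k hsL hyL
  -- `p` increases and `m` decreases.
  have h3 : (p s - p y) * (m s - m y) ≤ 0 := by
    rcases le_total s y with hsy | hsy
    · have := h.p_lower hsL hyL hsy
      have := h.m_lower hsL hyL hsy
      have : 0 ≤ κ * (y - s) := mul_nonneg hκ.le (by linarith)
      exact mul_nonpos_of_nonpos_of_nonneg (by linarith) (by linarith)
    · have := h.p_lower hyL hsL hsy
      have := h.m_lower hyL hsL hsy
      have : 0 ≤ κ * (s - y) := mul_nonneg hκ.le (by linarith)
      exact mul_nonpos_of_nonneg_of_nonpos (by linarith) (by linarith)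
  have h4 : c.im ^ 2 * ((p s - p y) * (m s - m y)) ≤ 0 :=
    mul_nonpos_of_nonneg_of_nonpos (sq_nonneg _) h3
  have h5 : 0 ≤ ((p s - c.re) * (p y - c.re) + c.im ^ 2)
      * ((m s - c.re) * (m y - c.re) + c.im ^ 2) := by positivity
  linarith

end HalfProfile

/-! ### Bounds for the regular solution -/

/-- The bounds for the regular solution that hold with one constant for all `c`. -/
structure RegularBounds (C yc : ℝ) (f : ℝ → ℂ) : Prop where
  one_le : ∀ y ∈ Icc 0 (max 1 yc), 1 ≤ ‖f y‖
  norm_le : ∀ y ∈ Icc 0 (max 1 yc), ‖f y‖ ≤ C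
  deriv_le : ∀ y ∈ Icc 0 (max 1 yc), ‖derivWithin f (Icc 0 (max 1 yc)) y‖ ≤ C * |y - yc|
  sub_one_le : ∀ y ∈ Icc 0 (max 1 yc), ‖f y - 1‖ ≤ C * |y - yc| ^ 2

namespace HalfProfile

variable {κ Λ L : ℝ} {p m dp dm : ℝ → ℝ}

/-- The bounds are uniform in `c`, including `c → 0`, because the constant of `sturmKernel` is. -/
theorem exists_regularBounds (h : HalfProfile κ Λ L p m dp dm) (α : ℝ) :
    ∃ C, 1 ≤ C ∧ ∀ c yc f, HalfSol α p m L c yc f → RegularBounds C yc f := by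
  have hκ := h.κ_pos
  have hΛ := h.Λ_pos
  have hL : 0 < L := zero_lt_one.trans_le h.one_le
  set M := 2 * Real.exp ((2 * (α ^ 2 * (1 + Λ / κ) * L) + 1) * L) with hM
  have hM1 : 1 ≤ M := by
    have : 1 ≤ Real.exp ((2 * (α ^ 2 * (1 + Λ / κ) * L) + 1) * L) :=
      Real.one_le_exp (by positivity)
    linarith
  have hN : 0 ≤ α ^ 2 * (1 + Λ / κ) * M := by positivity
  refine ⟨M + α ^ 2 * (1 + Λ / κ) * M, by linarith, fun c yc f hf => ?_⟩
  have k := h.sturmKernel hf.crit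
  have hb : max 1 yc - 0 ≤ L := by
    rw [sub_zero]; exact max_le h.one_le hf.crit.mem.2
  have hb0 : 0 ≤ max 1 yc - 0 := by rw [sub_zero]; positivity
  have hle : ∀ y ∈ Icc 0 (max 1 yc), ‖f y‖ ≤ M := fun y hy =>
    (hf.sol.norm_le k hy).trans (by rw [hM]; gcongr)
  refine ⟨fun y hy => hf.sol.one_le_norm k (fun t ht s hs => h.re_mul_conj_nonneg hf.crit ht hs) hy,
    fun y hy => (hle y hy).trans (by linarith), fun y hy => ?_, fun y hy => ?_⟩
  · refine (hf.sol.norm_derivWithin_le k hy hle).trans ?_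
    gcongr; linarith
  · refine (hf.sol.norm_sub_one_le k hy hle).trans ?_
    gcongr; linarith

/-- For real `c`, and up to `O(|Im c|)` for complex `c`, the regular solution is real. -/
theorem exists_abs_im_le (h : HalfProfile κ Λ L p m dp dm) (α : ℝ) {δ : ℝ} (hδ : 0 < δ) :
    ∃ C, 0 ≤ C ∧ ∀ c yc f, HalfSol α p m L c yc f → δ ≤ c.re →
      ∀ y ∈ Icc 0 (max 1 yc), |(f y).im| ≤ C * |c.im| := by
  have hκ := h.κ_pos
  have hΛ := h.Λ_pos
  have hL : 0 < L := zero_lt_one.trans_le h.one_le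
  obtain ⟨M, hM1, hM⟩ := h.exists_regularBounds α
  set r := Λ * L ^ 2 / δ ^ 2 + (1 + Λ * L / δ) / κ with hr
  refine ⟨2 * (α ^ 2 * M * L) * Real.exp ((2 * (α ^ 2 * (1 + Λ / κ) * L) + 1) * L) * r,
    by positivity, fun c yc f hf hc y hy => ?_⟩
  have k := h.sturmKernel hf.crit
  have hb : max 1 yc - 0 ≤ L := by
    rw [sub_zero]; exact max_le h.one_le hf.crit.mem.2
  have hb0 : 0 ≤ max 1 yc - 0 := by rw [sub_zero]; positivity
  have key := hf.sol.abs_im_le k (ρ := r * |c.im|) (hM c yc f hf).norm_le (fun t ht s hs => by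
    have htL := h.subset hf.crit ht
    have hsL : s ∈ Icc 0 L :=
      h.subset hf.crit (uIcc_subset_Icc ⟨hf.crit.mem.1, le_max_right _ _⟩ ht hs)
    obtain ⟨ha, ha'⟩ := h.abs_re_mono hf.crit ht hs
    have hat := h.abs_re_lower hf.crit ht
    have hmt := h.m_nonpos htL
    have hms := h.m_nonpos hsL
    have hκt := mul_nonneg hκ.le htL.1
    have hκs := mul_nonneg hκ.le hsL.1
    have hmst := h.abs_m_sub_le hsL htL
    have hst : |s - t| ≤ L := by
      rw [abs_le]; constructor <;> linarith [hsL.1, hsL.2, htL.1, htL.2]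
    have hty : |t - yc| ≤ L := by
      rw [abs_le]; constructor <;> linarith [hf.crit.mem.1, hf.crit.mem.2, htL.1, htL.2]
    have hn : ‖profileH p m c t‖ ^ 2
        = ((p t - c.re) ^ 2 + c.im ^ 2) * ((m t - c.re) ^ 2 + c.im ^ 2) := by
      rw [profileH, norm_mul, mul_pow, Complex.sq_norm, Complex.sq_norm, Complex.normSq_apply,
        Complex.normSq_apply]
      simp only [Complex.sub_re, Complex.sub_im, Complex.ofReal_re, Complex.ofReal_im]
      ring
    rw [(profileH_mul_conj p m c s t).2, hn, abs_mul]
    set e2 := c.im ^ 2 with he2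
    have he20 : 0 ≤ e2 := sq_nonneg _
    set as := p s - c.re with has
    set at' := p t - c.re with hat'
    set bs := c.re - m s with hbs
    set bt := c.re - m t with hbt
    have hbt0 : δ ≤ bt := by linarith
    have hbs0 : δ ≤ bs := by linarith
    have hbsbt : bs ≤ (1 + Λ * L / δ) * bt := by
      have h1 : bs ≤ bt + Λ * L := by
        have h2 : |m s - m t| ≤ Λ * L := hmst.trans (by gcongr)
        linarith [(abs_le.1 h2).1]
      have h3 : Λ * L ≤ Λ * L / δ * bt := by
        rw [div_mul_eq_mul_div, le_div_iff₀ hδ]; gcongr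
      linarith
    have hP : |as * at' + e2| ≤ at' ^ 2 + e2 := by
      rw [abs_of_nonneg (by positivity)]
      have : as * at' ≤ |as| * |at'| := by rw [← abs_mul]; exact le_abs_self _
      have : |as| * |at'| ≤ |at'| * |at'| := by gcongr
      rw [abs_mul_abs_self] at this
      linarith
    have hpd : |p s - p t| ≤ |at'| := by
      have e : p s - p t = as - at' := by rw [has, hat']; ring
      rw [e]
      rcases le_total 0 at' with h0 | h0
      · have : 0 ≤ as ∨ at' = 0 := by
          rcases h0.eq_or_lt with h1 | h1
          · exact Or.inr h1.symm
          · exact Or.inl (nonneg_of_mul_nonneg_left ha' h1)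
        rcases this with h1 | h1
        · rw [abs_of_nonneg h1, abs_of_nonneg h0] at ha
          rw [abs_of_nonneg h0, abs_le]; constructor <;> linarith
        · rw [h1, abs_zero] at ha
          rw [h1, abs_eq_zero.1 (le_antisymm ha (abs_nonneg _))]; simp
      · have : as ≤ 0 ∨ at' = 0 := by
          rcases h0.eq_or_lt with h1 | h1
          · exact Or.inr h1
          · exact Or.inl (nonpos_of_mul_nonneg_left ha' h1)
        rcases this with h1 | h1
        · rw [abs_of_nonpos h1, abs_of_nonpos h0] at ha
          rw [abs_of_nonpos h0, abs_le]; constructor <;> linarith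
        · rw [h1, abs_zero] at ha
          rw [h1, abs_eq_zero.1 (le_antisymm ha (abs_nonneg _))]; simp
    have hB : |(m s - c.re) * (m t - c.re) + e2| ≤ (1 + Λ * L / δ) * (bt ^ 2 + e2) := by
      have e : (m s - c.re) * (m t - c.re) = bs * bt := by rw [hbs, hbt]; ring
      have hbt' : 0 < bt := hδ.trans_le hbt0
      have hbs' : 0 < bs := hδ.trans_le hbs0
      rw [e, abs_of_nonneg (by positivity)]
      have h1 : bs * bt ≤ (1 + Λ * L / δ) * bt * bt := by gcongr
      have h2 : 0 ≤ Λ * L / δ * e2 := by positivity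
      nlinarith
    have hbt2 : (m t - c.re) ^ 2 = bt ^ 2 := by rw [hbt]; ring
    rw [hbt2]
    -- The term with `m s - m t` is bounded because `|m t - c| ≥ δ`; in the term with `p s - p t` the
    -- factor `|t - yc|` is absorbed by `|p t - Re c| ≥ κ |t - yc|`.
    have hterm1 : |as * at' + e2| * |m s - m t| * |t - yc|
        ≤ Λ * L ^ 2 / δ ^ 2 * ((at' ^ 2 + e2) * (bt ^ 2 + e2)) := by
      have h1 : δ ^ 2 ≤ bt ^ 2 + e2 := by
        have : δ ^ 2 ≤ bt ^ 2 := by gcongr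
        linarith
      calc |as * at' + e2| * |m s - m t| * |t - yc| ≤ (at' ^ 2 + e2) * (Λ * L) * L := by
            have : |m s - m t| ≤ Λ * L := hmst.trans (by gcongr)
            gcongr
        _ = Λ * L ^ 2 / δ ^ 2 * ((at' ^ 2 + e2) * δ ^ 2) := by field_simp
        _ ≤ _ := by gcongr
    have hterm2 : |p s - p t| * |(m s - c.re) * (m t - c.re) + e2| * |t - yc|
        ≤ (1 + Λ * L / δ) / κ * ((at' ^ 2 + e2) * (bt ^ 2 + e2)) := by
      calc |p s - p t| * |(m s - c.re) * (m t - c.re) + e2| * |t - yc|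
          ≤ |at'| * ((1 + Λ * L / δ) * (bt ^ 2 + e2)) * (|at'| / κ) := by
            have : |t - yc| ≤ |at'| / κ := by rw [le_div_iff₀ hκ]; linarith
            gcongr
        _ = (1 + Λ * L / δ) / κ * (at' ^ 2 * (bt ^ 2 + e2)) := by
            rw [← sq_abs at']; field_simp
        _ ≤ _ := by gcongr; linarith
    calc |c.im| * |(as * at' + e2) * (m s - m t) + (p s - p t) * ((m s - c.re) * (m t - c.re) + e2)|
            * |t - yc|
        ≤ |c.im| * (|as * at' + e2| * |m s - m t|
            + |p s - p t| * |(m s - c.re) * (m t - c.re) + e2|) * |t - yc| := by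
          gcongr
          refine (abs_add_le _ _).trans ?_
          rw [abs_mul, abs_mul]
      _ = |c.im| * (|as * at' + e2| * |m s - m t| * |t - yc|
            + |p s - p t| * |(m s - c.re) * (m t - c.re) + e2| * |t - yc|) := by ring
      _ ≤ |c.im| * (Λ * L ^ 2 / δ ^ 2 * ((at' ^ 2 + e2) * (bt ^ 2 + e2))
            + (1 + Λ * L / δ) / κ * ((at' ^ 2 + e2) * (bt ^ 2 + e2))) := by gcongr
      _ = _ := by rw [hr]; ring) hy
  refine key.trans ?_
  rw [mul_assoc _ r]
  gcongr

end HalfProfile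

/-! ### The reduced quantities of a half channel -/

/-- `I = ∫₀¹ dy / (H f²)`. -/
noncomputable def halfI (p m : ℝ → ℝ) (c : ℂ) (f : ℝ → ℂ) : ℂ :=
  ∫ y in (0 : ℝ)..1, 1 / (profileH p m c y * f y ^ 2)

/-- `X = f(0)² I`. -/
noncomputable def halfX (p m : ℝ → ℝ) (c : ℂ) (f : ℝ → ℂ) : ℂ := f 0 ^ 2 * halfI p m c f

/-- `A = - c² f'(0) / f(0)`. -/
noncomputable def halfA (c : ℂ) (yc : ℝ) (f : ℝ → ℂ) : ℂ :=
  -(c ^ 2 * derivWithin f (Icc 0 (max 1 yc)) 0 / f 0)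

/-- The numerator `|X|² A + X̄` of `A + 1 / X`, the Dirichlet-to-Neumann number at `0` of the
solution that vanishes at `1`. -/
noncomputable def halfB (p m : ℝ → ℝ) (c : ℂ) (yc : ℝ) (f : ℝ → ℂ) : ℂ :=
  (‖halfX p m c f‖ ^ 2 : ℝ) * halfA c yc f + (starRingEnd ℂ) (halfX p m c f)

theorem zero_mem_span {yc : ℝ} : (0 : ℝ) ∈ Icc 0 (max 1 yc) :=
  ⟨le_rfl, zero_le_one.trans (le_max_left _ _)⟩

theorem unit_subset_span {yc : ℝ} : Icc (0 : ℝ) 1 ⊆ Icc 0 (max 1 yc) :=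
  Icc_subset_Icc_right (le_max_left _ _)

namespace RegularBounds

variable {C yc : ℝ} {f : ℝ → ℂ}

theorem ne_zero (hb : RegularBounds C yc f) {y : ℝ} (hy : y ∈ Icc 0 (max 1 yc)) : f y ≠ 0 :=
  norm_pos_iff.1 (zero_lt_one.trans_le (hb.one_le y hy))

end RegularBounds

namespace HalfProfile

variable {κ Λ L : ℝ} {p m dp dm : ℝ → ℝ} {c : ℂ} {yc : ℝ} {f : ℝ → ℂ}

theorem profileH_zero (h : HalfProfile κ Λ L p m dp dm) (c : ℂ) : profileH p m c 0 = c ^ 2 := by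
  rw [profileH, h.p_zero, h.m_zero]; push_cast; ring

theorem profileH_re (p m : ℝ → ℝ) (c : ℂ) (y : ℝ) :
    (profileH p m c y).re = (c.re - p y) * (c.re - m y) - c.im ^ 2 := by
  simp only [profileH, Complex.mul_re, Complex.sub_re, Complex.sub_im, Complex.ofReal_re,
    Complex.ofReal_im]
  ring

theorem profileH_im (p m : ℝ → ℝ) (c : ℂ) (y : ℝ) :
    (profileH p m c y).im = c.im * ((c.re - p y) + (c.re - m y)) := by
  simp only [profileH, Complex.mul_im, Complex.sub_re, Complex.sub_im, Complex.ofReal_re,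
    Complex.ofReal_im]
  ring

theorem exists_norm_halfA_le (h : HalfProfile κ Λ L p m dp dm) (α R : ℝ) :
    ∃ C, 0 ≤ C ∧ ∀ c yc f, HalfSol α p m L c yc f → ‖c‖ ≤ R → ‖halfA c yc f‖ ≤ C := by
  obtain ⟨M, hM1, hM⟩ := h.exists_regularBounds α
  have hL : 0 < L := zero_lt_one.trans_le h.one_le
  refine ⟨R ^ 2 * (M * L), by positivity, fun c yc f hf hc => ?_⟩
  have hb := hM c yc f hf
  have h1 := hb.one_le 0 zero_mem_span
  have h2 := hb.deriv_le 0 zero_mem_span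
  have h3 : |0 - yc| ≤ L := by
    rw [zero_sub, abs_neg, abs_of_nonneg hf.crit.mem.1]; exact hf.crit.mem.2
  rw [halfA, norm_neg, norm_div, norm_mul, norm_pow]
  refine (div_le_self (by positivity) h1).trans ?_
  gcongr
  exact h2.trans (by gcongr)

/-- The energy of the regular solution on `[0, yc]`, where `H` has positive real part up to
`O(|Im c|²)`, makes `Re A` positive away from the origin. -/
theorem exists_halfA_re_ge (h : HalfProfile κ Λ L p m dp dm) {α δ : ℝ} (hα : 1 ≤ |α|)
    (hδ : 0 < δ) :
    ∃ ε₀ a₀, 0 < ε₀ ∧ 0 < a₀ ∧ ∀ c yc f, HalfSol α p m L c yc f → δ ≤ c.re →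
      ‖c - p yc‖ ≤ ε₀ → a₀ ≤ (halfA c yc f).re := by
  obtain ⟨M, hM1, hM⟩ := h.exists_regularBounds α
  have hκ := h.κ_pos
  have hΛ := h.Λ_pos
  have hL : 0 < L := zero_lt_one.trans_le h.one_le
  have hα2 : 1 ≤ α ^ 2 := by rw [← sq_abs]; nlinarith
  set CQ := (M * L) ^ 2 + α ^ 2 * M ^ 2 with hCQ
  have hCQ0 : 0 < CQ := by positivity
  -- `w / 2` bounds `∫_0^yc κ δ (yc - s) ds` below, because `yc ≥ δ / (2 Λ)`; the error `(Im c)² Q`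
  -- takes up at most half of it.
  set w := κ * δ * (δ / (2 * Λ)) ^ 2 with hw
  have hw0 : 0 < w := by positivity
  refine ⟨min (δ / 2) (min 1 (w / (4 * CQ * L))), w / (4 * M ^ 2), by positivity, by positivity,
    fun c yc f hf hc hpc => ?_⟩
  have k := h.sturmKernel hf.crit
  have hb := hM c yc f hf
  set J := Icc 0 (max 1 yc) with hJ
  set f' := derivWithin f J with hf'
  set Q : ℝ → ℝ := fun t => ‖f' t‖ ^ 2 + α ^ 2 * ‖f t‖ ^ 2 with hQ
  have hQc : ContinuousOn Q J :=
    (hf.sol.continuousOn_deriv.norm.pow 2).add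
      (continuousOn_const.mul (hf.sol.continuousOn.norm.pow 2))
  have hHQ : ContinuousOn (fun t => profileH p m c t * (Q t : ℂ)) J :=
    k.cont.mul (Complex.continuous_ofReal.comp_continuousOn hQc)
  have hsub : uIcc 0 yc ⊆ J := uIcc_subset_Icc zero_mem_span k.mem
  have hflux : ∫ s in (0 : ℝ)..yc, profileH p m c s * (Q s : ℂ)
      = -(c ^ 2 * f' 0 * (starRingEnd ℂ) (f 0)) := by
    rw [integral_eq_sub_of_hasDerivWithinAt_Icc (fun t ht =>
      hasDerivWithinAt_energy (hf.sol.hasDerivWithinAt ht) (hf.sol.ode t ht)) hHQ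
      zero_mem_span k.mem]
    have hslope : f' yc = 0 := hf.sol.slope
    simp only [← hJ, ← hf', hslope, h.profileH_zero]
    ring
  have hf0 : f 0 ≠ 0 := hb.ne_zero zero_mem_span
  have hA : halfA c yc f = ((‖f 0‖ ^ 2)⁻¹ : ℝ) *
      ∫ s in (0 : ℝ)..yc, profileH p m c s * (Q s : ℂ) := by
    have : (starRingEnd ℂ) (f 0) ≠ 0 := by simpa using hf0
    rw [hflux, halfA]
    push_cast
    rw [← Complex.mul_conj', ← hJ, ← hf']
    field_simp
  have hre : (∫ s in (0 : ℝ)..yc, profileH p m c s * (Q s : ℂ)).re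
      = ∫ s in (0 : ℝ)..yc, (profileH p m c s).re * Q s := by
    have h2 := Complex.reCLM.intervalIntegral_comp_comm
      ((hHQ.mono hsub).intervalIntegrable (μ := MeasureTheory.volume))
    simp only [Complex.reCLM_apply] at h2
    rw [← h2]
    exact intervalIntegral.integral_congr fun s _ => Complex.re_mul_ofReal _ _
  have hreH : ContinuousOn (fun s => (profileH p m c s).re * Q s) J :=
    (Complex.continuous_re.comp_continuousOn k.cont).mul hQc
  set e₀ := min (δ / 2) (min 1 (w / (4 * CQ * L))) with he₀
  have him : |c.im| ≤ e₀ := by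
    have := Complex.abs_im_le_norm (c - p yc)
    simp only [Complex.sub_im, Complex.ofReal_im, sub_zero] at this
    exact this.trans hpc
  have hree : c.re - p yc ≤ e₀ := by
    have := (le_abs_self _).trans (Complex.abs_re_le_norm (c - p yc))
    simp only [Complex.sub_re, Complex.ofReal_re] at this
    exact this.trans hpc
  have he1 : e₀ ≤ δ / 2 := min_le_left _ _
  have he2 : e₀ ≤ 1 := (min_le_right _ _).trans (min_le_left _ _)
  have he3 : e₀ ≤ w / (4 * CQ * L) := (min_le_right _ _).trans (min_le_right _ _)
  have himsq : c.im ^ 2 ≤ w / (4 * CQ * L) := by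
    rw [← sq_abs]
    nlinarith [abs_nonneg c.im]
  have hyc : δ / (2 * Λ) ≤ yc := by
    rw [div_le_iff₀ (by positivity)]
    nlinarith [h.p_le hf.crit.mem]
  have hlow : w / 4 ≤ ∫ s in (0 : ℝ)..yc, (profileH p m c s).re * Q s := by
    have hi : ∫ s in (0 : ℝ)..yc, (κ * δ * (yc - s) - w / (4 * CQ * L) * CQ)
        = κ * δ * (yc ^ 2 / 2) - w / (4 * CQ * L) * CQ * yc := by
      rw [intervalIntegral.integral_sub (by apply Continuous.intervalIntegrable; fun_prop)
        (by simp), intervalIntegral.integral_const_mul, intervalIntegral.integral_const,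
        intervalIntegral.integral_sub (by simp) (by apply Continuous.intervalIntegrable; fun_prop),
        integral_id, intervalIntegral.integral_const]
      simp only [smul_eq_mul]; ring
    have hmono : ∫ s in (0 : ℝ)..yc, (κ * δ * (yc - s) - w / (4 * CQ * L) * CQ)
        ≤ ∫ s in (0 : ℝ)..yc, (profileH p m c s).re * Q s := by
      refine intervalIntegral.integral_mono_on hf.crit.mem.1
        (by apply Continuous.intervalIntegrable; fun_prop)
        (hreH.mono hsub).intervalIntegrable fun s hs => ?_
      have hsJ : s ∈ J := hsub (by rwa [uIcc_of_le hf.crit.mem.1])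
      have hsL := h.subset hf.crit hsJ
      have hQ1 : 1 ≤ Q s := by
        have := hb.one_le s hsJ
        have : 1 ≤ ‖f s‖ ^ 2 := by nlinarith
        have h0 : 0 ≤ ‖f' s‖ ^ 2 := by positivity
        simp only [hQ]; nlinarith
      have hQ2 : Q s ≤ CQ := by
        have h1 := hb.norm_le s hsJ
        have h2 : ‖f' s‖ ≤ M * L := by
          refine (hb.deriv_le s hsJ).trans ?_
          have : |s - yc| ≤ L := by
            rw [abs_le]; constructor <;> linarith [hs.1, hs.2, hf.crit.mem.2]
          gcongr
        simp only [hQ, hCQ]; gcongr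
      rw [profileH_re]
      have h1 : κ * (yc - s) ≤ c.re - p s := by
        have := h.p_lower hsL hf.crit.mem hs.2
        linarith [hf.crit.le]
      have h2 : δ ≤ c.re - m s := by
        have := h.m_nonpos hsL
        have := mul_nonneg hκ.le hsL.1
        linarith
      have h3 : 0 ≤ κ * (yc - s) := mul_nonneg hκ.le (by linarith [hs.2])
      have hps : 0 ≤ c.re - p s := h3.trans h1
      have h4 : κ * δ * (yc - s) ≤ (c.re - p s) * (c.re - m s) := by
        calc κ * δ * (yc - s) = κ * (yc - s) * δ := by ring
          _ ≤ _ := by gcongr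
      have h5 : κ * δ * (yc - s) ≤ (c.re - p s) * (c.re - m s) * Q s := by
        have : 0 ≤ (c.re - p s) * (c.re - m s) := by
          refine le_trans ?_ h4
          have := mul_nonneg h3 hδ.le; linarith
        nlinarith
      have h6 : c.im ^ 2 * Q s ≤ w / (4 * CQ * L) * CQ := by gcongr
      linarith
    have h1 : w ≤ κ * δ * yc ^ 2 := by rw [hw]; gcongr
    have h2 : w / (4 * CQ * L) * CQ * yc ≤ w / 4 := by
      calc w / (4 * CQ * L) * CQ * yc ≤ w / (4 * CQ * L) * CQ * L := by
            have := hf.crit.mem.2; gcongr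
        _ = _ := by field_simp
    linarith
  rw [hA, Complex.re_ofReal_mul, hre]
  have hn := hb.norm_le 0 zero_mem_span
  have hn1 := hb.one_le 0 zero_mem_span
  calc w / (4 * M ^ 2) = (M ^ 2)⁻¹ * (w / 4) := by field_simp
    _ ≤ _ := by gcongr

/-! ### The sign of the Dirichlet-to-Neumann number -/

/-- The flux identity for the solution `g = f ∫_y^1 1 / (H f²)` that vanishes at `1`: because
`Im (c̄ H) = Im c (|c|² - p m)` has a sign, so does the imaginary part of `c̄ (|X|² A + X̄)`. The
flux density is `q = (|c|² - p m) (|g'|² + α² |g|²)`, and `F y = ∫_y^1 1 / (H f²)`, so that the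
lower bound stated for `q y` is `|c|² |g' y|²`. -/
theorem halfB_im_ge (h : HalfProfile κ Λ L p m dp dm) {α M : ℝ} (hf : HalfSol α p m L c yc f)
    (hb : RegularBounds M yc f) (hc : c.im ≠ 0) :
    ∃ q : ℝ → ℝ, ContinuousOn q (Icc 0 1) ∧ (∀ y ∈ Icc (0 : ℝ) 1, 0 ≤ q y) ∧
      (∀ y ∈ Icc (0 : ℝ) 1, ∃ F : ℂ, ‖F‖ ≤ 1 / (|c.im| * ‖c‖) ∧
        ‖c‖ ^ 2 * ‖derivWithin f (Icc 0 (max 1 yc)) y * F - 1 / (profileH p m c y * f y)‖ ^ 2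
          ≤ q y) ∧
      |c.im| * ∫ y in (0 : ℝ)..1, q y
        ≤ c.im / |c.im| * ((starRingEnd ℂ) c * halfB p m c yc f).im := by
  have k := h.sturmKernel hf.crit
  have hsub : Icc (0 : ℝ) 1 ⊆ Icc 0 (max 1 yc) := unit_subset_span
  set f' := derivWithin f (Icc 0 (max 1 yc)) with hf'
  set H := profileH p m c with hH
  have hc0 : c ≠ 0 := fun h0 => hc (by simp [h0])
  have hcn : 0 < ‖c‖ := norm_pos_iff.2 hc0
  have hci : 0 < |c.im| := abs_pos.2 hc
  have hHlow : ∀ y ∈ Icc (0 : ℝ) 1, |c.im| * ‖c‖ ≤ ‖H y‖ := fun y hy => by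
    rw [hH, profileH, norm_mul]
    have h1 : |c.im| ≤ ‖(p y : ℂ) - c‖ := by
      simpa using Complex.abs_im_le_norm ((p y : ℂ) - c)
    have h2 := h.norm_m_sub_ge hf.crit (h.subset hf.crit (hsub hy))
    gcongr
  have hHne : ∀ y ∈ Icc (0 : ℝ) 1, H y ≠ 0 := fun y hy =>
    norm_pos_iff.1 ((mul_pos hci hcn).trans_le (hHlow y hy))
  have hfne : ∀ y ∈ Icc (0 : ℝ) 1, f y ≠ 0 := fun y hy => hb.ne_zero (hsub hy)
  have hHc : ContinuousOn H (Icc 0 1) := k.cont.mono hsub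
  have hfc : ContinuousOn f (Icc 0 1) := hf.sol.continuousOn.mono hsub
  have hf'c : ContinuousOn f' (Icc 0 1) := hf.sol.continuousOn_deriv.mono hsub
  set r : ℝ → ℂ := fun y => 1 / (H y * f y ^ 2) with hr
  have hrc : ContinuousOn r (Icc 0 1) := continuousOn_const.div (hHc.mul (hfc.pow 2))
    fun y hy => mul_ne_zero (hHne y hy) (pow_ne_zero 2 (hfne y hy))
  -- `F y = ∫_y^1 r`
  set F : ℝ → ℂ := fun y => -∫ s in (1 : ℝ)..y, r s with hF
  have h1m : (1 : ℝ) ∈ Icc (0 : ℝ) 1 := ⟨zero_le_one, le_rfl⟩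
  have h0m : (0 : ℝ) ∈ Icc (0 : ℝ) 1 := ⟨le_rfl, zero_le_one⟩
  have hFd : ∀ y ∈ Icc (0 : ℝ) 1, HasDerivWithinAt F (-r y) (Icc 0 1) y := fun y hy =>
    (hasDerivWithinAt_primitive hrc h1m hy).neg
  have hFc : ContinuousOn F (Icc 0 1) := fun y hy => (hFd y hy).continuousWithinAt
  have hFle : ∀ y ∈ Icc (0 : ℝ) 1, ‖F y‖ ≤ 1 / (|c.im| * ‖c‖) := fun y hy => by
    have := intervalIntegral.norm_integral_le_of_norm_le_const (a := 1) (b := y) (f := r)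
      (C := 1 / (|c.im| * ‖c‖)) (fun s hs => by
        have hs' : s ∈ Icc (0 : ℝ) 1 := uIcc_subset_Icc h1m hy (uIoc_subset_uIcc hs)
        have h1 := hb.one_le s (hsub hs')
        have h2 : 1 ≤ ‖f s‖ ^ 2 := by nlinarith
        rw [hr, norm_div, norm_one, norm_mul, norm_pow]
        refine one_div_le_one_div_of_le (by positivity) ?_
        calc |c.im| * ‖c‖ = |c.im| * ‖c‖ * 1 := (mul_one _).symm
          _ ≤ _ := mul_le_mul (hHlow s hs') h2 zero_le_one (norm_nonneg _))
    rw [hF, norm_neg]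
    refine this.trans ?_
    have : |y - 1| ≤ 1 := by rw [abs_le]; constructor <;> linarith [hy.1, hy.2]
    exact mul_le_of_le_one_right (by positivity) this
  set g : ℝ → ℂ := fun y => f y * F y with hg
  set g' : ℝ → ℂ := fun y => f' y * F y - 1 / (H y * f y) with hg'
  have hgd : ∀ y ∈ Icc (0 : ℝ) 1, HasDerivWithinAt g (g' y) (Icc 0 1) y := fun y hy => by
    refine (((hf.sol.hasDerivWithinAt (hsub hy)).mono hsub).mul (hFd y hy)).congr_deriv ?_
    have := hfne y hy
    have := hHne y hy
    simp only [hg', hr]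
    field_simp
    ring
  -- `g = f F` solves the same equation as `f`: `H g' = (H f') F - 1 / f`.
  have hvd : ∀ y ∈ Icc (0 : ℝ) 1,
      HasDerivWithinAt (fun s => H s * g' s) ((α : ℂ) ^ 2 * H y * g y) (Icc 0 1) y := fun y hy => by
    have e1 := ((hf.sol.ode y (hsub hy)).mono hsub).mul (hFd y hy)
    have e2 := ((hf.sol.hasDerivWithinAt (hsub hy)).mono hsub).inv (hfne y hy)
    refine ((e1.sub e2).congr_of_mem (fun s hs => ?_) hy).congr_deriv ?_
    · have := hfne s hs
      have := hHne s hs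
      simp only [hg', Pi.sub_apply, Pi.mul_apply, Pi.inv_apply, ← hH, ← hf']
      field_simp
    · have := hfne y hy
      have := hHne y hy
      simp only [hg, hr]
      field_simp
      ring
  have hgc : ContinuousOn g (Icc 0 1) := hfc.mul hFc
  have hg'c : ContinuousOn g' (Icc 0 1) := (hf'c.mul hFc).sub
    (continuousOn_const.div (hHc.mul hfc) fun y hy => mul_ne_zero (hHne y hy) (hfne y hy))
  set Q : ℝ → ℝ := fun y => ‖g' y‖ ^ 2 + α ^ 2 * ‖g y‖ ^ 2 with hQ
  have hQc : ContinuousOn Q (Icc 0 1) :=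
    (hg'c.norm.pow 2).add (continuousOn_const.mul (hgc.norm.pow 2))
  have hHQ : ContinuousOn (fun t => H t * (Q t : ℂ)) (Icc 0 1) :=
    hHc.mul (Complex.continuous_ofReal.comp_continuousOn hQc)
  -- Since `g 1 = 0`, only the end `0` contributes to the energy identity.
  have hen := integral_eq_sub_of_hasDerivWithinAt_Icc
    (fun t ht => hasDerivWithinAt_energy (hgd t ht) (hvd t ht)) hHQ h0m h1m
  have hF1 : F 1 = 0 := by simp [hF]
  have hF0 : F 0 = halfI p m c f := by
    simp only [hF, halfI, hr]; rw [intervalIntegral.integral_symm, neg_neg]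
  have hB : halfB p m c yc f = ((‖f 0‖ ^ 2 : ℝ) : ℂ) * ∫ t in (0 : ℝ)..1, H t * (Q t : ℂ) := by
    have hf0 : f 0 ≠ 0 := hfne 0 h0m
    rw [hen]
    simp only [hg, hg', hF1, mul_zero, map_zero, zero_sub, hF0]
    rw [halfB, halfA, halfX, hH, h.profileH_zero, ← hf']
    push_cast
    rw [← Complex.mul_conj', ← Complex.mul_conj', map_mul, map_mul, map_pow]
    field_simp
    ring
  set q : ℝ → ℝ := fun y => (‖c‖ ^ 2 - p y * m y) * Q y with hq
  have hI : Icc (0 : ℝ) 1 ⊆ Icc 0 L := Icc_subset_Icc_right h.one_le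
  have hpm : ∀ y ∈ Icc (0 : ℝ) 1, ‖c‖ ^ 2 ≤ ‖c‖ ^ 2 - p y * m y := fun y hy => by
    have h1 := h.p_nonneg (hI hy)
    have h2 := h.m_nonpos (hI hy)
    have h3 := mul_nonneg h.κ_pos.le hy.1
    have : p y * m y ≤ 0 := mul_nonpos_of_nonneg_of_nonpos (by linarith) (by linarith)
    linarith
  have hQ0 : ∀ y, 0 ≤ Q y := fun y => by positivity
  have hqc : ContinuousOn q (Icc 0 1) :=
    (continuousOn_const.sub ((h.continuousOn_p.mono hI).mul (h.continuousOn_m.mono hI))).mul hQc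
  have hq0 : ∀ y ∈ Icc (0 : ℝ) 1, 0 ≤ q y := fun y hy =>
    mul_nonneg ((sq_nonneg _).trans (hpm y hy)) (hQ0 y)
  refine ⟨q, hqc, hq0, fun y hy => ⟨F y, hFle y hy, ?_⟩, ?_⟩
  · have h1 : ‖g' y‖ ^ 2 ≤ Q y := by
      have : 0 ≤ α ^ 2 * ‖g y‖ ^ 2 := by positivity
      simp only [hQ]; linarith
    exact mul_le_mul (hpm y hy) h1 (by positivity) ((sq_nonneg _).trans (hpm y hy))
  · have him : ((starRingEnd ℂ) c * ∫ t in (0 : ℝ)..1, H t * (Q t : ℂ)).im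
        = c.im * ∫ t in (0 : ℝ)..1, q t := by
      have hu : uIcc (0 : ℝ) 1 = Icc 0 1 := uIcc_of_le zero_le_one
      have hint : IntervalIntegrable (fun t => (starRingEnd ℂ) c * (H t * (Q t : ℂ)))
          MeasureTheory.volume 0 1 := by
        refine ContinuousOn.intervalIntegrable ?_
        rw [hu]; exact continuousOn_const.mul hHQ
      have h2 := Complex.imCLM.intervalIntegral_comp_comm hint
      simp only [Complex.imCLM_apply] at h2
      rw [← intervalIntegral.integral_const_mul, ← h2, ← intervalIntegral.integral_const_mul]
      refine intervalIntegral.integral_congr fun t _ => ?_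
      simp only [hq, hH, profileH, Complex.sq_norm, Complex.normSq_apply, Complex.mul_re,
        Complex.mul_im, Complex.sub_re, Complex.sub_im, Complex.ofReal_re, Complex.ofReal_im,
        Complex.conj_re, Complex.conj_im]
      ring
    have hf1 : 1 ≤ ‖f 0‖ ^ 2 := by nlinarith [hb.one_le 0 zero_mem_span]
    have hint0 : 0 ≤ ∫ t in (0 : ℝ)..1, q t :=
      intervalIntegral.integral_nonneg zero_le_one hq0
    rw [hB, mul_left_comm, Complex.im_ofReal_mul, him]
    have e : c.im / |c.im| * (‖f 0‖ ^ 2 * (c.im * ∫ t in (0 : ℝ)..1, q t))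
        = ‖f 0‖ ^ 2 * (|c.im| * ∫ t in (0 : ℝ)..1, q t) := by
      have : c.im * c.im = |c.im| * |c.im| := (abs_mul_abs_self _).symm
      field_simp
      rw [sq, this]; ring
    rw [e]
    have : 0 ≤ |c.im| * ∫ t in (0 : ℝ)..1, q t := by positivity
    nlinarith

theorem halfB_im_nonneg (h : HalfProfile κ Λ L p m dp dm) {α : ℝ} (hf : HalfSol α p m L c yc f)
    (hc : c.im ≠ 0) : 0 ≤ c.im / |c.im| * ((starRingEnd ℂ) c * halfB p m c yc f).im := by
  obtain ⟨M, -, hM⟩ := h.exists_regularBounds α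
  obtain ⟨q, -, hq0, -, hle⟩ := h.halfB_im_ge hf (hM c yc f hf) hc
  exact (mul_nonneg (abs_nonneg _) (intervalIntegral.integral_nonneg zero_le_one hq0)).trans hle

/-- When the critical point lies in `[0, 1]`, an interval of length `|Im c|` next to it contributes
a fixed amount to the flux, uniformly in `c`. This is what remains of the absorption at the critical
layer as `Im c → 0`, and it does not degenerate as `c → 0`. -/
theorem exists_halfB_im_ge (h : HalfProfile κ Λ L p m dp dm) (α : ℝ) :
    ∃ ε₀ n₀, 0 < ε₀ ∧ 0 < n₀ ∧ ∀ c yc f, HalfSol α p m L c yc f → c.im ≠ 0 → |c.im| ≤ ε₀ →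
      yc ≤ 1 → c.re = p yc →
      n₀ ≤ c.im / |c.im| * ((starRingEnd ℂ) c * halfB p m c yc f).im := by
  obtain ⟨M, hM1, hM⟩ := h.exists_regularBounds α
  have hκ := h.κ_pos
  have hΛ := h.Λ_pos
  have hM0 : 0 < M := by linarith
  -- `2 c₁ / (|Im c| |c|)` bounds `1 / |H f|` below next to `yc`, where the other part of `g'` is at most
  -- half as large.
  set c₁ := 1 / (2 * M * (Λ + 1) * (Λ / κ + Λ + 1)) with hc₁
  have hc₁0 : 0 < c₁ := by positivity
  refine ⟨min (1 / 2) (c₁ / M), c₁ ^ 2, by positivity, by positivity,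
    fun c yc f hf hc hce hyc hpc => ?_⟩
  have hb := hM c yc f hf
  obtain ⟨q, hqc, hq0, hqF, hle⟩ := h.halfB_im_ge hf hb hc
  refine le_trans ?_ hle
  have hc0 : c ≠ 0 := fun h0 => hc (by simp [h0])
  have hcn : 0 < ‖c‖ := norm_pos_iff.2 hc0
  have hci : 0 < |c.im| := abs_pos.2 hc
  have he1 : |c.im| ≤ 1 / 2 := hce.trans (min_le_left _ _)
  have he2 : M * |c.im| ≤ c₁ := by
    have := hce.trans (min_le_right _ _)
    rw [le_div_iff₀ hM0] at this; linarith
  -- an interval of length `|Im c|` with end point `yc`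
  obtain ⟨a, b, ha, hb1, hba, hab⟩ : ∃ a b : ℝ, 0 ≤ a ∧ b ≤ 1 ∧ b - a = |c.im| ∧
      ∀ y ∈ Icc a b, |y - yc| ≤ |c.im| := by
    rcases le_total yc (1 / 2) with hy | hy
    · refine ⟨yc, yc + |c.im|, hf.crit.mem.1, by linarith, by ring, fun y hy => ?_⟩
      rw [abs_of_nonneg (by linarith [hy.1])]; linarith [hy.2]
    · refine ⟨yc - |c.im|, yc, by linarith, hyc, by ring, fun y hy => ?_⟩
      rw [abs_of_nonpos (by linarith [hy.2])]; linarith [hy.1]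
  have hablt : a ≤ b := by linarith
  have hpt : ∀ y ∈ Icc a b, c₁ ^ 2 / |c.im| ^ 2 ≤ q y := by
    intro y hy
    have hy1 : y ∈ Icc (0 : ℝ) 1 := ⟨ha.trans hy.1, hy.2.trans hb1⟩
    have hyJ : y ∈ Icc 0 (max 1 yc) := unit_subset_span hy1
    have hyL := h.subset hf.crit hyJ
    have hyc' := hab y hy
    obtain ⟨F, hF, hFq⟩ := hqF y hy1
    refine le_trans ?_ hFq
    have h1 : ‖derivWithin f (Icc 0 (max 1 yc)) y * F‖ ≤ M / ‖c‖ := by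
      rw [norm_mul]
      calc _ ≤ (M * |c.im|) * (1 / (|c.im| * ‖c‖)) := by
            have := hb.deriv_le y hyJ
            have h' : M * |y - yc| ≤ M * |c.im| := by gcongr
            gcongr
            exact this.trans h'
        _ = _ := by field_simp
    have h2 : 2 * c₁ / (|c.im| * ‖c‖) ≤ ‖1 / (profileH p m c y * f y)‖ := by
      have hp : ‖(p y : ℂ) - c‖ ≤ (Λ + 1) * |c.im| := by
        have e : (p y : ℂ) - c = ((p y - p yc : ℝ) : ℂ) - (c.im : ℂ) * Complex.I := by
          apply Complex.ext <;> simp [hpc]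
        rw [e]
        refine (norm_sub_le _ _).trans ?_
        rw [norm_mul, Complex.norm_I, Complex.norm_real, Complex.norm_real, Real.norm_eq_abs,
          Real.norm_eq_abs]
        have := h.abs_p_sub_le hyL hf.crit.mem
        have : Λ * |y - yc| ≤ Λ * |c.im| := by gcongr
        linarith
      have hm : ‖(m y : ℂ) - c‖ ≤ (Λ / κ + Λ + 1) * ‖c‖ := by
        refine (norm_sub_le _ _).trans ?_
        rw [Complex.norm_real, Real.norm_eq_abs]
        have e1 := h.m_nonpos hyL
        have e2 := mul_nonneg hκ.le hyL.1
        rw [abs_of_nonpos (by linarith)]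
        have e3 := h.m_ge hyL
        have e4 : Λ * y ≤ Λ * (yc + |c.im|) := by
          have := (abs_le.1 hyc').2
          gcongr; linarith
        have e5 : Λ * yc ≤ Λ / κ * ‖c‖ := by
          rw [div_mul_eq_mul_div, le_div_iff₀ hκ]
          have := h.crit_le hf.crit
          calc Λ * yc * κ = Λ * (κ * yc) := by ring
            _ ≤ _ := by gcongr
        have e6 : Λ * |c.im| ≤ Λ * ‖c‖ := by
          have := Complex.abs_im_le_norm c
          gcongr
        linarith
      have hfy := hb.norm_le y hyJ
      have hfy1 := hb.one_le y hyJ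
      have hHpos : 0 < ‖profileH p m c y‖ := by
        rw [profileH, norm_mul]
        have h1 : |c.im| ≤ ‖(p y : ℂ) - c‖ := by
          simpa using Complex.abs_im_le_norm ((p y : ℂ) - c)
        have h2 := h.norm_m_sub_ge hf.crit hyL
        exact mul_pos (hci.trans_le h1) (hcn.trans_le h2)
      rw [norm_div, norm_one, norm_mul, div_le_div_iff₀ (by positivity) (by positivity)]
      calc 2 * c₁ * (‖profileH p m c y‖ * ‖f y‖)
          ≤ 2 * c₁ * (((Λ + 1) * |c.im| * ((Λ / κ + Λ + 1) * ‖c‖)) * M) := by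
            rw [profileH, norm_mul]; gcongr
        _ = 1 * (|c.im| * ‖c‖) := by rw [hc₁]; field_simp
    have h3 : M / ‖c‖ ≤ c₁ / (|c.im| * ‖c‖) := by
      rw [div_le_div_iff₀ hcn (by positivity)]
      nlinarith
    have h4 : c₁ / (|c.im| * ‖c‖)
        ≤ ‖derivWithin f (Icc 0 (max 1 yc)) y * F - 1 / (profileH p m c y * f y)‖ := by
      have := norm_sub_norm_le (1 / (profileH p m c y * f y))
        (derivWithin f (Icc 0 (max 1 yc)) y * F)
      rw [norm_sub_rev] at this
      have e : 2 * c₁ / (|c.im| * ‖c‖) = c₁ / (|c.im| * ‖c‖) + c₁ / (|c.im| * ‖c‖) := by ring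
      linarith
    calc c₁ ^ 2 / |c.im| ^ 2 = ‖c‖ ^ 2 * (c₁ / (|c.im| * ‖c‖)) ^ 2 := by field_simp
      _ ≤ _ := by gcongr
  have hsub : Icc a b ⊆ Icc (0 : ℝ) 1 := Icc_subset_Icc ha hb1
  have hqi : ∀ x ∈ Icc (0 : ℝ) 1, ∀ y ∈ Icc (0 : ℝ) 1,
      IntervalIntegrable q MeasureTheory.volume x y := fun x hx y hy =>
    (hqc.mono (uIcc_subset_Icc hx hy)).intervalIntegrable
  have h0m : (0 : ℝ) ∈ Icc (0 : ℝ) 1 := ⟨le_rfl, zero_le_one⟩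
  have h1m : (1 : ℝ) ∈ Icc (0 : ℝ) 1 := ⟨zero_le_one, le_rfl⟩
  have ham : a ∈ Icc (0 : ℝ) 1 := hsub ⟨le_rfl, hablt⟩
  have hbm : b ∈ Icc (0 : ℝ) 1 := hsub ⟨hablt, le_rfl⟩
  have hsplit : ∫ y in (0 : ℝ)..1, q y
      = (∫ y in (0 : ℝ)..a, q y) + (∫ y in a..b, q y) + ∫ y in b..1, q y := by
    rw [intervalIntegral.integral_add_adjacent_intervals (hqi 0 h0m a ham) (hqi a ham b hbm),
      intervalIntegral.integral_add_adjacent_intervals (hqi 0 h0m b hbm) (hqi b hbm 1 h1m)]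
  have i1 : 0 ≤ ∫ y in (0 : ℝ)..a, q y := intervalIntegral.integral_nonneg ha fun y hy =>
    hq0 y ⟨hy.1, hy.2.trans ham.2⟩
  have i2 : 0 ≤ ∫ y in b..1, q y := intervalIntegral.integral_nonneg hb1 fun y hy =>
    hq0 y ⟨hbm.1.trans hy.1, hy.2⟩
  have i3 : c₁ ^ 2 / |c.im| ^ 2 * |c.im| ≤ ∫ y in a..b, q y := by
    have := intervalIntegral.integral_mono_on hablt (by simp) (hqi a ham b hbm) hpt
    rw [intervalIntegral.integral_const, hba, smul_eq_mul] at this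
    linarith
  calc c₁ ^ 2 = |c.im| * (c₁ ^ 2 / |c.im| ^ 2 * |c.im|) := by field_simp
    _ ≤ _ := by gcongr; linarith

end HalfProfile

/-! ### The logarithmic decomposition of `I` -/

/-- `σ = p'(yc) (m(yc) - c) - m'(yc) (p(yc) - c)`. -/
noncomputable def halfSigma (p m dp dm : ℝ → ℝ) (c : ℂ) (yc : ℝ) : ℂ :=
  (dp yc : ℂ) * ((m yc : ℂ) - c) - (dm yc : ℂ) * ((p yc : ℂ) - c)

/-- The integrand of `Π`. -/
noncomputable def piIntegrand (p m : ℝ → ℝ) (c : ℂ) (f : ℝ → ℂ) (y : ℝ) : ℂ :=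
  1 / profileH p m c y * (1 / f y ^ 2 - 1)

/-- The integrand of `R¹`. -/
noncomputable def r1Integrand (p m dp dm : ℝ → ℝ) (c : ℂ) (yc y : ℝ) : ℂ :=
  ((dp yc * (m yc - m y) - dm yc * (p yc - p y) : ℝ) : ℂ) / profileH p m c y

/-- The integrand of `R²`. -/
noncomputable def r2Integrand (p m dp dm : ℝ → ℝ) (c : ℂ) (yc y : ℝ) : ℂ :=
  ((dp yc - dp y : ℝ) : ℂ) / ((p y : ℂ) - c) - ((dm yc - dm y : ℝ) : ℂ) / ((m y : ℂ) - c)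

theorem norm_div_le_of_le_mul {a b : ℂ} {C : ℝ} (hC : 0 ≤ C) (h : ‖a‖ ≤ C * ‖b‖) :
    ‖a / b‖ ≤ C := by
  rw [norm_div]
  exact div_le_of_le_mul₀ (norm_nonneg _) hC h

theorem Complex.norm_log_le (w : ℂ) : ‖Complex.log w‖ ≤ |Real.log ‖w‖| + Real.pi := by
  refine (Complex.norm_le_abs_re_add_abs_im _).trans ?_
  rw [Complex.log_re, Complex.log_im]
  gcongr
  exact Complex.abs_arg_le_pi w

namespace HalfProfile

variable {κ Λ L : ℝ} {p m dp dm : ℝ → ℝ} {c : ℂ} {yc : ℝ} {f : ℝ → ℂ}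

theorem unit_subset (h : HalfProfile κ Λ L p m dp dm) : Icc (0 : ℝ) 1 ⊆ Icc 0 L :=
  Icc_subset_Icc_right h.one_le

theorem p_one_pos (h : HalfProfile κ Λ L p m dp dm) : 0 < p 1 := by
  have := h.p_nonneg h.one_mem; linarith [h.κ_pos]

theorem p_mono (h : HalfProfile κ Λ L p m dp dm) {x y : ℝ} (hx : x ∈ Icc 0 L) (hy : y ∈ Icc 0 L)
    (hxy : x ≤ y) : p x ≤ p y := by
  have := h.p_lower hx hy hxy
  have := mul_nonneg h.κ_pos.le (sub_nonneg.2 hxy)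
  linarith

theorem sub_mem_slitPlane (h : HalfProfile κ Λ L p m dp dm) (hoff : c.im ≠ 0 ∨ p 1 < c.re)
    {y : ℝ} (hy : y ∈ Icc (0 : ℝ) 1) :
    c - p y ∈ Complex.slitPlane ∧ c - m y ∈ Complex.slitPlane := by
  rcases hoff with hc | hc
  · exact ⟨Or.inr (by simpa using hc), Or.inr (by simpa using hc)⟩
  · refine ⟨Or.inl ?_, Or.inl ?_⟩
    · have := h.p_mono (h.unit_subset hy) h.one_mem hy.2
      simp only [Complex.sub_re, Complex.ofReal_re]; linarith
    · have := h.m_nonpos (h.unit_subset hy)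
      have := mul_nonneg h.κ_pos.le hy.1
      have := h.p_one_pos
      simp only [Complex.sub_re, Complex.ofReal_re]; linarith

theorem sub_ne_zero_of_off (h : HalfProfile κ Λ L p m dp dm) (hoff : c.im ≠ 0 ∨ p 1 < c.re)
    {y : ℝ} (hy : y ∈ Icc (0 : ℝ) 1) : (p y : ℂ) - c ≠ 0 ∧ (m y : ℂ) - c ≠ 0 := by
  obtain ⟨h1, h2⟩ := h.sub_mem_slitPlane hoff hy
  have h1' := Complex.slitPlane_ne_zero h1
  have h2' := Complex.slitPlane_ne_zero h2
  rw [← neg_sub, neg_ne_zero] at h1' h2'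
  exact ⟨h1', h2'⟩

/-- Continuity on `[0, 1]` of the integrands of `Π`, `R¹`, `R²` and of the logarithmic derivative. -/
theorem continuousOn_integrands (h : HalfProfile κ Λ L p m dp dm) {α M : ℝ}
    (hf : HalfSol α p m L c yc f) (hb : RegularBounds M yc f) (hoff : c.im ≠ 0 ∨ p 1 < c.re) :
    ContinuousOn (piIntegrand p m c f) (Icc 0 1) ∧
      ContinuousOn (r1Integrand p m dp dm c yc) (Icc 0 1) ∧
      ContinuousOn (r2Integrand p m dp dm c yc) (Icc 0 1) ∧
      ContinuousOn (fun y => (dp y : ℂ) / ((p y : ℂ) - c) - (dm y : ℂ) / ((m y : ℂ) - c))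
        (Icc 0 1) := by
  have hne := fun y hy => h.sub_ne_zero_of_off hoff (y := y) hy
  have hpc : ContinuousOn (fun y => (p y : ℂ) - c) (Icc 0 1) :=
    (Complex.continuous_ofReal.comp_continuousOn (h.continuousOn_p.mono h.unit_subset)).sub
      continuousOn_const
  have hmc : ContinuousOn (fun y => (m y : ℂ) - c) (Icc 0 1) :=
    (Complex.continuous_ofReal.comp_continuousOn (h.continuousOn_m.mono h.unit_subset)).sub
      continuousOn_const
  have hHc : ContinuousOn (profileH p m c) (Icc 0 1) := hpc.mul hmc
  have hHne : ∀ y ∈ Icc (0 : ℝ) 1, profileH p m c y ≠ 0 := fun y hy =>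
    mul_ne_zero (hne y hy).1 (hne y hy).2
  have hfc : ContinuousOn f (Icc 0 1) := hf.sol.continuousOn.mono unit_subset_span
  have hfne : ∀ y ∈ Icc (0 : ℝ) 1, f y ≠ 0 := fun y hy => hb.ne_zero (unit_subset_span hy)
  have c1 : ContinuousOn (piIntegrand p m c f) (Icc 0 1) :=
    (continuousOn_const.div hHc hHne).mul ((continuousOn_const.div (hfc.pow 2)
      fun y hy => pow_ne_zero 2 (hfne y hy)).sub continuousOn_const)
  have c2 : ContinuousOn (r1Integrand p m dp dm c yc) (Icc 0 1) := by
    refine ContinuousOn.div (Complex.continuous_ofReal.comp_continuousOn ?_) hHc hHne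
    exact (continuousOn_const.mul (continuousOn_const.sub
      (h.continuousOn_m.mono h.unit_subset))).sub (continuousOn_const.mul (continuousOn_const.sub
      (h.continuousOn_p.mono h.unit_subset)))
  have cdp := h.continuousOn_dp.mono h.unit_subset
  have cdm := h.continuousOn_dm.mono h.unit_subset
  have c3 : ContinuousOn (r2Integrand p m dp dm c yc) (Icc 0 1) :=
    ((Complex.continuous_ofReal.comp_continuousOn (continuousOn_const.sub cdp)).div hpc
      fun y hy => (hne y hy).1).sub
    ((Complex.continuous_ofReal.comp_continuousOn (continuousOn_const.sub cdm)).div hmc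
      fun y hy => (hne y hy).2)
  have c4 : ContinuousOn (fun y => (dp y : ℂ) / ((p y : ℂ) - c) - (dm y : ℂ) / ((m y : ℂ) - c))
      (Icc 0 1) :=
    ((Complex.continuous_ofReal.comp_continuousOn cdp).div hpc fun y hy => (hne y hy).1).sub
    ((Complex.continuous_ofReal.comp_continuousOn cdm).div hmc fun y hy => (hne y hy).2)
  exact ⟨c1, c2, c3, c4⟩

/-- The exact splitting of `σ I` into regular integrals and a logarithm: the partial fraction
`p' / (p - c) - m' / (m - c)` integrates to the logarithm, and the other integrands stay bounded as
`c` approaches the real axis. -/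
theorem sigma_mul_halfI (h : HalfProfile κ Λ L p m dp dm) {α M : ℝ} (hf : HalfSol α p m L c yc f)
    (hb : RegularBounds M yc f) (hoff : c.im ≠ 0 ∨ p 1 < c.re) :
    halfSigma p m dp dm c yc * halfI p m c f
      = halfSigma p m dp dm c yc * (∫ y in (0 : ℝ)..1, piIntegrand p m c f y)
        + (∫ y in (0 : ℝ)..1, r1Integrand p m dp dm c yc y)
        + (∫ y in (0 : ℝ)..1, r2Integrand p m dp dm c yc y)
        + (Complex.log (c - p 1) - Complex.log (c - m 1)) := by
  set σ := halfSigma p m dp dm c yc with hσ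
  have hne := fun y hy => h.sub_ne_zero_of_off hoff (y := y) hy
  have hu : uIcc (0 : ℝ) 1 = Icc 0 1 := uIcc_of_le zero_le_one
  have hfne : ∀ y ∈ Icc (0 : ℝ) 1, f y ≠ 0 := fun y hy => hb.ne_zero (unit_subset_span hy)
  obtain ⟨c1, c2, c3, c4⟩ := h.continuousOn_integrands hf hb hoff
  have hlog : ∫ y in (0 : ℝ)..1, ((dp y : ℂ) / ((p y : ℂ) - c) - (dm y : ℂ) / ((m y : ℂ) - c))
      = Complex.log (c - p 1) - Complex.log (c - m 1) := by
    rw [integral_eq_sub_of_hasDerivWithinAt_Icc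
      (f := fun y => Complex.log (c - p y) - Complex.log (c - m y)) (fun y hy => ?_) c4
      ⟨le_rfl, zero_le_one⟩ ⟨zero_le_one, le_rfl⟩]
    · simp [h.p_zero, h.m_zero]
    · obtain ⟨s1, s2⟩ := h.sub_mem_slitPlane hoff hy
      have d1 := ((((h.hasDeriv_p y (h.unit_subset hy)).mono h.unit_subset).ofReal_comp).const_sub
        c).clog_real s1
      have d2 := ((((h.hasDeriv_m y (h.unit_subset hy)).mono h.unit_subset).ofReal_comp).const_sub
        c).clog_real s2
      refine (d1.sub d2).congr_deriv ?_
      rw [← neg_sub (p y : ℂ) c, ← neg_sub (m y : ℂ) c, neg_div_neg_eq, neg_div_neg_eq]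
  have i (g : ℝ → ℂ) (hg : ContinuousOn g (Icc 0 1)) :
      IntervalIntegrable g MeasureTheory.volume 0 1 := by
    refine ContinuousOn.intervalIntegrable ?_; rwa [hu]
  have c1' : ContinuousOn (fun y => σ * piIntegrand p m c f y) (Icc 0 1) := continuousOn_const.mul c1
  have c2' : ContinuousOn (fun y => σ * piIntegrand p m c f y + r1Integrand p m dp dm c yc y)
      (Icc 0 1) := c1'.add c2
  have c3' : ContinuousOn (fun y => σ * piIntegrand p m c f y + r1Integrand p m dp dm c yc y
      + r2Integrand p m dp dm c yc y) (Icc 0 1) := c2'.add c3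
  rw [← hlog, halfI, ← intervalIntegral.integral_const_mul, ← intervalIntegral.integral_const_mul,
    ← intervalIntegral.integral_add (i _ c1') (i _ c2),
    ← intervalIntegral.integral_add (i _ c2') (i _ c3),
    ← intervalIntegral.integral_add (i _ c3') (i _ c4)]
  refine intervalIntegral.integral_congr fun y hy => ?_
  rw [hu] at hy
  obtain ⟨n1, n2⟩ := hne y hy
  have n3 := hfne y hy
  simp only [piIntegrand, r1Integrand, r2Integrand, profileH]
  rw [hσ, halfSigma]
  push_cast
  field_simp
  ring

/-- `1 / f² - 1` vanishes to second order at the critical point, against the first-order zero of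
`H`. -/
theorem norm_piIntegrand_le (h : HalfProfile κ Λ L p m dp dm) {M δ : ℝ} (k : CritPoint p L c yc)
    (hb : RegularBounds M yc f) (hM : 1 ≤ M) (hδ : 0 < δ) (hc : δ ≤ c.re) {y : ℝ}
    (hy : y ∈ Icc (0 : ℝ) 1) : ‖piIntegrand p m c f y‖ ≤ 2 * M ^ 2 * L / (κ * δ) := by
  have hκ := h.κ_pos
  have hL : 0 < L := zero_lt_one.trans_le h.one_le
  have hyJ : y ∈ Icc 0 (max 1 yc) := unit_subset_span hy
  have hyL := h.unit_subset hy
  have hfne := hb.ne_zero hyJ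
  have e : piIntegrand p m c f y = (1 - f y ^ 2) / f y ^ 2 / profileH p m c y := by
    rw [piIntegrand]; field_simp
  rw [e]
  refine norm_div_le_of_le_mul (by positivity) ?_
  have h1 := hb.one_le y hyJ
  have h2 := hb.norm_le y hyJ
  have h3 := hb.sub_one_le y hyJ
  have hyy : |y - yc| ≤ L := by
    rw [abs_le]; constructor <;> linarith [hyL.1, hyL.2, k.mem.1, k.mem.2]
  have h4 : ‖(1 - f y ^ 2) / f y ^ 2‖ ≤ 2 * M ^ 2 * |y - yc| ^ 2 := by
    rw [norm_div, norm_pow]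
    refine (div_le_self (norm_nonneg _) (one_le_pow₀ h1)).trans ?_
    have e2 : 1 - f y ^ 2 = -((f y - 1) * (f y + 1)) := by ring
    rw [e2, norm_neg, norm_mul]
    have h5 : ‖f y + 1‖ ≤ 2 * M := (norm_add_le _ _).trans (by rw [norm_one]; linarith)
    calc ‖f y - 1‖ * ‖f y + 1‖ ≤ (M * |y - yc| ^ 2) * (2 * M) := by gcongr
      _ = _ := by ring
  have h5 : κ * |y - yc| * δ ≤ ‖profileH p m c y‖ := by
    rw [profileH, norm_mul]
    have := h.norm_p_sub_ge k hyJ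
    have := (hc.trans (Complex.re_le_norm c)).trans (h.norm_m_sub_ge k hyL)
    gcongr
  calc ‖(1 - f y ^ 2) / f y ^ 2‖ ≤ 2 * M ^ 2 * (|y - yc| * |y - yc|) := by rw [← sq]; exact h4
    _ ≤ 2 * M ^ 2 * (L * |y - yc|) := by gcongr
    _ = 2 * M ^ 2 * L / (κ * δ) * (κ * |y - yc| * δ) := by field_simp
    _ ≤ _ := by gcongr

/-- The numerator of `R¹` vanishes at the critical point. -/
theorem norm_r1Integrand_le (h : HalfProfile κ Λ L p m dp dm) {δ : ℝ} (k : CritPoint p L c yc)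
    (hδ : 0 < δ) (hc : δ ≤ c.re) {y : ℝ} (hy : y ∈ Icc (0 : ℝ) 1) :
    ‖r1Integrand p m dp dm c yc y‖ ≤ 2 * Λ ^ 2 / (κ * δ) := by
  have hκ := h.κ_pos
  have hΛ := h.Λ_pos
  have hyJ : y ∈ Icc 0 (max 1 yc) := unit_subset_span hy
  have hyL := h.unit_subset hy
  refine norm_div_le_of_le_mul (by positivity) ?_
  have h5 : κ * |y - yc| * δ ≤ ‖profileH p m c y‖ := by
    rw [profileH, norm_mul]
    have := h.norm_p_sub_ge k hyJ
    have := (hc.trans (Complex.re_le_norm c)).trans (h.norm_m_sub_ge k hyL)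
    gcongr
  have b1 : |dp yc| ≤ Λ := by
    obtain ⟨u, v⟩ := h.dp_bound yc k.mem
    rw [abs_of_pos (hκ.trans_le u)]; exact v
  have b2 : |dm yc| ≤ Λ := by
    obtain ⟨u, v⟩ := h.dm_bound yc k.mem
    rw [abs_of_neg (by linarith)]; exact v
  rw [Complex.norm_real, Real.norm_eq_abs]
  calc |dp yc * (m yc - m y) - dm yc * (p yc - p y)|
      ≤ |dp yc| * |m yc - m y| + |dm yc| * |p yc - p y| := by
        rw [← abs_mul, ← abs_mul]; exact abs_sub _ _
    _ ≤ Λ * (Λ * |yc - y|) + Λ * (Λ * |yc - y|) := by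
        have := h.abs_m_sub_le k.mem hyL
        have := h.abs_p_sub_le k.mem hyL
        gcongr
    _ = 2 * Λ ^ 2 / (κ * δ) * (κ * |y - yc| * δ) := by rw [abs_sub_comm]; field_simp; ring
    _ ≤ _ := by gcongr

/-- `p'(yc) - p'` vanishes at the critical point, and `m - c` is bounded away from `0`. -/
theorem norm_r2Integrand_le (h : HalfProfile κ Λ L p m dp dm) {δ : ℝ} (k : CritPoint p L c yc)
    (hδ : 0 < δ) (hc : δ ≤ c.re) {y : ℝ} (hy : y ∈ Icc (0 : ℝ) 1) :
    ‖r2Integrand p m dp dm c yc y‖ ≤ Λ / κ + Λ * L / δ := by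
  have hκ := h.κ_pos
  have hΛ := h.Λ_pos
  have hL : 0 < L := zero_lt_one.trans_le h.one_le
  have hyJ : y ∈ Icc 0 (max 1 yc) := unit_subset_span hy
  have hyL := h.unit_subset hy
  refine (norm_sub_le _ _).trans (add_le_add ?_ ?_)
  · refine norm_div_le_of_le_mul (by positivity) ?_
    rw [Complex.norm_real, Real.norm_eq_abs]
    calc |dp yc - dp y| ≤ Λ * |yc - y| := h.dp_lip _ k.mem _ hyL
      _ = Λ / κ * (κ * |y - yc|) := by rw [abs_sub_comm]; field_simp
      _ ≤ _ := by have := h.norm_p_sub_ge k hyJ; gcongr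
  · refine norm_div_le_of_le_mul (by positivity) ?_
    rw [Complex.norm_real, Real.norm_eq_abs]
    calc |dm yc - dm y| ≤ Λ * |yc - y| := h.dm_lip _ k.mem _ hyL
      _ ≤ Λ * L := by
        have : |yc - y| ≤ L := by
          rw [abs_le]; constructor <;> linarith [hyL.1, hyL.2, k.mem.1, k.mem.2]
        gcongr
      _ = Λ * L / δ * δ := by field_simp
      _ ≤ _ := by
        have := (hc.trans (Complex.re_le_norm c)).trans (h.norm_m_sub_ge k hyL)
        gcongr

theorem norm_sigma_le (h : HalfProfile κ Λ L p m dp dm) (k : CritPoint p L c yc) {R : ℝ}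
    (hR : ‖c‖ ≤ R) : ‖halfSigma p m dp dm c yc‖ ≤ 2 * (Λ * (Λ * L + R)) := by
  have hκ := h.κ_pos
  have hΛ := h.Λ_pos
  have b1 : ‖(dp yc : ℂ)‖ ≤ Λ := by
    obtain ⟨u, v⟩ := h.dp_bound yc k.mem
    rw [Complex.norm_real, Real.norm_eq_abs, abs_of_pos (hκ.trans_le u)]; exact v
  have b2 : ‖(dm yc : ℂ)‖ ≤ Λ := by
    obtain ⟨u, v⟩ := h.dm_bound yc k.mem
    rw [Complex.norm_real, Real.norm_eq_abs, abs_of_neg (by linarith)]; exact v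
  have hyc0 := mul_nonneg hκ.le k.mem.1
  have hyL : Λ * yc ≤ Λ * L := by have := k.mem.2; gcongr
  have b3 : ‖(m yc : ℂ) - c‖ ≤ Λ * L + R := by
    refine (norm_sub_le _ _).trans (add_le_add ?_ hR)
    have := h.m_nonpos k.mem
    rw [Complex.norm_real, Real.norm_eq_abs, abs_of_nonpos (by linarith)]
    exact (h.m_ge k.mem).trans hyL
  have b4 : ‖(p yc : ℂ) - c‖ ≤ Λ * L + R := by
    refine (norm_sub_le _ _).trans (add_le_add ?_ hR)
    have := h.p_nonneg k.mem
    rw [Complex.norm_real, Real.norm_eq_abs, abs_of_nonneg (by linarith)]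
    exact (h.p_le k.mem).trans hyL
  rw [halfSigma]
  refine (norm_sub_le _ _).trans ?_
  rw [norm_mul, norm_mul, two_mul]
  gcongr

/-- Away from the origin, and with `c` close to `p yc`, the term `p'(yc) (m(yc) - c)` dominates `σ`. -/
theorem norm_sigma_ge (h : HalfProfile κ Λ L p m dp dm) (k : CritPoint p L c yc) {δ : ℝ}
    (hc : δ ≤ c.re) (hpc : ‖c - p yc‖ ≤ κ * δ / (2 * Λ)) :
    κ * δ / 2 ≤ ‖halfSigma p m dp dm c yc‖ := by
  have hκ := h.κ_pos
  have hΛ := h.Λ_pos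
  have b1 : κ ≤ ‖(dp yc : ℂ)‖ := by
    obtain ⟨u, v⟩ := h.dp_bound yc k.mem
    rw [Complex.norm_real, Real.norm_eq_abs, abs_of_pos (hκ.trans_le u)]; exact u
  have b2 : ‖(dm yc : ℂ)‖ ≤ Λ := by
    obtain ⟨u, v⟩ := h.dm_bound yc k.mem
    rw [Complex.norm_real, Real.norm_eq_abs, abs_of_neg (by linarith)]; exact v
  have b3 := (hc.trans (Complex.re_le_norm c)).trans (h.norm_m_sub_ge k k.mem)
  have h1 : κ * δ ≤ ‖(dp yc : ℂ) * ((m yc : ℂ) - c)‖ := by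
    rw [norm_mul]
    calc κ * δ ≤ κ * ‖(m yc : ℂ) - c‖ := by gcongr
      _ ≤ _ := by gcongr
  have h2 : ‖(dm yc : ℂ) * ((p yc : ℂ) - c)‖ ≤ κ * δ / 2 := by
    rw [norm_mul, norm_sub_rev]
    calc _ ≤ Λ * (κ * δ / (2 * Λ)) := by gcongr
      _ = _ := by field_simp
  have := norm_sub_norm_le ((dp yc : ℂ) * ((m yc : ℂ) - c)) ((dm yc : ℂ) * ((p yc : ℂ) - c))
  rw [halfSigma]
  linarith

/-- Away from the origin, `|X|` is `|ln |c - p(1)||` up to constants: this is the only unbounded term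
of `sigma_mul_halfI`. -/
theorem exists_halfX_log (h : HalfProfile κ Λ L p m dp dm) (α : ℝ) {δ R : ℝ} (hδ : 0 < δ)
    (hR : 0 ≤ R) :
    ∃ ε₀ C, 0 < ε₀ ∧ 1 ≤ C ∧ ∀ c yc f, HalfSol α p m L c yc f → δ ≤ c.re → ‖c‖ ≤ R →
      ‖c - p yc‖ ≤ ε₀ → (c.im ≠ 0 ∨ p 1 < c.re) →
      ‖halfX p m c f‖ ≤ C * (1 + |Real.log ‖c - p 1‖|) ∧
      |Real.log ‖c - p 1‖| ≤ C * (1 + ‖halfX p m c f‖) := by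
  obtain ⟨M, hM1, hM⟩ := h.exists_regularBounds α
  have hκ := h.κ_pos
  have hΛ := h.Λ_pos
  have hL : 0 < L := zero_lt_one.trans_le h.one_le
  obtain ⟨s, hs⟩ : ∃ s, s = 2 * (Λ * (Λ * L + R)) := ⟨_, rfl⟩
  have hs0 : 0 < s := by rw [hs]; positivity
  obtain ⟨B, hB⟩ : ∃ B, B = s * (2 * M ^ 2 * L / (κ * δ)) + 2 * Λ ^ 2 / (κ * δ)
    + (Λ / κ + Λ * L / δ) + (|Real.log δ| + |Real.log (Λ * L + R)| + Real.pi) := ⟨_, rfl⟩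
  have hpi := Real.pi_pos
  have hB0 : 0 < B := by rw [hB]; positivity
  obtain ⟨C, hC⟩ : ∃ C, C = (M ^ 2 * (2 / (κ * δ)) + 1) * (B + Real.pi + 1) + (B + s + 1) :=
    ⟨_, rfl⟩
  refine ⟨κ * δ / (2 * Λ), C, by positivity, ?_, fun c yc f hf hc hcR hpc hoff => ?_⟩
  · have : 0 ≤ (M ^ 2 * (2 / (κ * δ)) + 1) * (B + Real.pi + 1) := by positivity
    linarith
  have hb := hM c yc f hf
  set σ := halfSigma p m dp dm c yc with hσ
  have hσ1 : ‖σ‖ ≤ s := hs ▸ h.norm_sigma_le hf.crit hcR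
  have hσ2 : κ * δ / 2 ≤ ‖σ‖ := h.norm_sigma_ge hf.crit hc hpc
  have hσ0 : 0 < ‖σ‖ := lt_of_lt_of_le (by positivity) hσ2
  have key := h.sigma_mul_halfI hf hb hoff
  have ibound (g : ℝ → ℂ) (K : ℝ) (hg : ∀ y ∈ Icc (0 : ℝ) 1, ‖g y‖ ≤ K) :
      ‖∫ y in (0 : ℝ)..1, g y‖ ≤ K := by
    have := intervalIntegral.norm_integral_le_of_norm_le_const (a := 0) (b := 1) (f := g) (C := K)
      (fun y hy => hg y (by
        rw [uIoc_of_le zero_le_one] at hy; exact Ioc_subset_Icc_self hy))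
    simpa using this
  have i1 := ibound _ _ fun y hy => h.norm_piIntegrand_le hf.crit hb hM1 hδ hc hy
  have i2 := ibound _ _ fun y hy => h.norm_r1Integrand_le hf.crit hδ hc hy
  have i3 := ibound _ _ fun y hy => h.norm_r2Integrand_le hf.crit hδ hc hy
  have hlogm : ‖Complex.log (c - m 1)‖
      ≤ |Real.log δ| + |Real.log (Λ * L + R)| + Real.pi := by
    refine (Complex.norm_log_le _).trans ?_
    have l1 : δ ≤ ‖c - m 1‖ := by
      rw [norm_sub_rev]
      exact (hc.trans (Complex.re_le_norm c)).trans (h.norm_m_sub_ge hf.crit h.one_mem)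
    have l2 : ‖c - m 1‖ ≤ Λ * L + R := by
      refine (norm_sub_le _ _).trans ?_
      have e1 := h.m_nonpos h.one_mem
      rw [Complex.norm_real, Real.norm_eq_abs, abs_of_nonpos (by linarith)]
      have e2 := h.m_ge h.one_mem
      nlinarith [h.one_le]
    have g1 := Real.log_le_log hδ l1
    have g2 := Real.log_le_log (hδ.trans_le l1) l2
    have : |Real.log ‖c - m 1‖| ≤ |Real.log δ| + |Real.log (Λ * L + R)| := by
      rw [abs_le]
      constructor
      · linarith [neg_abs_le (Real.log δ), abs_nonneg (Real.log (Λ * L + R))]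
      · linarith [le_abs_self (Real.log (Λ * L + R)), abs_nonneg (Real.log δ)]
    linarith
  have hdiff : ‖σ * halfI p m c f - Complex.log (c - p 1)‖ ≤ B := by
    have e : σ * halfI p m c f - Complex.log (c - p 1)
        = σ * (∫ y in (0 : ℝ)..1, piIntegrand p m c f y)
        + (∫ y in (0 : ℝ)..1, r1Integrand p m dp dm c yc y)
        + (∫ y in (0 : ℝ)..1, r2Integrand p m dp dm c yc y) - Complex.log (c - m 1) := by
      rw [key]; ring
    rw [e, hB]
    refine (norm_sub_le _ _).trans (add_le_add ((norm_add_le _ _).trans (add_le_add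
      ((norm_add_le _ _).trans (add_le_add ?_ i2)) i3)) hlogm)
    rw [norm_mul]
    gcongr
  have hf1 := hb.one_le 0 zero_mem_span
  have hf2 := hb.norm_le 0 zero_mem_span
  have hX : ‖halfX p m c f‖ = ‖f 0‖ ^ 2 * ‖halfI p m c f‖ := by rw [halfX, norm_mul, norm_pow]
  set l := |Real.log ‖c - p 1‖| with hl
  have hl0 : 0 ≤ l := abs_nonneg _
  have hll : l ≤ ‖Complex.log (c - p 1)‖ := by
    rw [hl, ← Complex.log_re]; exact Complex.abs_re_le_norm _
  have hlu : ‖Complex.log (c - p 1)‖ ≤ l + Real.pi := Complex.norm_log_le _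
  constructor
  · have h1 : ‖σ‖ * ‖halfI p m c f‖ ≤ B + (l + Real.pi) := by
      rw [← norm_mul]
      have := norm_le_norm_add_norm_sub' (σ * halfI p m c f) (Complex.log (c - p 1))
      linarith
    have h3 : B + (l + Real.pi) ≤ (B + Real.pi + 1) * (1 + l) := by nlinarith
    have h2 : ‖halfI p m c f‖ ≤ 2 / (κ * δ) * ((B + Real.pi + 1) * (1 + l)) := by
      calc ‖halfI p m c f‖ = 2 / (κ * δ) * (κ * δ / 2 * ‖halfI p m c f‖) := by field_simp
        _ ≤ 2 / (κ * δ) * (‖σ‖ * ‖halfI p m c f‖) := mul_le_mul_of_nonneg_left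
            (mul_le_mul_of_nonneg_right hσ2 (norm_nonneg _)) (by positivity)
        _ ≤ _ := mul_le_mul_of_nonneg_left (h1.trans h3) (by positivity)
    have h4 : M ^ 2 * (2 / (κ * δ)) * (B + Real.pi + 1) ≤ C := by
      have : 0 ≤ B + Real.pi + 1 + (B + s + 1) := by positivity
      have e : C = M ^ 2 * (2 / (κ * δ)) * (B + Real.pi + 1)
          + (B + Real.pi + 1 + (B + s + 1)) := by rw [hC]; ring
      linarith
    rw [hX]
    calc ‖f 0‖ ^ 2 * ‖halfI p m c f‖
        ≤ M ^ 2 * (2 / (κ * δ) * ((B + Real.pi + 1) * (1 + l))) :=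
          mul_le_mul (pow_le_pow_left₀ (norm_nonneg _) hf2 2) h2 (norm_nonneg _) (by positivity)
      _ = M ^ 2 * (2 / (κ * δ)) * (B + Real.pi + 1) * (1 + l) := by ring
      _ ≤ _ := mul_le_mul_of_nonneg_right h4 (by linarith)
  · have h1 : l ≤ B + ‖σ‖ * ‖halfI p m c f‖ := by
      rw [← norm_mul]
      have := norm_le_norm_add_norm_sub (σ * halfI p m c f) (Complex.log (c - p 1))
      linarith
    have h2 : ‖halfI p m c f‖ ≤ ‖halfX p m c f‖ := by
      rw [hX]
      exact le_mul_of_one_le_left (norm_nonneg _) (one_le_pow₀ hf1)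
    have h3 : ‖σ‖ * ‖halfI p m c f‖ ≤ s * ‖halfX p m c f‖ := by gcongr
    have h4 : B + s * ‖halfX p m c f‖ ≤ (B + s + 1) * (1 + ‖halfX p m c f‖) := by
      nlinarith [norm_nonneg (halfX p m c f)]
    refine (h1.trans (by linarith)).trans (h4.trans ?_)
    refine mul_le_mul_of_nonneg_right ?_ (by positivity)
    rw [hC]
    have : 0 ≤ (M ^ 2 * (2 / (κ * δ)) + 1) * (B + Real.pi + 1) := by positivity
    linarith

/-- Beyond `p(1)` the coefficient `H` is nearly positive on `[0, 1]`, and so is `X`. -/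
theorem exists_halfX_re_ge (h : HalfProfile κ Λ L p m dp dm) (α : ℝ) {δ η R : ℝ} (hδ : 0 < δ)
    (hη : 0 < η) (hR : 0 ≤ R) :
    ∃ ε₀ x₀ C, 0 < ε₀ ∧ 0 < x₀ ∧ 0 ≤ C ∧ ∀ c yc f, HalfSol α p m L c yc f → δ ≤ c.re →
      p 1 + η ≤ c.re → ‖c‖ ≤ R → |c.im| ≤ ε₀ →
      x₀ ≤ (halfX p m c f).re ∧ |(halfX p m c f).im| ≤ C * |c.im| := by
  obtain ⟨M, hM1, hM⟩ := h.exists_regularBounds α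
  obtain ⟨N, hN0, hN⟩ := h.exists_abs_im_le α hδ
  have hΛ := h.Λ_pos
  have hκ := h.κ_pos
  set S := Λ + R with hS
  have hS0 : 0 < S := by positivity
  -- `E |Im c|` bounds the deviation of `f(0)² conj (H f²)` from a positive number.
  set E := M * (M * (M * (M * (2 * S + 1) + N * S ^ 2) + N * (M * S ^ 2))
    + N * (M * (M * S ^ 2))) + N * (M * (M * (M * S ^ 2))) with hE
  have hE0 : 0 ≤ E := by positivity
  refine ⟨min 1 (min (1 / (2 * (N + 1))) (η * δ / (32 * (E + 1)))),
    η * δ / 32 / (S ^ 2 * M ^ 2) ^ 2, E / (η * δ) ^ 2, by positivity, by positivity,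
    by positivity, fun c yc f hf hc hpc hcR hce => ?_⟩
  have hb := hM c yc f hf
  have him := hN c yc f hf hc
  have he1 : |c.im| ≤ 1 := hce.trans (min_le_left _ _)
  have he2 : N * |c.im| ≤ 1 / 2 := by
    have := hce.trans ((min_le_right _ _).trans (min_le_left _ _))
    rw [le_div_iff₀ (by positivity)] at this
    nlinarith [abs_nonneg c.im]
  have he3 : E * |c.im| ≤ η * δ / 32 := by
    have := hce.trans ((min_le_right _ _).trans (min_le_right _ _))
    rw [le_div_iff₀ (by positivity)] at this
    nlinarith [abs_nonneg c.im]
  set e := |c.im| with he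
  have he0 : 0 ≤ e := abs_nonneg _
  have hH : ∀ y ∈ Icc (0 : ℝ) 1, ‖profileH p m c y‖ ≤ S ^ 2 ∧ η * δ ≤ ‖profileH p m c y‖ ∧
      η * δ ≤ (c.re - p y) * (c.re - m y) ∧
      ‖(starRingEnd ℂ) (profileH p m c y) - (((c.re - p y) * (c.re - m y) : ℝ) : ℂ)‖
        ≤ (2 * S + 1) * e := by
    intro y hy
    have hyL := h.unit_subset hy
    have a1 := h.p_nonneg hyL
    have a2 := h.p_le hyL
    have a3 := h.m_nonpos hyL
    have a4 := h.m_ge hyL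
    have a5 := mul_nonneg hκ.le hy.1
    have a6 : Λ * y ≤ Λ := mul_le_of_le_one_right hΛ.le hy.2
    have a7 := h.p_mono hyL h.one_mem hy.2
    have a8 : ‖(p y : ℂ) - c‖ ≤ S := by
      refine (norm_sub_le _ _).trans (add_le_add ?_ hcR)
      rw [Complex.norm_real, Real.norm_eq_abs, abs_of_nonneg (by linarith)]; linarith
    have a9 : ‖(m y : ℂ) - c‖ ≤ S := by
      refine (norm_sub_le _ _).trans (add_le_add ?_ hcR)
      rw [Complex.norm_real, Real.norm_eq_abs, abs_of_nonpos (by linarith)]; linarith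
    have b1 : η ≤ c.re - p y := by linarith
    have b2 : δ ≤ c.re - m y := by linarith
    refine ⟨?_, ?_, mul_le_mul b1 b2 hδ.le (hη.le.trans b1), ?_⟩
    · rw [profileH, norm_mul, sq]; gcongr
    · rw [profileH, norm_mul]
      have c1 : η ≤ ‖(p y : ℂ) - c‖ := by
        have := Complex.abs_re_le_norm ((p y : ℂ) - c)
        simp only [Complex.sub_re, Complex.ofReal_re] at this
        linarith [neg_abs_le (p y - c.re)]
      have c2 : δ ≤ ‖(m y : ℂ) - c‖ := by
        have := Complex.abs_re_le_norm ((m y : ℂ) - c)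
        simp only [Complex.sub_re, Complex.ofReal_re] at this
        linarith [neg_abs_le (m y - c.re)]
      gcongr
    · refine (Complex.norm_le_abs_re_add_abs_im _).trans ?_
      simp only [Complex.sub_re, Complex.sub_im, Complex.conj_re, Complex.conj_im,
        Complex.ofReal_re, Complex.ofReal_im, profileH_re, profileH_im, sub_zero, abs_neg]
      rw [sub_sub_cancel_left, abs_neg, abs_mul, ← he, ← sq_abs, ← he, abs_of_nonneg (sq_nonneg e),
        abs_of_nonneg (by linarith)]
      have d1 : c.re - p y ≤ S := by
        have := (le_abs_self _).trans (Complex.abs_re_le_norm (c - (p y : ℂ)))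
        simp only [Complex.sub_re, Complex.ofReal_re] at this
        rw [norm_sub_rev] at this; linarith
      have d2 : c.re - m y ≤ S := by
        have := (le_abs_self _).trans (Complex.abs_re_le_norm (c - (m y : ℂ)))
        simp only [Complex.sub_re, Complex.ofReal_re] at this
        rw [norm_sub_rev] at this; linarith
      nlinarith
  have hfr : ∀ y ∈ Icc (0 : ℝ) 1, ‖f y - ((f y).re : ℂ)‖ ≤ N * e ∧ |(f y).re| ≤ M ∧
      1 / 2 ≤ (f y).re ^ 2 := by
    intro y hy
    have hyJ : y ∈ Icc 0 (max 1 yc) := unit_subset_span hy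
    have i := him y hyJ
    refine ⟨?_, (Complex.abs_re_le_norm _).trans (hb.norm_le y hyJ), ?_⟩
    · have : f y - ((f y).re : ℂ) = ((f y).im : ℂ) * Complex.I := by
        apply Complex.ext <;> simp
      rw [this, norm_mul, Complex.norm_I, Complex.norm_real, Real.norm_eq_abs, mul_one]
      exact i
    · have h1 := hb.one_le y hyJ
      have h2 : 1 ≤ ‖f y‖ ^ 2 := one_le_pow₀ h1
      rw [Complex.sq_norm, Complex.normSq_apply] at h2
      have h3 : (f y).im ^ 2 ≤ (1 / 2) ^ 2 := by
        rw [← sq_abs]; exact pow_le_pow_left₀ (abs_nonneg _) (i.trans he2) 2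
      nlinarith
  -- a product of perturbed factors, to first order in `e`
  have prod {x x' y y' : ℂ} {A B a b : ℝ} (hx : ‖x‖ ≤ A) (hxx : ‖x - x'‖ ≤ a * e)
      (hy' : ‖y'‖ ≤ B) (hyy : ‖y - y'‖ ≤ b * e) : ‖x * y - x' * y'‖ ≤ (A * b + a * B) * e := by
    have hA : 0 ≤ A := (norm_nonneg _).trans hx
    have hb0 : 0 ≤ b * e := (norm_nonneg _).trans hyy
    have ha0 : 0 ≤ a * e := (norm_nonneg _).trans hxx
    have : x * y - x' * y' = x * (y - y') + (x - x') * y' := by ring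
    rw [this]
    refine (norm_add_le _ _).trans ?_
    rw [norm_mul, norm_mul]
    calc _ ≤ A * (b * e) + (a * e) * B := by gcongr
      _ = _ := by ring
  have h0m : (0 : ℝ) ∈ Icc (0 : ℝ) 1 := ⟨le_rfl, zero_le_one⟩
  -- `θ = f(0)² conj (H f²)` is compared with the real number obtained from `Re f` and
  -- `(Re c - p) (Re c - m)`.
  set θ : ℝ → ℂ := fun y => f 0 * (f 0 * ((starRingEnd ℂ) (f y) * ((starRingEnd ℂ) (f y) *
    (starRingEnd ℂ) (profileH p m c y)))) with hθ
  have hθb : ∀ y ∈ Icc (0 : ℝ) 1, η * δ / 32 ≤ (θ y).re ∧ |(θ y).im| ≤ E * e := by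
    intro y hy
    obtain ⟨g1, g2, g3, g4⟩ := hH y hy
    obtain ⟨u1, u2, u3⟩ := hfr y hy
    obtain ⟨v1, v2, v3⟩ := hfr 0 h0m
    have w1 := hb.norm_le y (unit_subset_span hy)
    have w2 := hb.norm_le 0 zero_mem_span
    set T := (c.re - p y) * (c.re - m y) with hT
    set r := (f y).re with hr
    set r0 := (f 0).re with hr0
    have hTn : ‖(T : ℂ)‖ ≤ S ^ 2 := by
      have : ‖(T : ℂ)‖ = |c.re - p y| * |c.re - m y| := by
        rw [Complex.norm_real, Real.norm_eq_abs, hT, abs_mul]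
      have k1 : |c.re - p y| ≤ S := by
        have hyL := h.unit_subset hy
        have a1 := h.p_nonneg hyL
        have a2 := h.p_le hyL
        have a5 := mul_nonneg hκ.le hy.1
        have a6 : Λ * y ≤ Λ := mul_le_of_le_one_right hΛ.le hy.2
        have a7 := Complex.re_le_norm c
        have := h.p_mono hyL h.one_mem hy.2
        rw [abs_of_nonneg (by linarith)]; linarith
      have k2 : |c.re - m y| ≤ S := by
        have hyL := h.unit_subset hy
        have a1 := h.m_nonpos hyL
        have a2 := h.m_ge hyL
        have a5 := mul_nonneg hκ.le hy.1
        have a6 : Λ * y ≤ Λ := mul_le_of_le_one_right hΛ.le hy.2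
        have a7 := Complex.re_le_norm c
        rw [abs_of_nonneg (by linarith)]; linarith
      rw [this, sq]; gcongr
    have hrn : ‖(r : ℂ)‖ ≤ M := by rwa [Complex.norm_real, Real.norm_eq_abs]
    have hr0n : ‖(r0 : ℂ)‖ ≤ M := by rwa [Complex.norm_real, Real.norm_eq_abs]
    have u1' : ‖(starRingEnd ℂ) (f y) - (r : ℂ)‖ ≤ N * e := by
      rw [← Complex.conj_ofReal, ← map_sub, Complex.norm_conj]; exact u1
    have w1' : ‖(starRingEnd ℂ) (f y)‖ ≤ M := by rwa [Complex.norm_conj]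
    have hn (x y : ℂ) (A B : ℝ) (hx : ‖x‖ ≤ A) (hy : ‖y‖ ≤ B) : ‖x * y‖ ≤ A * B := by
      rw [norm_mul]
      exact mul_le_mul hx hy (norm_nonneg _) ((norm_nonneg _).trans hx)
    have n1 := hn _ _ _ _ hrn hTn
    have n2 := hn _ _ _ _ hrn n1
    have n3 := hn _ _ _ _ hr0n n2
    have q1 := prod w1' u1' hTn g4
    have q2 := prod w1' u1' n1 q1
    have q3 := prod w2 v1 n2 q2
    have q4 := prod w2 v1 n3 q3
    have q5 : ‖θ y - ((r0 * (r0 * (r * (r * T))) : ℝ) : ℂ)‖ ≤ E * e := by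
      simp only [hθ]; push_cast; exact q4
    have r1 := (Complex.abs_re_le_norm _).trans q5
    have r2 := (Complex.abs_im_le_norm _).trans q5
    simp only [Complex.sub_re, Complex.sub_im, Complex.ofReal_re, Complex.ofReal_im, sub_zero]
      at r1 r2
    refine ⟨?_, r2⟩
    have t1 : η * δ / 4 ≤ r0 * (r0 * (r * (r * T))) := by
      have e1 : r0 * (r0 * (r * (r * T))) = r0 ^ 2 * r ^ 2 * T := by ring
      rw [e1]
      calc η * δ / 4 = 1 / 2 * (1 / 2) * (η * δ) := by ring
        _ ≤ _ := by gcongr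
    have hηδ : 0 < η * δ := by positivity
    linarith [(abs_le.1 r1).1]
  set G : ℝ → ℝ := fun y => ‖profileH p m c y * f y ^ 2‖ ^ 2 with hG
  have hpt : ∀ y ∈ Icc (0 : ℝ) 1, f 0 ^ 2 * (1 / (profileH p m c y * f y ^ 2))
      = (((G y)⁻¹ : ℝ) : ℂ) * θ y := by
    intro y hy
    have n1 : profileH p m c y ≠ 0 := norm_pos_iff.1
      (lt_of_lt_of_le (by positivity) (hH y hy).2.1)
    have n2 : f y ≠ 0 := hb.ne_zero (unit_subset_span hy)
    have n3 : (starRingEnd ℂ) (profileH p m c y) ≠ 0 := by simpa using n1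
    have n4 : (starRingEnd ℂ) (f y) ≠ 0 := by simpa using n2
    simp only [hG, hθ]
    push_cast
    rw [← Complex.mul_conj', map_mul, map_pow]
    field_simp
  have hGb : ∀ y ∈ Icc (0 : ℝ) 1, (η * δ) ^ 2 ≤ G y ∧ G y ≤ (S ^ 2 * M ^ 2) ^ 2 := by
    intro y hy
    obtain ⟨g1, g2, -, -⟩ := hH y hy
    have w0 := hb.one_le y (unit_subset_span hy)
    have w1 := hb.norm_le y (unit_subset_span hy)
    simp only [hG]
    rw [norm_mul, norm_pow]
    constructor
    · have : 1 ≤ ‖f y‖ ^ 2 := one_le_pow₀ w0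
      have : η * δ ≤ ‖profileH p m c y‖ * ‖f y‖ ^ 2 := by
        calc η * δ = η * δ * 1 := (mul_one _).symm
          _ ≤ _ := by gcongr
      gcongr
    · gcongr
  have hXi : halfX p m c f
      = ∫ y in (0 : ℝ)..1, f 0 ^ 2 * (1 / (profileH p m c y * f y ^ 2)) := by
    rw [halfX, halfI, intervalIntegral.integral_const_mul]
  have hu : uIcc (0 : ℝ) 1 = Icc 0 1 := uIcc_of_le zero_le_one
  have hcont : ContinuousOn (fun y => f 0 ^ 2 * (1 / (profileH p m c y * f y ^ 2)))
      (uIcc (0 : ℝ) 1) := by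
    rw [hu]
    refine continuousOn_const.mul (continuousOn_const.div
      (((h.continuousOn_profileH c).mono h.unit_subset).mul
        ((hf.sol.continuousOn.mono unit_subset_span).pow 2)) fun y hy => ?_)
    exact mul_ne_zero (norm_pos_iff.1 (lt_of_lt_of_le (by positivity) (hH y hy).2.1))
      (pow_ne_zero 2 (hb.ne_zero (unit_subset_span hy)))
  have hint := hcont.intervalIntegrable (μ := MeasureTheory.volume)
  have hre := Complex.reCLM.intervalIntegral_comp_comm hint
  have hima := Complex.imCLM.intervalIntegral_comp_comm hint
  simp only [Complex.reCLM_apply, Complex.imCLM_apply] at hre hima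
  rw [hXi, ← hre, ← hima]
  constructor
  · have := intervalIntegral.integral_mono_on (μ := MeasureTheory.volume)
      (f := fun _ => η * δ / 32 / (S ^ 2 * M ^ 2) ^ 2) zero_le_one (by simp)
      (Complex.continuous_re.comp_continuousOn hcont).intervalIntegrable (fun y hy => by
        obtain ⟨l1, -⟩ := hθb y hy
        obtain ⟨l3, l4⟩ := hGb y hy
        simp only [Function.comp]
        rw [hpt y hy, Complex.re_ofReal_mul, div_eq_inv_mul]
        have : 0 < G y := lt_of_lt_of_le (by positivity) l3
        gcongr)
    simpa using this
  · have := intervalIntegral.norm_integral_le_of_norm_le_const (a := 0) (b := 1)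
      (f := fun y => (f 0 ^ 2 * (1 / (profileH p m c y * f y ^ 2))).im)
      (C := E / (η * δ) ^ 2 * e) (fun y hy => by
        rw [uIoc_of_le zero_le_one] at hy
        have hy := Ioc_subset_Icc_self hy
        obtain ⟨-, l2⟩ := hθb y hy
        obtain ⟨l3, l4⟩ := hGb y hy
        have hGp : 0 < G y := lt_of_lt_of_le (by positivity) l3
        rw [hpt y hy, Complex.im_ofReal_mul, Real.norm_eq_abs, abs_mul, abs_of_pos (by positivity),
          div_mul_eq_mul_div, inv_mul_eq_div]
        gcongr)
    simpa using this

end HalfProfile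

/-! ### The logarithmic weight -/

theorem one_le_logWeight (x : ℂ) : 1 ≤ logWeight x := by
  have h : Real.exp 1 ≤ Real.exp 1 + ‖x‖⁻¹ := by
    have : 0 ≤ ‖x‖⁻¹ := by positivity
    linarith
  have := Real.log_le_log (Real.exp_pos 1) h
  rwa [Real.log_exp] at this

theorem logWeight_le_of_le {x : ℂ} {η : ℝ} (hη : 0 < η) (hx : η ≤ ‖x‖) :
    logWeight x ≤ Real.log (Real.exp 1 + η⁻¹) := by
  have h1 : ‖x‖⁻¹ ≤ η⁻¹ := inv_anti₀ hη hx
  exact Real.log_le_log (by positivity) (by linarith)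

theorem logWeight_le_two_mul_abs_log {x : ℂ} (hx : x ≠ 0) (h : 1 ≤ |Real.log ‖x‖|)
    (h1 : ‖x‖ ≤ 1) : logWeight x ≤ 2 * |Real.log ‖x‖| := by
  have hx0 : 0 < ‖x‖ := norm_pos_iff.2 hx
  have hl : |Real.log ‖x‖| = Real.log ‖x‖⁻¹ := by
    rw [Real.log_inv, abs_of_nonpos (Real.log_nonpos hx0.le h1)]
  have he : Real.exp 1 ≤ ‖x‖⁻¹ := by
    rw [← Real.le_log_iff_exp_le (by positivity), ← hl]; exact h
  have h2 : Real.log (2 * ‖x‖⁻¹) ≤ 2 * |Real.log ‖x‖| := by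
    rw [Real.log_mul two_ne_zero (by positivity), ← hl]
    linarith [Real.log_two_lt_d9]
  refine le_trans (Real.log_le_log (by positivity) ?_) h2
  linarith

namespace HalfProfile

variable {κ Λ L : ℝ} {p m dp dm : ℝ → ℝ} {c : ℂ} {yc : ℝ} {f : ℝ → ℂ}

/-- Away from the origin, `|X|` is large of the order of the weight near `p(1)`, and bounded away
from `p(1)`. -/
theorem exists_halfX_weight (h : HalfProfile κ Λ L p m dp dm) (α : ℝ) {δ R : ℝ} (hδ : 0 < δ)
    (hR : 0 ≤ R) :
    ∃ ε₀ k, 0 < ε₀ ∧ 0 < k ∧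
      (∀ T, ∃ η, 0 < η ∧ ∀ c yc f, HalfSol α p m L c yc f → δ ≤ c.re → ‖c‖ ≤ R →
        ‖c - p yc‖ ≤ ε₀ → (c.im ≠ 0 ∨ p 1 < c.re) → ‖c - p 1‖ < η →
        k * logWeight (c - p 1) ≤ ‖halfX p m c f‖ ∧ T ≤ ‖halfX p m c f‖) ∧
      (∀ η, 0 < η → ∃ C, 0 < C ∧ ∀ c yc f, HalfSol α p m L c yc f → δ ≤ c.re → ‖c‖ ≤ R →
        ‖c - p yc‖ ≤ ε₀ → (c.im ≠ 0 ∨ p 1 < c.re) → η ≤ ‖c - p 1‖ → ‖halfX p m c f‖ ≤ C) := by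
  obtain ⟨ε₀, C, hε₀, hC, hlog⟩ := h.exists_halfX_log α hδ hR
  have hC0 : 0 < C := by linarith
  refine ⟨ε₀, 1 / (4 * C), hε₀, by positivity, fun T => ?_, fun η hη => ?_⟩
  · refine ⟨Real.exp (-(2 * C * max T 1)), Real.exp_pos _,
      fun c yc f hf hc hcR hpc hoff hη => ?_⟩
    obtain ⟨-, hl⟩ := hlog c yc f hf hc hcR hpc hoff
    have hne : c - p 1 ≠ 0 := by
      rw [← neg_sub, neg_ne_zero]
      exact (h.sub_ne_zero_of_off hoff ⟨zero_le_one, le_rfl⟩).1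
    have hpos : 0 < ‖c - p 1‖ := norm_pos_iff.2 hne
    have hT1 : 1 ≤ max T 1 := le_max_right _ _
    have hT2 : T ≤ max T 1 := le_max_left _ _
    have h1 : Real.log ‖c - p 1‖ ≤ -(2 * C * max T 1) := by
      rw [Real.log_le_iff_le_exp hpos]; exact hη.le
    have h2 : 2 * C * max T 1 ≤ |Real.log ‖c - p 1‖| := by
      linarith [neg_abs_le (Real.log ‖c - p 1‖)]
    have h2' : 2 * C ≤ |Real.log ‖c - p 1‖| := by nlinarith
    have h3 : ‖c - p 1‖ ≤ 1 := hη.le.trans (by rw [Real.exp_le_one_iff]; nlinarith)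
    have h4 := logWeight_le_two_mul_abs_log hne (by linarith) h3
    have h5 : |Real.log ‖c - p 1‖| ≤ 2 * C * ‖halfX p m c f‖ := by nlinarith
    constructor
    · rw [one_div, inv_mul_le_iff₀ (by positivity)]; linarith
    · have h6 : 2 * C * max T 1 ≤ 2 * C * ‖halfX p m c f‖ := h2.trans h5
      exact hT2.trans (le_of_mul_le_mul_left h6 (by positivity))
  · have hΛ := h.Λ_pos
    refine ⟨C * (1 + (|Real.log η| + |Real.log (R + p 1)|)), by positivity,
      fun c yc f hf hc hcR hpc hoff hη' => ?_⟩
    obtain ⟨hl, -⟩ := hlog c yc f hf hc hcR hpc hoff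
    refine hl.trans ?_
    have hp := h.p_one_pos
    have h2 : ‖c - p 1‖ ≤ R + p 1 := by
      refine (norm_sub_le _ _).trans (add_le_add hcR ?_)
      rw [Complex.norm_real, Real.norm_eq_abs, abs_of_pos hp]
    have g1 := Real.log_le_log hη hη'
    have g2 := Real.log_le_log (hη.trans_le hη') h2
    have : |Real.log ‖c - p 1‖| ≤ |Real.log η| + |Real.log (R + p 1)| := by
      rw [abs_le]
      constructor
      · linarith [neg_abs_le (Real.log η), abs_nonneg (Real.log (R + p 1))]
      · linarith [le_abs_self (Real.log (R + p 1)), abs_nonneg (Real.log η)]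
    gcongr

/-- Up to `p 1` the critical point lies in `[0, 1]` and is exact. -/
theorem crit_of_re_le (h : HalfProfile κ Λ L p m dp dm) (k : CritPoint p L c yc)
    (hc : c.re ≤ p 1) : yc ≤ 1 ∧ c.re = p yc := by
  have hle : yc ≤ 1 := by
    by_contra hlt
    push Not at hlt
    have := h.p_lower h.one_mem k.mem hlt.le
    have : 0 < κ * (yc - 1) := mul_pos h.κ_pos (by linarith)
    linarith [k.le]
  refine ⟨hle, ?_⟩
  rcases hle.lt_or_eq with h1 | h1
  · exact k.eq h1
  · exact le_antisymm (by rw [h1]; exact hc) k.le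

end HalfProfile

/-! ### The lower bound for the Wronskian -/

/-- `-𝓓` in terms of the reduced quantities of the two half channels. -/
noncomputable def reducedWronskian (X₁ X₂ A₁ A₂ : ℂ) : ℂ := X₁ * X₂ * (A₁ + A₂) + X₁ + X₂

theorem reducedWronskian_comm (X₁ X₂ A₁ A₂ : ℂ) :
    reducedWronskian X₁ X₂ A₁ A₂ = reducedWronskian X₂ X₁ A₂ A₁ := by
  simp only [reducedWronskian]; ring

/-- `|D| |X₁ X₂|` dominates the total flux, since `D conj (X₁ X₂) = |X₂|² B₁ + |X₁|² B₂` with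
`Bᵢ = |Xᵢ|² Aᵢ + conj Xᵢ`. -/
theorem flux_le_reducedWronskian {c X₁ X₂ A₁ A₂ : ℂ} {s n₁ n₂ : ℝ} (hs : |s| ≤ 1)
    (h₁ : n₁ ≤ s * ((starRingEnd ℂ) c * ((‖X₁‖ ^ 2 : ℝ) * A₁ + (starRingEnd ℂ) X₁)).im)
    (h₂ : n₂ ≤ s * ((starRingEnd ℂ) c * ((‖X₂‖ ^ 2 : ℝ) * A₂ + (starRingEnd ℂ) X₂)).im) :
    ‖X₂‖ ^ 2 * n₁ + ‖X₁‖ ^ 2 * n₂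
      ≤ ‖c‖ * ‖reducedWronskian X₁ X₂ A₁ A₂‖ * (‖X₁‖ * ‖X₂‖) := by
  set D := reducedWronskian X₁ X₂ A₁ A₂ with hD
  set B₁ := ((‖X₁‖ ^ 2 : ℝ) : ℂ) * A₁ + (starRingEnd ℂ) X₁ with hB₁
  set B₂ := ((‖X₂‖ ^ 2 : ℝ) : ℂ) * A₂ + (starRingEnd ℂ) X₂ with hB₂
  have e : (starRingEnd ℂ) c * (D * (starRingEnd ℂ) (X₁ * X₂))
      = ((‖X₂‖ ^ 2 : ℝ) : ℂ) * ((starRingEnd ℂ) c * B₁)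
        + ((‖X₁‖ ^ 2 : ℝ) : ℂ) * ((starRingEnd ℂ) c * B₂) := by
    rw [hD, reducedWronskian, hB₁, hB₂]
    push_cast
    rw [← Complex.mul_conj', ← Complex.mul_conj', map_mul]
    ring
  have e2 := congrArg Complex.im e
  rw [Complex.add_im, Complex.im_ofReal_mul, Complex.im_ofReal_mul] at e2
  have h3 : s * ((starRingEnd ℂ) c * (D * (starRingEnd ℂ) (X₁ * X₂))).im
      ≤ ‖c‖ * ‖D‖ * (‖X₁‖ * ‖X₂‖) := by
    refine (le_abs_self _).trans ?_
    rw [abs_mul]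
    have := Complex.abs_im_le_norm ((starRingEnd ℂ) c * (D * (starRingEnd ℂ) (X₁ * X₂)))
    rw [norm_mul, norm_mul, Complex.norm_conj, Complex.norm_conj, norm_mul] at this
    calc _ ≤ 1 * (‖c‖ * (‖D‖ * (‖X₁‖ * ‖X₂‖))) := by gcongr
      _ = _ := by ring
  refine le_trans ?_ h3
  rw [e2, mul_add, mul_left_comm, mul_left_comm s]
  gcongr

theorem abs_div_abs_self_le_one (x : ℝ) : |x / (|x|)| ≤ 1 := by
  rw [abs_div, abs_abs]; exact div_self_le_one _

namespace HalfProfile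

variable {κ₁ Λ₁ L₁ κ₂ Λ₂ L₂ : ℝ} {p₁ m₁ dp₁ dm₁ p₂ m₂ dp₂ dm₂ : ℝ → ℝ}

theorem norm_le_of_re_le {c : ℂ} {a ε : ℝ} (h0 : 0 ≤ c.re) (h1 : c.re ≤ a + ε) (h2 : |c.im| ≤ ε)
    (hε : ε ≤ 1) : ‖c‖ ≤ a + 2 := by
  refine (Complex.norm_le_abs_re_add_abs_im c).trans ?_
  rw [abs_of_nonneg h0]; linarith

theorem norm_sub_real_le {c : ℂ} {a ε : ℝ} (h0 : a ≤ c.re) (h1 : c.re ≤ a + ε)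
    (h2 : |c.im| ≤ ε) : ‖c - a‖ ≤ 2 * ε := by
  refine (Complex.norm_le_abs_re_add_abs_im _).trans ?_
  simp only [Complex.sub_re, Complex.sub_im, Complex.ofReal_re, Complex.ofReal_im, sub_zero]
  rw [abs_of_nonneg (by linarith)]; linarith

theorem abs_im_le_of_norm_sub_le {c : ℂ} {a ε : ℝ} (h : ‖c - a‖ ≤ ε) : |c.im| ≤ ε := by
  have := Complex.abs_im_le_norm (c - a)
  simp only [Complex.sub_im, Complex.ofReal_im, sub_zero] at this
  exact this.trans h

theorem abs_re_sub_le_norm (c : ℂ) (a : ℝ) : |c.re - a| ≤ ‖c - a‖ := by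
  simpa using Complex.abs_re_le_norm (c - a)

/-- With both critical points in `[0, 1]`, the fluxes `n₁, n₂ ≥ n₀` and the inequality of the
arithmetic and geometric means bound `|c| |D|` below, whatever the sizes of `X₁` and `X₂`. -/
theorem two_mul_le_of_flux {c X₁ X₂ A₁ A₂ : ℂ} {s n₀ : ℝ} (hs : |s| ≤ 1) (hn : 0 < n₀)
    (h₁ : n₀ ≤ s * ((starRingEnd ℂ) c * ((‖X₁‖ ^ 2 : ℝ) * A₁ + (starRingEnd ℂ) X₁)).im)
    (h₂ : n₀ ≤ s * ((starRingEnd ℂ) c * ((‖X₂‖ ^ 2 : ℝ) * A₂ + (starRingEnd ℂ) X₂)).im) :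
    2 * n₀ ≤ ‖c‖ * ‖reducedWronskian X₁ X₂ A₁ A₂‖ := by
  have hX₁ : X₁ ≠ 0 := fun h => by simp [h] at h₁; linarith
  have hX₂ : X₂ ≠ 0 := fun h => by simp [h] at h₂; linarith
  have hx₁ := norm_pos_iff.2 hX₁
  have hx₂ := norm_pos_iff.2 hX₂
  have := flux_le_reducedWronskian hs h₁ h₂
  have h3 : 2 * n₀ * (‖X₁‖ * ‖X₂‖) ≤ ‖X₂‖ ^ 2 * n₀ + ‖X₁‖ ^ 2 * n₀ := by
    nlinarith [sq_nonneg (‖X₁‖ - ‖X₂‖)]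
  exact le_of_mul_le_mul_right (h3.trans this) (by positivity)

/-- With one flux bounded below, `|c| |D|` dominates `|X₁| / |X₂|`. -/
theorem mul_norm_le_of_flux {c X₁ X₂ A₁ A₂ : ℂ} {s n₀ : ℝ} (hs : |s| ≤ 1)
    (h₁ : 0 ≤ s * ((starRingEnd ℂ) c * ((‖X₁‖ ^ 2 : ℝ) * A₁ + (starRingEnd ℂ) X₁)).im)
    (h₂ : n₀ ≤ s * ((starRingEnd ℂ) c * ((‖X₂‖ ^ 2 : ℝ) * A₂ + (starRingEnd ℂ) X₂)).im) :
    n₀ * ‖X₁‖ ≤ ‖c‖ * ‖reducedWronskian X₁ X₂ A₁ A₂‖ * ‖X₂‖ := by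
  by_cases hX : X₁ = 0
  · rw [hX]; simp only [norm_zero, mul_zero]; positivity
  have hx := norm_pos_iff.2 hX
  have := flux_le_reducedWronskian hs h₁ h₂
  have h3 : n₀ * ‖X₁‖ * ‖X₁‖ ≤ ‖c‖ * ‖reducedWronskian X₁ X₂ A₁ A₂‖ * ‖X₂‖ * ‖X₁‖ := by
    nlinarith
  exact le_of_mul_le_mul_right h3 hx

/-- The case where the end points `p₁ 1` and `p₂ 1` coincide. Near them `X₁` and `X₂` are both large and
the term `X₁ X₂ (A₁ + A₂)` dominates, its last factor having positive real part; elsewhere both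
critical points lie in `[0, 1]` and `two_mul_le_of_flux` applies. -/
theorem exists_lower_bound_of_eq (h₁ : HalfProfile κ₁ Λ₁ L₁ p₁ m₁ dp₁ dm₁)
    (h₂ : HalfProfile κ₂ Λ₂ L₂ p₂ m₂ dp₂ dm₂) {α : ℝ} (hα : 1 ≤ |α|) (he : p₁ 1 = p₂ 1) :
    ∃ ε₀ C, 0 < ε₀ ∧ 0 < C ∧ ∀ c y₁ y₂ f₁ f₂, HalfSol α p₁ m₁ L₁ c y₁ f₁ →
      HalfSol α p₂ m₂ L₂ c y₂ f₂ → ‖c - p₁ y₁‖ ≤ ε₀ → ‖c - p₂ y₂‖ ≤ ε₀ →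
      (c.im ≠ 0 ∨ p₂ 1 < c.re) → c.re ≤ p₂ 1 + ε₀ →
      logWeight (c - p₁ 1) * logWeight (c - p₂ 1) ≤ C * (‖c‖ * ‖reducedWronskian
        (halfX p₁ m₁ c f₁) (halfX p₂ m₂ c f₂) (halfA c y₁ f₁) (halfA c y₂ f₂)‖) := by
  have hp := h₂.p_one_pos
  set e := p₂ 1 with hedef
  have hδ : 0 < e / 2 := by positivity
  have hR : 0 ≤ e + 2 := by positivity
  obtain ⟨ε₁, a₁, hε₁, ha₁, hA₁⟩ := h₁.exists_halfA_re_ge hα hδ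
  obtain ⟨ε₂, a₂, hε₂, ha₂, hA₂⟩ := h₂.exists_halfA_re_ge hα hδ
  obtain ⟨ε₃, n₁, hε₃, hn₁, hB₁⟩ := h₁.exists_halfB_im_ge α
  obtain ⟨ε₄, n₂, hε₄, hn₂, hB₂⟩ := h₂.exists_halfB_im_ge α
  obtain ⟨ε₅, k₁, hε₅, hk₁, hW₁, -⟩ := h₁.exists_halfX_weight α hδ hR
  obtain ⟨ε₆, k₂, hε₆, hk₂, hW₂, -⟩ := h₂.exists_halfX_weight α hδ hR
  obtain ⟨η₁, hη₁, hW₁⟩ := hW₁ (4 / a₁)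
  obtain ⟨η₂, hη₂, hW₂⟩ := hW₂ (4 / a₁)
  obtain ⟨η, hη⟩ : ∃ η, η = min (e / 2) (min η₁ η₂) := ⟨_, rfl⟩
  have hη0 : 0 < η := by rw [hη]; positivity
  have hηe : η ≤ e / 2 := hη ▸ min_le_left _ _
  have hηη₁ : η ≤ η₁ := hη ▸ (min_le_right _ _).trans (min_le_left _ _)
  have hηη₂ : η ≤ η₂ := hη ▸ (min_le_right _ _).trans (min_le_right _ _)
  obtain ⟨ε₀, hε₀⟩ : ∃ ε₀, ε₀ = min (min (min ε₁ ε₂) (min ε₃ ε₄)) (min (min ε₅ ε₆)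
    (min 1 (η / 4))) := ⟨_, rfl⟩
  have hε₀0 : 0 < ε₀ := by rw [hε₀]; positivity
  obtain ⟨⟨⟨l1, l2⟩, l3, l4⟩, ⟨l5, l6⟩, l7, l8⟩ : ((ε₀ ≤ ε₁ ∧ ε₀ ≤ ε₂) ∧ ε₀ ≤ ε₃ ∧ ε₀ ≤ ε₄) ∧
      (ε₀ ≤ ε₅ ∧ ε₀ ≤ ε₆) ∧ ε₀ ≤ 1 ∧ ε₀ ≤ η / 4 := by
    simp only [← le_min_iff]; exact hε₀.le
  set ℓ := Real.log (Real.exp 1 + η⁻¹) with hℓ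
  obtain ⟨n₀, hn₀⟩ : ∃ n₀, n₀ = min n₁ n₂ := ⟨_, rfl⟩
  have hn₀0 : 0 < n₀ := by rw [hn₀]; positivity
  refine ⟨ε₀, ℓ ^ 2 / (2 * n₀) + 1 / (e / 2 * (a₁ / 2 * (k₁ * k₂))), hε₀0, by positivity,
    fun c y₁ y₂ f₁ f₂ hf₁ hf₂ hc₁ hc₂ hoff hce => ?_⟩
  have him := abs_im_le_of_norm_sub_le hc₁
  have hre0 := h₁.re_nonneg hf₁.crit
  have hcR := norm_le_of_re_le hre0 hce him l7
  set X₁ := halfX p₁ m₁ c f₁ with hX₁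
  set X₂ := halfX p₂ m₂ c f₂ with hX₂
  set A₁ := halfA c y₁ f₁ with hA₁'
  set A₂ := halfA c y₂ f₂ with hA₂'
  set D := reducedWronskian X₁ X₂ A₁ A₂ with hD
  have hw₁ := one_le_logWeight (c - p₁ 1)
  have hw₂ := one_le_logWeight (c - e)
  have hD0 : 0 ≤ ‖c‖ * ‖D‖ := by positivity
  rcases lt_or_ge ‖c - e‖ η with hlt | hge
  · -- both `X₁` and `X₂` are large
    have hre := (abs_le.1 ((abs_re_sub_le_norm c e).trans hlt.le)).1
    have hcδ : e / 2 ≤ c.re := by linarith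
    have hlt₁ : ‖c - p₁ 1‖ < η := by rw [he]; exact hlt
    obtain ⟨u1, u2⟩ := hW₁ c y₁ f₁ hf₁ hcδ hcR (hc₁.trans l5) (by rwa [he]) (hlt₁.trans_le hηη₁)
    obtain ⟨v1, v2⟩ := hW₂ c y₂ f₂ hf₂ hcδ hcR (hc₂.trans l6) hoff (hlt.trans_le hηη₂)
    have w1 := hA₁ c y₁ f₁ hf₁ hcδ (hc₁.trans l1)
    have w2 := hA₂ c y₂ f₂ hf₂ hcδ (hc₂.trans l2)
    rw [← hX₁] at u1 u2
    rw [← hX₂] at v1 v2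
    have hAn : a₁ ≤ ‖A₁ + A₂‖ := by
      refine le_trans ?_ (Complex.re_le_norm _)
      rw [Complex.add_re]; linarith
    rw [div_le_iff₀ ha₁] at u2 v2
    have hDn : a₁ / 2 * (‖X₁‖ * ‖X₂‖) ≤ ‖D‖ := by
      have e1 : X₁ * X₂ * (A₁ + A₂) = D - (X₁ + X₂) := by rw [hD, reducedWronskian]; ring
      have e2 : ‖X₁‖ * ‖X₂‖ * ‖A₁ + A₂‖ ≤ ‖D‖ + (‖X₁‖ + ‖X₂‖) := by
        rw [← norm_mul, ← norm_mul, e1]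
        exact (norm_sub_le _ _).trans (by gcongr; exact norm_add_le _ _)
      have e3 : ‖X₁‖ * ‖X₂‖ * a₁ ≤ ‖X₁‖ * ‖X₂‖ * ‖A₁ + A₂‖ := by gcongr
      have e4 : 4 * ‖X₂‖ ≤ ‖X₁‖ * a₁ * ‖X₂‖ := by gcongr
      have e5 : 4 * ‖X₁‖ ≤ ‖X₂‖ * a₁ * ‖X₁‖ := by gcongr
      nlinarith
    have hcn : e / 2 ≤ ‖c‖ := hcδ.trans (Complex.re_le_norm c)
    have hfin : e / 2 * (a₁ / 2 * (k₁ * k₂)) * (logWeight (c - p₁ 1) * logWeight (c - e))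
        ≤ ‖c‖ * ‖D‖ := by
      calc _ = e / 2 * (a₁ / 2 * ((k₁ * logWeight (c - p₁ 1)) * (k₂ * logWeight (c - e)))) := by
            ring
        _ ≤ ‖c‖ * (a₁ / 2 * (‖X₁‖ * ‖X₂‖)) := by gcongr
        _ ≤ _ := by gcongr
    rw [add_mul]
    have : logWeight (c - p₁ 1) * logWeight (c - e)
        ≤ 1 / (e / 2 * (a₁ / 2 * (k₁ * k₂))) * (‖c‖ * ‖D‖) := by
      rw [one_div, ← div_eq_inv_mul, le_div_iff₀ (by positivity)]; linarith
    have : 0 ≤ ℓ ^ 2 / (2 * n₀) * (‖c‖ * ‖D‖) := by positivity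
    linarith
  · -- both critical points lie in `[0, 1]`
    have hlt : c.re < e := by
      by_contra hcon
      push Not at hcon
      have := norm_sub_real_le hcon hce him
      linarith
    have hci : c.im ≠ 0 := hoff.resolve_right (by linarith)
    obtain ⟨q1, q2⟩ := h₁.crit_of_re_le hf₁.crit (he ▸ hlt.le)
    obtain ⟨q3, q4⟩ := h₂.crit_of_re_le hf₂.crit hlt.le
    have b1 := hB₁ c y₁ f₁ hf₁ hci (him.trans l3) q1 q2
    have b2 := hB₂ c y₂ f₂ hf₂ hci (him.trans l4) q3 q4
    have key := two_mul_le_of_flux (abs_div_abs_self_le_one c.im) hn₀0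
      ((hn₀ ▸ min_le_left n₁ n₂).trans b1) ((hn₀ ▸ min_le_right n₁ n₂).trans b2)
    have w1 : logWeight (c - p₁ 1) ≤ ℓ := logWeight_le_of_le hη0 (by rw [he]; exact hge)
    have w2 : logWeight (c - e) ≤ ℓ := logWeight_le_of_le hη0 hge
    have hww : logWeight (c - p₁ 1) * logWeight (c - e) ≤ ℓ ^ 2 := by
      have hℓ : 0 ≤ ℓ := zero_le_one.trans ((one_le_logWeight _).trans w1)
      rw [sq]
      exact mul_le_mul w1 w2 (zero_le_one.trans (one_le_logWeight _)) hℓ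
    have h3 : ℓ ^ 2 ≤ ℓ ^ 2 / (2 * n₀) * (‖c‖ * ‖D‖) := by
      calc ℓ ^ 2 = ℓ ^ 2 / (2 * n₀) * (2 * n₀) := by field_simp
        _ ≤ _ := by gcongr
    rw [add_mul]
    have : 0 ≤ 1 / (e / 2 * (a₁ / 2 * (k₁ * k₂))) * (‖c‖ * ‖D‖) := by positivity
    linarith

/-- The case of different end points `p₁ 1 < p₂ 1`, with four regions for `c`: near `p₂ 1`, where `X₂` is
large and `Re (X₁ (A₁ + A₂)) ≥ 0`; near `p₁ 1`, where `X₁` is large; to the left of `p₁ 1`, where both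
critical points lie in `[0, 1]`; and between the end points. The last three use the flux through the
second half, whose critical point lies in `[0, 1]`. -/
theorem exists_lower_bound_of_lt (h₁ : HalfProfile κ₁ Λ₁ L₁ p₁ m₁ dp₁ dm₁)
    (h₂ : HalfProfile κ₂ Λ₂ L₂ p₂ m₂ dp₂ dm₂) {α : ℝ} (hα : 1 ≤ |α|) (he : p₁ 1 < p₂ 1) :
    ∃ ε₀ C, 0 < ε₀ ∧ 0 < C ∧ ∀ c y₁ y₂ f₁ f₂, HalfSol α p₁ m₁ L₁ c y₁ f₁ →
      HalfSol α p₂ m₂ L₂ c y₂ f₂ → ‖c - p₁ y₁‖ ≤ ε₀ → ‖c - p₂ y₂‖ ≤ ε₀ →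
      (c.im ≠ 0 ∨ p₂ 1 < c.re) → c.re ≤ p₂ 1 + ε₀ →
      logWeight (c - p₁ 1) * logWeight (c - p₂ 1) ≤ C * (‖c‖ * ‖reducedWronskian
        (halfX p₁ m₁ c f₁) (halfX p₂ m₂ c f₂) (halfA c y₁ f₁) (halfA c y₂ f₂)‖) := by
  have hp := h₁.p_one_pos
  set e₁ := p₁ 1 with he₁
  set e₂ := p₂ 1 with he₂
  have hδ : 0 < e₁ / 2 := by positivity
  have hR : 0 ≤ e₂ + 2 := by linarith
  have hg : 0 < (e₂ - e₁) / 2 := by linarith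
  obtain ⟨ε₁, a₁, hε₁, ha₁, hA₁⟩ := h₁.exists_halfA_re_ge hα hδ
  obtain ⟨ε₂, a₂, hε₂, ha₂, hA₂⟩ := h₂.exists_halfA_re_ge hα hδ
  obtain ⟨S₁, hS₁, hAn₁⟩ := h₁.exists_norm_halfA_le α (e₂ + 2)
  obtain ⟨S₂, hS₂, hAn₂⟩ := h₂.exists_norm_halfA_le α (e₂ + 2)
  obtain ⟨ε₃, n₁, hε₃, hn₁, hB₁⟩ := h₁.exists_halfB_im_ge α
  obtain ⟨ε₄, n₂, hε₄, hn₂, hB₂⟩ := h₂.exists_halfB_im_ge α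
  obtain ⟨ε₅, k₁, hε₅, hk₁, hW₁, hV₁⟩ := h₁.exists_halfX_weight α hδ hR
  obtain ⟨ε₆, k₂, hε₆, hk₂, hW₂, hV₂⟩ := h₂.exists_halfX_weight α hδ hR
  obtain ⟨η₁', hη₁', hW₁⟩ := hW₁ 1
  obtain ⟨C₁, hC₁, hV₁⟩ := hV₁ ((e₂ - e₁) / 2) hg
  obtain ⟨η₂', hη₂', hW₂⟩ := hW₂ (2 * C₁)
  obtain ⟨η₁, hη₁⟩ : ∃ η, η = min (e₁ / 2) (min ((e₂ - e₁) / 2) η₁') := ⟨_, rfl⟩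
  obtain ⟨η₂, hη₂⟩ : ∃ η, η = min ((e₂ - e₁) / 2) η₂' := ⟨_, rfl⟩
  have hη₁0 : 0 < η₁ := by rw [hη₁]; positivity
  have hη₂0 : 0 < η₂ := by rw [hη₂]; positivity
  obtain ⟨t1, t2, t3⟩ : η₁ ≤ e₁ / 2 ∧ η₁ ≤ (e₂ - e₁) / 2 ∧ η₁ ≤ η₁' := by
    simp only [← le_min_iff]; exact hη₁.le
  obtain ⟨t4, t5⟩ : η₂ ≤ (e₂ - e₁) / 2 ∧ η₂ ≤ η₂' := by
    simp only [← le_min_iff]; exact hη₂.le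
  obtain ⟨C₂, hC₂, hV₂⟩ := hV₂ η₂ hη₂0
  obtain ⟨ε₇, x₀, N, hε₇, hx₀, hN, hP⟩ := h₁.exists_halfX_re_ge α hδ (half_pos hη₁0) hR
  -- so that the imaginary parts of `X₁` and `A` cannot spoil `Re (X₁ A) ≥ 0`
  obtain ⟨ε₈, hε₈⟩ : ∃ ε, ε = x₀ * a₁ / (N * (S₁ + S₂) + 1) := ⟨_, rfl⟩
  have hε₈0 : 0 < ε₈ := by rw [hε₈]; positivity
  obtain ⟨ε₀, hε₀⟩ : ∃ ε₀, ε₀ = min (min (min ε₁ ε₂) (min ε₃ ε₄)) (min (min ε₅ ε₆)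
    (min (min ε₇ ε₈) (min 1 (min (η₁ / 4) (η₂ / 4))))) := ⟨_, rfl⟩
  have hε₀0 : 0 < ε₀ := by rw [hε₀]; positivity
  obtain ⟨⟨⟨l1, l2⟩, l3, l4⟩, ⟨l5, l6⟩, ⟨l7, l8⟩, l9, l10, l11⟩ :
      ((ε₀ ≤ ε₁ ∧ ε₀ ≤ ε₂) ∧ ε₀ ≤ ε₃ ∧ ε₀ ≤ ε₄) ∧ (ε₀ ≤ ε₅ ∧ ε₀ ≤ ε₆) ∧ (ε₀ ≤ ε₇ ∧ ε₀ ≤ ε₈) ∧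
      ε₀ ≤ 1 ∧ ε₀ ≤ η₁ / 4 ∧ ε₀ ≤ η₂ / 4 := by
    simp only [← le_min_iff]; exact hε₀.le
  obtain ⟨ℓ₁, hℓ₁⟩ : ∃ l, l = Real.log (Real.exp 1 + η₁⁻¹) := ⟨_, rfl⟩
  obtain ⟨ℓ₂, hℓ₂⟩ : ∃ l, l = Real.log (Real.exp 1 + η₂⁻¹) := ⟨_, rfl⟩
  have hℓ (η : ℝ) (hη : 0 < η) : 0 ≤ Real.log (Real.exp 1 + η⁻¹) :=
    Real.log_nonneg (by
      have := Real.add_one_le_exp 1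
      have : 0 < η⁻¹ := by positivity
      linarith)
  have hℓ₁0 : 0 ≤ ℓ₁ := hℓ₁ ▸ hℓ η₁ hη₁0
  have hℓ₂0 : 0 ≤ ℓ₂ := hℓ₂ ▸ hℓ η₂ hη₂0
  obtain ⟨n₀, hn₀⟩ : ∃ n₀, n₀ = min n₁ n₂ := ⟨_, rfl⟩
  have hn₀0 : 0 < n₀ := by rw [hn₀]; positivity
  obtain ⟨K₁, hK₁⟩ : ∃ K, K = ℓ₁ * ℓ₂ / (2 * n₀) := ⟨_, rfl⟩
  obtain ⟨K₂, hK₂⟩ : ∃ K, K = ℓ₂ * C₂ / (n₂ * k₁) := ⟨_, rfl⟩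
  obtain ⟨K₃, hK₃⟩ : ∃ K, K = ℓ₁ * ℓ₂ * C₂ / (n₂ * x₀) := ⟨_, rfl⟩
  obtain ⟨K₄, hK₄⟩ : ∃ K, K = 2 * ℓ₁ / (k₂ * (e₁ / 2)) := ⟨_, rfl⟩
  have hK₁0 : 0 ≤ K₁ := by rw [hK₁]; positivity
  have hK₂0 : 0 ≤ K₂ := by rw [hK₂]; positivity
  have hK₃0 : 0 ≤ K₃ := by rw [hK₃]; positivity
  have hK₄0 : 0 ≤ K₄ := by rw [hK₄]; positivity
  refine ⟨ε₀, K₁ + K₂ + K₃ + K₄ + 1, hε₀0, by positivity,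
    fun c y₁ y₂ f₁ f₂ hf₁ hf₂ hc₁ hc₂ hoff hce => ?_⟩
  have him := abs_im_le_of_norm_sub_le hc₁
  have hre0 := h₁.re_nonneg hf₁.crit
  have hcR := norm_le_of_re_le hre0 hce him l9
  set X₁ := halfX p₁ m₁ c f₁ with hX₁
  set X₂ := halfX p₂ m₂ c f₂ with hX₂
  set A₁ := halfA c y₁ f₁ with hA₁'
  set A₂ := halfA c y₂ f₂ with hA₂'
  set D := reducedWronskian X₁ X₂ A₁ A₂ with hD
  have hw₁ := one_le_logWeight (c - e₁)
  have hw₂ := one_le_logWeight (c - e₂)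
  have hoff₁ : c.im ≠ 0 ∨ e₁ < c.re := hoff.imp_right fun h => he.trans h
  obtain ⟨Z, hZ⟩ : ∃ Z, Z = ‖c‖ * ‖D‖ := ⟨_, rfl⟩
  have hZ0 : 0 ≤ Z := by rw [hZ]; positivity
  have hgoal (K : ℝ) (hK : K ≤ K₁ + K₂ + K₃ + K₄ + 1)
      (hle : logWeight (c - e₁) * logWeight (c - e₂) ≤ K * Z) :
      logWeight (c - e₁) * logWeight (c - e₂) ≤ (K₁ + K₂ + K₃ + K₄ + 1) * (‖c‖ * ‖D‖) := by
    rw [← hZ]; exact hle.trans (by gcongr)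
  rcases lt_or_ge ‖c - e₂‖ η₂ with hlt | hge
  · -- near the outer end point: `X₂` is large and `X₁` nearly positive
    have hre := (abs_le.1 ((abs_re_sub_le_norm c e₂).trans hlt.le)).1
    have hcδ : e₁ / 2 ≤ c.re := by linarith
    obtain ⟨v1, v2⟩ := hW₂ c y₂ f₂ hf₂ hcδ hcR (hc₂.trans l6) hoff (hlt.trans_le t5)
    obtain ⟨r1, r2⟩ := hP c y₁ f₁ hf₁ hcδ (by linarith) hcR (him.trans l7)
    have hfar : (e₂ - e₁) / 2 ≤ ‖c - e₁‖ :=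
      le_trans (by linarith) ((le_abs_self _).trans (abs_re_sub_le_norm c e₁))
    have u1 := hV₁ c y₁ f₁ hf₁ hcδ hcR (hc₁.trans l5) hoff₁ hfar
    have w1 := hA₁ c y₁ f₁ hf₁ hcδ (hc₁.trans l1)
    have w2 := hA₂ c y₂ f₂ hf₂ hcδ (hc₂.trans l2)
    have w3 := hAn₁ c y₁ f₁ hf₁ hcR
    have w4 := hAn₂ c y₂ f₂ hf₂ hcR
    rw [← hX₁] at r1 r2 u1
    rw [← hX₂] at v1 v2
    rw [← hA₁'] at w1 w3
    rw [← hA₂'] at w2 w4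
    have hone : 1 ≤ ‖X₁ * (A₁ + A₂) + 1‖ := by
      refine le_trans ?_ (Complex.re_le_norm _)
      rw [Complex.add_re, Complex.one_re, Complex.mul_re]
      have i1 : x₀ * a₁ ≤ X₁.re * (A₁ + A₂).re := by
        have : a₁ ≤ (A₁ + A₂).re := by rw [Complex.add_re]; linarith
        exact mul_le_mul r1 this (by linarith) (hx₀.le.trans r1)
      have i2 : X₁.im * (A₁ + A₂).im ≤ x₀ * a₁ := by
        have j1 : |(A₁ + A₂).im| ≤ S₁ + S₂ :=
          (Complex.abs_im_le_norm _).trans ((norm_add_le _ _).trans (add_le_add w3 w4))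
        have j2 : |c.im| ≤ ε₈ := him.trans l8
        calc X₁.im * (A₁ + A₂).im ≤ |X₁.im| * |(A₁ + A₂).im| := by
              rw [← abs_mul]; exact le_abs_self _
          _ ≤ (N * ε₈) * (S₁ + S₂) := by
              have : N * |c.im| ≤ N * ε₈ := by gcongr
              exact mul_le_mul (r2.trans this) j1 (abs_nonneg _) (by positivity)
          _ = (N * (S₁ + S₂)) * ε₈ := by ring
          _ ≤ (N * (S₁ + S₂) + 1) * ε₈ := by gcongr; linarith
          _ = x₀ * a₁ := by rw [hε₈]; field_simp
      linarith
    have hDn : ‖X₂‖ ≤ 2 * ‖D‖ := by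
      have e1 : X₂ * (X₁ * (A₁ + A₂) + 1) = D - X₁ := by rw [hD, reducedWronskian]; ring
      have e2 : ‖X₂‖ * ‖X₁ * (A₁ + A₂) + 1‖ ≤ ‖D‖ + ‖X₁‖ := by
        rw [← norm_mul, e1]; exact norm_sub_le _ _
      have e3 : ‖X₂‖ * 1 ≤ ‖X₂‖ * ‖X₁ * (A₁ + A₂) + 1‖ := by gcongr
      linarith
    have hcn : e₁ / 2 ≤ ‖c‖ := hcδ.trans (Complex.re_le_norm c)
    have hl1 : logWeight (c - e₁) ≤ ℓ₁ := hℓ₁ ▸ logWeight_le_of_le hη₁0 (t2.trans hfar)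
    refine hgoal K₄ (by linarith) ?_
    have h5 : k₂ * logWeight (c - e₂) * (e₁ / 2) ≤ 2 * Z := by
      calc _ ≤ (2 * ‖D‖) * ‖c‖ := by
            refine mul_le_mul (v1.trans hDn) hcn (by positivity) (by positivity)
        _ = _ := by rw [hZ]; ring
    calc logWeight (c - e₁) * logWeight (c - e₂) ≤ ℓ₁ * logWeight (c - e₂) := by gcongr
      _ = ℓ₁ / (k₂ * (e₁ / 2)) * (k₂ * logWeight (c - e₂) * (e₁ / 2)) := by field_simp
      _ ≤ ℓ₁ / (k₂ * (e₁ / 2)) * (2 * Z) := by gcongr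
      _ = K₄ * Z := by rw [hK₄]; ring
  · have hlt : c.re < e₂ := by
      by_contra hcon
      push Not at hcon
      have := norm_sub_real_le hcon hce him
      linarith
    have hci : c.im ≠ 0 := hoff.resolve_right (by linarith)
    obtain ⟨q3, q4⟩ := h₂.crit_of_re_le hf₂.crit hlt.le
    have b2 := hB₂ c y₂ f₂ hf₂ hci (him.trans l4) q3 q4
    have hl2 : logWeight (c - e₂) ≤ ℓ₂ := hℓ₂ ▸ logWeight_le_of_le hη₂0 hge
    have hflux := mul_norm_le_of_flux (abs_div_abs_self_le_one c.im)
      (h₁.halfB_im_nonneg hf₁ hci) b2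
    rw [← hX₁, ← hX₂, ← hA₁', ← hA₂', ← hD, ← hZ] at hflux
    rcases lt_or_ge ‖c - e₁‖ η₁ with hlt₁ | hge₁
    · -- near the inner end point: `X₁` is large
      have hre := (abs_le.1 ((abs_re_sub_le_norm c e₁).trans hlt₁.le)).1
      have hcδ : e₁ / 2 ≤ c.re := by linarith
      obtain ⟨u1, -⟩ := hW₁ c y₁ f₁ hf₁ hcδ hcR (hc₁.trans l5) hoff₁ (hlt₁.trans_le t3)
      have v1 := hV₂ c y₂ f₂ hf₂ hcδ hcR (hc₂.trans l6) hoff hge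
      rw [← hX₁] at u1
      rw [← hX₂] at v1
      refine hgoal K₂ (by linarith) ?_
      calc logWeight (c - e₁) * logWeight (c - e₂) ≤ logWeight (c - e₁) * ℓ₂ := by gcongr
        _ = ℓ₂ / (n₂ * k₁) * (n₂ * (k₁ * logWeight (c - e₁))) := by field_simp
        _ ≤ ℓ₂ / (n₂ * k₁) * (n₂ * ‖X₁‖) := by gcongr
        _ ≤ ℓ₂ / (n₂ * k₁) * (Z * C₂) :=
            mul_le_mul_of_nonneg_left (hflux.trans (by gcongr)) (by positivity)
        _ = K₂ * Z := by rw [hK₂]; ring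
    have hl1 : logWeight (c - e₁) ≤ ℓ₁ := hℓ₁ ▸ logWeight_le_of_le hη₁0 hge₁
    have hww : logWeight (c - e₁) * logWeight (c - e₂) ≤ ℓ₁ * ℓ₂ := by gcongr
    rcases le_or_gt c.re e₁ with hle | hgt
    · -- both critical points lie in `[0, 1]`; this includes the neighbourhood of the origin
      obtain ⟨q1, q2⟩ := h₁.crit_of_re_le hf₁.crit hle
      have b1 := hB₁ c y₁ f₁ hf₁ hci (him.trans l3) q1 q2
      have key := two_mul_le_of_flux (abs_div_abs_self_le_one c.im) hn₀0
        ((hn₀ ▸ min_le_left n₁ n₂).trans b1) ((hn₀ ▸ min_le_right n₁ n₂).trans b2)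
      rw [← hX₁, ← hX₂, ← hA₁', ← hA₂', ← hD, ← hZ] at key
      refine hgoal K₁ (by linarith) (hww.trans ?_)
      calc ℓ₁ * ℓ₂ = K₁ * (2 * n₀) := by rw [hK₁]; field_simp
        _ ≤ _ := by gcongr
    · -- between the end points: `X₁` is bounded below
      have hfar : e₁ + η₁ / 2 ≤ c.re := by
        have h6 := Complex.norm_le_abs_re_add_abs_im (c - e₁)
        simp only [Complex.sub_re, Complex.sub_im, Complex.ofReal_re, Complex.ofReal_im,
          sub_zero] at h6
        rw [abs_of_pos (by linarith)] at h6
        linarith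
      have hcδ : e₁ / 2 ≤ c.re := by linarith
      obtain ⟨r1, -⟩ := hP c y₁ f₁ hf₁ hcδ hfar hcR (him.trans l7)
      have v1 := hV₂ c y₂ f₂ hf₂ hcδ hcR (hc₂.trans l6) hoff hge
      rw [← hX₁] at r1
      rw [← hX₂] at v1
      have hx : x₀ ≤ ‖X₁‖ := r1.trans (Complex.re_le_norm _)
      refine hgoal K₃ (by linarith) (hww.trans ?_)
      calc ℓ₁ * ℓ₂ = ℓ₁ * ℓ₂ / (n₂ * x₀) * (n₂ * x₀) := by field_simp
        _ ≤ ℓ₁ * ℓ₂ / (n₂ * x₀) * (n₂ * ‖X₁‖) := by gcongr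
        _ ≤ ℓ₁ * ℓ₂ / (n₂ * x₀) * (Z * C₂) :=
            mul_le_mul_of_nonneg_left (hflux.trans (by gcongr)) (by positivity)
        _ = K₃ * Z := by rw [hK₃]; ring

/-- The lower bound for the Wronskian on the side `Re c ≥ 0`. -/
theorem exists_lower_bound (h₁ : HalfProfile κ₁ Λ₁ L₁ p₁ m₁ dp₁ dm₁)
    (h₂ : HalfProfile κ₂ Λ₂ L₂ p₂ m₂ dp₂ dm₂) {α : ℝ} (hα : 1 ≤ |α|) :
    ∃ ε₀ C, 0 < ε₀ ∧ 0 < C ∧ ∀ c y₁ y₂ f₁ f₂, HalfSol α p₁ m₁ L₁ c y₁ f₁ →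
      HalfSol α p₂ m₂ L₂ c y₂ f₂ → ‖c - p₁ y₁‖ ≤ ε₀ → ‖c - p₂ y₂‖ ≤ ε₀ →
      (c.im ≠ 0 ∨ max (p₁ 1) (p₂ 1) < c.re) → c.re ≤ max (p₁ 1) (p₂ 1) + ε₀ →
      logWeight (c - p₁ 1) * logWeight (c - p₂ 1) ≤ C * (‖c‖ * ‖reducedWronskian
        (halfX p₁ m₁ c f₁) (halfX p₂ m₂ c f₂) (halfA c y₁ f₁) (halfA c y₂ f₂)‖) := by
  rcases lt_trichotomy (p₁ 1) (p₂ 1) with h | h | h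
  · rw [max_eq_right h.le]; exact exists_lower_bound_of_lt h₁ h₂ hα h
  · rw [max_eq_right h.le]; exact exists_lower_bound_of_eq h₁ h₂ hα h
  · rw [max_eq_left h.le]
    obtain ⟨ε₀, C, hε, hC, H⟩ := exists_lower_bound_of_lt h₂ h₁ hα h
    refine ⟨ε₀, C, hε, hC, fun c y₁ y₂ f₁ f₂ hf₁ hf₂ hc₁ hc₂ hoff hce => ?_⟩
    rw [mul_comm, reducedWronskian_comm]
    exact H c y₂ y₁ f₂ f₁ hf₂ hf₁ hc₂ hc₁ hoff hce

end HalfProfile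

/-! ### Stability of regular solutions and boundary values of `I` -/

/-- Bounded convergence for interval integrals, with one exceptional point `y₀`. -/
theorem tendsto_intervalIntegral_of_bounded {ι : Type*} {l : Filter ι} [l.IsCountablyGenerated]
    {F : ι → ℝ → ℂ} {g : ℝ → ℂ} {a b B y₀ : ℝ}
    (hc : ∀ᶠ i in l, ContinuousOn (F i) (uIcc a b))
    (hB : ∀ᶠ i in l, ∀ x ∈ uIcc a b, ‖F i x‖ ≤ B)
    (hl : ∀ x ∈ uIcc a b, x ≠ y₀ → Tendsto (fun i => F i x) l (𝓝 (g x))) :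
    Tendsto (fun i => ∫ x in a..b, F i x) l (𝓝 (∫ x in a..b, g x)) := by
  refine intervalIntegral.tendsto_integral_filter_of_dominated_convergence (fun _ => B) ?_ ?_
    intervalIntegrable_const ?_
  · filter_upwards [hc] with i hi
    exact (hi.mono uIoc_subset_uIcc).aestronglyMeasurable measurableSet_uIoc
  · filter_upwards [hB] with i hi
    exact Eventually.of_forall fun x hx => hi x (uIoc_subset_uIcc hx)
  · have : ∀ᵐ x : ℝ, x ≠ y₀ := by
      rw [MeasureTheory.ae_iff]; simp
    filter_upwards [this] with x hx hxm
    exact hl x (uIoc_subset_uIcc hxm) hx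

namespace SturmKernel

variable {ι : Type*} {l : Filter ι} [l.IsCountablyGenerated] {Hn : ι → ℝ → ℂ} {H : ℝ → ℂ}
  {gn : ι → ℝ → ℂ} {g : ℝ → ℂ} {a b y₀ K M N α : ℝ}

theorem tendsto_volterra (hn : ∀ᶠ i in l, SturmKernel (Hn i) a b y₀ K)
    (k : SturmKernel H a b y₀ K) (hN : ∀ᶠ i in l, ∀ s ∈ Icc a b, ‖Hn i s‖ ≤ N)
    (hH : ∀ s ∈ Icc a b, Tendsto (fun i => Hn i s) l (𝓝 (H s)))
    (hc : ∀ᶠ i in l, ContinuousOn (gn i) (Icc a b))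
    (hM : ∀ᶠ i in l, ∀ s ∈ Icc a b, ‖gn i s‖ ≤ M)
    (hg : ∀ s ∈ Icc a b, Tendsto (fun i => gn i s) l (𝓝 (g s))) {t : ℝ} (ht : t ∈ Icc a b) :
    Tendsto (fun i => volterra (Hn i) y₀ (gn i) t) l (𝓝 (volterra H y₀ g t)) := by
  by_cases h : t = y₀
  · simpa [volterra, h] using tendsto_const_nhds
  refine Tendsto.div ?_ (hH t ht) (k.ne t ht h)
  have hs := k.uIcc_subset ht
  refine tendsto_intervalIntegral_of_bounded (B := N * M) (y₀ := y₀) ?_ ?_ fun x hx _ =>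
    (hH x (hs hx)).mul (hg x (hs hx))
  · filter_upwards [hn, hc] with i hi hci
    exact (hi.cont.mul hci).mono hs
  · filter_upwards [hN, hM] with i hi hMi x hx
    rw [norm_mul]
    have := hi x (hs hx)
    exact mul_le_mul this (hMi x (hs hx)) (norm_nonneg _) ((norm_nonneg _).trans this)

/-- Continuous dependence of the regular solution on the coefficient: the difference of two
solutions solves the Volterra equation with forcing `∫ (V_i - V) f`, which tends to `0` by
dominated convergence. -/
theorem tendsto_isSturmSol {fn : ι → ℝ → ℂ} {f : ℝ → ℂ}
    (hn : ∀ᶠ i in l, SturmKernel (Hn i) a b y₀ K)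
    (k : SturmKernel H a b y₀ K) (hN : ∀ᶠ i in l, ∀ s ∈ Icc a b, ‖Hn i s‖ ≤ N)
    (hH : ∀ s ∈ Icc a b, Tendsto (fun i => Hn i s) l (𝓝 (H s)))
    (hfn : ∀ᶠ i in l, IsSturmSol α (Hn i) (Icc a b) y₀ (fn i))
    (hf : IsSturmSol α H (Icc a b) y₀ f) {y : ℝ} (hy : y ∈ Icc a b) :
    Tendsto (fun i => fn i y) l (𝓝 (f y)) := by
  have hab := k.lt.le
  obtain ⟨M, hM⟩ := isCompact_Icc.exists_bound_of_continuousOn hf.continuousOn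
  set e : ι → ℝ → ℂ := fun i t => volterra (Hn i) y₀ f t - volterra H y₀ f t with he
  have hec : ∀ᶠ i in l, ContinuousOn (e i) (Icc a b) := by
    filter_upwards [hn] with i hi
    exact (hi.continuousOn_volterra hf.continuousOn).sub (k.continuousOn_volterra hf.continuousOn)
  have hM0 : 0 ≤ M := (norm_nonneg _).trans (hM y hy)
  have hK := k.nonneg
  have heb : ∀ᶠ i in l, ∀ t ∈ Icc a b, ‖e i t‖ ≤ 2 * (K * M * (b - a)) := by
    filter_upwards [hn] with i hi t ht
    have hd : |t - y₀| ≤ b - a := by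
      rw [abs_le]; constructor <;> linarith [ht.1, ht.2, k.mem.1, k.mem.2]
    have h1 := hi.norm_volterra_le ht fun s hs => hM s (k.uIcc_subset ht hs)
    have h2 := k.norm_volterra_le ht fun s hs => hM s (k.uIcc_subset ht hs)
    have h3 : K * M * |t - y₀| ≤ K * M * (b - a) := by gcongr
    refine (norm_sub_le _ _).trans ?_
    linarith
  have het : ∀ t ∈ Icc a b, Tendsto (fun i => e i t) l (𝓝 0) := by
    intro t ht
    have := (tendsto_volterra hn k hN hH (Eventually.of_forall fun _ => hf.continuousOn)
      (Eventually.of_forall fun _ => hM) (fun s _ => tendsto_const_nhds) ht).sub_const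
        (volterra H y₀ f t)
    rwa [sub_self] at this
  have hA : Tendsto (fun i => ∫ t in a..b, ((‖e i t‖ : ℝ) : ℂ)) l (𝓝 0) := by
    have := tendsto_intervalIntegral_of_bounded (l := l) (F := fun i t => ((‖e i t‖ : ℝ) : ℂ))
      (g := fun _ => 0) (a := a) (b := b) (B := 2 * (K * M * (b - a))) (y₀ := y₀) ?_ ?_ ?_
    · simpa using this
    · filter_upwards [hec] with i hi
      rw [uIcc_of_le hab]
      exact Complex.continuous_ofReal.comp_continuousOn hi.norm
    · filter_upwards [heb] with i hi t ht
      rw [uIcc_of_le hab] at ht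
      simpa using hi t ht
    · intro t ht _
      rw [uIcc_of_le hab] at ht
      have h0 := (het t ht).norm
      rw [norm_zero] at h0
      exact (Complex.continuous_ofReal.tendsto' 0 0 Complex.ofReal_zero).comp h0
  have hA' : Tendsto (fun i => 2 * (α ^ 2 * ‖∫ t in a..b, ((‖e i t‖ : ℝ) : ℂ)‖)
      * Real.exp ((2 * (α ^ 2 * K * (b - a)) + 1) * (b - a))) l (𝓝 0) := by
    simpa using (((hA.norm).const_mul (α ^ 2)).const_mul 2).mul_const
      (Real.exp ((2 * (α ^ 2 * K * (b - a)) + 1) * (b - a)))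
  rw [tendsto_iff_norm_sub_tendsto_zero]
  refine squeeze_zero' (Eventually.of_forall fun _ => norm_nonneg _) ?_ hA'
  filter_upwards [hn, hfn, hec] with i hi hfi hei
  refine hi.norm_le_of_volterra α (d := fun y => fn i y - f y)
    (hfi.continuousOn.sub hf.continuousOn) (fun x hx => ?_) y hy
  have hs := k.uIcc_subset hx
  have ii {g : ℝ → ℂ} (hg : ContinuousOn g (Icc a b)) :
      IntervalIntegrable g MeasureTheory.volume y₀ x := (hg.mono hs).intervalIntegrable
  have i1 := ii (hi.continuousOn_volterra hfi.continuousOn)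
  have i2 := ii (hi.continuousOn_volterra hf.continuousOn)
  have i3 := ii (k.continuousOn_volterra hf.continuousOn)
  have e1 : ∫ t in y₀..x, volterra (Hn i) y₀ (fun y => fn i y - f y) t
      = (∫ t in y₀..x, volterra (Hn i) y₀ (fn i) t) - ∫ t in y₀..x, volterra (Hn i) y₀ f t := by
    rw [← intervalIntegral.integral_sub i1 i2]
    exact intervalIntegral.integral_congr fun t ht =>
      (hi.volterra_sub (hs ht) hfi.continuousOn hf.continuousOn).symm
  have e2 : ∫ t in y₀..x, e i t
      = (∫ t in y₀..x, volterra (Hn i) y₀ f t) - ∫ t in y₀..x, volterra H y₀ f t :=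
    intervalIntegral.integral_sub i2 i3
  have e3 : fn i x - f x - (α : ℂ) ^ 2 * ∫ t in y₀..x, volterra (Hn i) y₀ (fun y => fn i y - f y) t
      = (α : ℂ) ^ 2 * ∫ t in y₀..x, e i t := by
    rw [e1, e2, hfi.eq_volterra hi hx, hf.eq_volterra k hx]; ring
  rw [e3, norm_mul, norm_pow, Complex.norm_real, Real.norm_eq_abs, sq_abs]
  refine mul_le_mul_of_nonneg_left ?_ (sq_nonneg _)
  rw [intervalIntegral.integral_ofReal, Complex.norm_real, Real.norm_eq_abs]
  refine intervalIntegral.norm_integral_le_abs_integral_norm.trans ?_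
  refine intervalIntegral.abs_integral_mono_interval ?_ ?_ ?_
  · rw [uIoc_of_le hab]
    intro t ht
    rcases le_total y₀ x with h | h
    · rw [uIoc_of_le h] at ht
      exact ⟨k.mem.1.trans_lt ht.1, ht.2.trans hx.2⟩
    · rw [uIoc_of_ge h] at ht
      exact ⟨hx.1.trans_lt ht.1, ht.2.trans k.mem.2⟩
  · exact Eventually.of_forall fun t => norm_nonneg _
  · exact ContinuousOn.intervalIntegrable (by rw [uIcc_of_le hab]; exact hei.norm)

theorem tendsto_derivWithin_isSturmSol {fn : ι → ℝ → ℂ} {f : ℝ → ℂ}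
    (hn : ∀ᶠ i in l, SturmKernel (Hn i) a b y₀ K)
    (k : SturmKernel H a b y₀ K) (hN : ∀ᶠ i in l, ∀ s ∈ Icc a b, ‖Hn i s‖ ≤ N)
    (hH : ∀ s ∈ Icc a b, Tendsto (fun i => Hn i s) l (𝓝 (H s)))
    (hfn : ∀ᶠ i in l, IsSturmSol α (Hn i) (Icc a b) y₀ (fn i))
    (hf : IsSturmSol α H (Icc a b) y₀ f) {y : ℝ} (hy : y ∈ Icc a b) :
    Tendsto (fun i => derivWithin (fn i) (Icc a b) y) l (𝓝 (derivWithin f (Icc a b) y)) := by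
  rw [hf.derivWithin_eq k hy]
  have h1 : (fun i => (α : ℂ) ^ 2 * volterra (Hn i) y₀ (fn i) y)
      =ᶠ[l] fun i => derivWithin (fn i) (Icc a b) y := by
    filter_upwards [hn, hfn] with i hi hfi
    exact (hfi.derivWithin_eq hi hy).symm
  refine Tendsto.congr' h1 (Tendsto.const_mul _ ?_)
  refine tendsto_volterra hn k hN hH (hfn.mono fun i hi => hi.continuousOn)
    (M := 2 * Real.exp ((2 * (α ^ 2 * K * (b - a)) + 1) * (b - a))) ?_
    (fun s hs => tendsto_isSturmSol hn k hN hH hfn hf hs) hy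
  filter_upwards [hn, hfn] with i hi hfi s hs
  exact hfi.norm_le hi hs

end SturmKernel

/-- The boundary value of the principal logarithm at the negative axis, from above. -/
theorem tendsto_log_add_mul_I_right {x : ℝ} (hx : x ≠ 0) :
    Tendsto (fun ε : ℝ => Complex.log (x + ε * Complex.I)) (𝓝[>] 0)
      (𝓝 (Real.log |x| + Complex.I * (Real.pi * if x < 0 then 1 else 0))) := by
  have ht : Tendsto (fun ε : ℝ => (x : ℂ) + ε * Complex.I) (𝓝 0) (𝓝 x) := by
    have : Continuous fun ε : ℝ => (x : ℂ) + ε * Complex.I := by fun_prop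
    simpa using this.tendsto 0
  rcases hx.lt_or_gt with h | h
  · have := Complex.tendsto_log_nhdsWithin_im_nonneg_of_re_neg_of_im_zero (z := x) (by simpa) rfl
    rw [if_pos h, mul_one, mul_comm Complex.I]
    rw [Complex.norm_real, Real.norm_eq_abs] at this
    refine this.comp (tendsto_nhdsWithin_iff.2 ⟨ht.mono_left nhdsWithin_le_nhds, ?_⟩)
    filter_upwards [self_mem_nhdsWithin] with ε hε
    simpa using (le_of_lt hε)
  · rw [if_neg h.not_gt, mul_zero, mul_zero, add_zero, abs_of_pos h, Complex.ofReal_log h.le]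
    exact ((continuousAt_clog (Or.inl (by simpa))).tendsto.comp ht).mono_left nhdsWithin_le_nhds

theorem tendsto_log_add_mul_I_left {x : ℝ} (hx : x ≠ 0) :
    Tendsto (fun ε : ℝ => Complex.log (x + ε * Complex.I)) (𝓝[<] 0)
      (𝓝 (Real.log |x| - Complex.I * (Real.pi * if x < 0 then 1 else 0))) := by
  have ht : Tendsto (fun ε : ℝ => (x : ℂ) + ε * Complex.I) (𝓝 0) (𝓝 x) := by
    have : Continuous fun ε : ℝ => (x : ℂ) + ε * Complex.I := by fun_prop
    simpa using this.tendsto 0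
  rcases hx.lt_or_gt with h | h
  · have := Complex.tendsto_log_nhdsWithin_im_neg_of_re_neg_of_im_zero (z := x) (by simpa) rfl
    rw [if_pos h, mul_one, mul_comm Complex.I]
    rw [Complex.norm_real, Real.norm_eq_abs] at this
    refine this.comp (tendsto_nhdsWithin_iff.2 ⟨ht.mono_left nhdsWithin_le_nhds, ?_⟩)
    filter_upwards [self_mem_nhdsWithin] with ε hε
    simpa using hε
  · rw [if_neg h.not_gt, mul_zero, mul_zero, sub_zero, abs_of_pos h, Complex.ofReal_log h.le]
    exact ((continuousAt_clog (Or.inl (by simpa))).tendsto.comp ht).mono_left nhdsWithin_le_nhds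

/-- The common part of the boundary values of `I` at a real point `c` from above and from below; for
`c > 0` it is real. -/
noncomputable def halfIre (p m dp dm : ℝ → ℝ) (c yc : ℝ) (f : ℝ → ℂ) : ℂ :=
  (∫ y in (0 : ℝ)..1, piIntegrand p m c f y) + 1 / halfSigma p m dp dm c yc *
    ((∫ y in (0 : ℝ)..1, r1Integrand p m dp dm c yc y)
      + (∫ y in (0 : ℝ)..1, r2Integrand p m dp dm c yc y)
      + (Real.log |c - p 1| - Real.log |c - m 1| : ℝ))

namespace HalfProfile

variable {κ Λ L : ℝ} {p m dp dm : ℝ → ℝ} {c yc : ℝ} {f : ℝ → ℂ} {F : ℝ → ℝ → ℂ} {α : ℝ}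
  {l : Filter ℝ}

theorem tendsto_profileH (hl : l ≤ 𝓝[≠] 0) (y : ℝ) :
    Tendsto (fun ε : ℝ => profileH p m (c + ε * Complex.I) y) l (𝓝 (profileH p m c y)) := by
  have : Continuous fun ε : ℝ => profileH p m (c + ε * Complex.I) y := by
    unfold profileH; fun_prop
  simpa using (this.tendsto 0).mono_left (hl.trans nhdsWithin_le_nhds)

theorem eventually_norm_profileH_le (h : HalfProfile κ Λ L p m dp dm) (hl : l ≤ 𝓝[≠] 0) (c : ℝ) :
    ∀ᶠ ε : ℝ in l, ∀ s ∈ Icc 0 L,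
      ‖profileH p m (c + ε * Complex.I) s‖ ≤ (Λ * L + (|c| + 1)) * (Λ * L + (|c| + 1)) := by
  have hΛ := h.Λ_pos
  have hε : ∀ᶠ ε : ℝ in l, |ε| < 1 := by
    have : ∀ᶠ ε : ℝ in 𝓝 0, |ε| < 1 := by
      have := Metric.ball_mem_nhds (0 : ℝ) one_pos
      filter_upwards [this] with ε hε
      simpa using hε
    exact (hl.trans nhdsWithin_le_nhds) this
  filter_upwards [hε] with ε hε s hs
  have hc : ‖(c : ℂ) + ε * Complex.I‖ ≤ |c| + 1 := by
    refine (norm_add_le _ _).trans ?_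
    rw [norm_mul, Complex.norm_I, mul_one, Complex.norm_real, Complex.norm_real, Real.norm_eq_abs,
      Real.norm_eq_abs]
    linarith
  have hsL : Λ * s ≤ Λ * L := by have := hs.2; gcongr
  have hs0 := mul_nonneg h.κ_pos.le hs.1
  have h1 : ‖(p s : ℂ)‖ ≤ Λ * L := by
    rw [Complex.norm_real, Real.norm_eq_abs, abs_of_nonneg (hs0.trans (h.p_nonneg hs))]
    exact (h.p_le hs).trans hsL
  have h2 : ‖(m s : ℂ)‖ ≤ Λ * L := by
    rw [Complex.norm_real, Real.norm_eq_abs, abs_of_nonpos (by linarith [h.m_nonpos hs])]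
    exact (h.m_ge hs).trans hsL
  rw [profileH, norm_mul]
  have h3 := (norm_sub_le (p s : ℂ) (c + ε * Complex.I)).trans (add_le_add h1 hc)
  have h4 := (norm_sub_le (m s : ℂ) (c + ε * Complex.I)).trans (add_le_add h2 hc)
  exact mul_le_mul h3 h4 (norm_nonneg _) ((norm_nonneg _).trans h3)

theorem tendsto_halfSol [l.IsCountablyGenerated] (h : HalfProfile κ Λ L p m dp dm) (hl : l ≤ 𝓝[≠] 0)
    (hF : ∀ ε : ℝ, HalfSol α p m L (c + ε * Complex.I) yc (F ε)) (hf : HalfSol α p m L c yc f)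
    {y : ℝ} (hy : y ∈ Icc 0 (max 1 yc)) :
    Tendsto (fun ε => F ε y) l (𝓝 (f y)) ∧
      Tendsto (fun ε => derivWithin (F ε) (Icc 0 (max 1 yc)) y) l
        (𝓝 (derivWithin f (Icc 0 (max 1 yc)) y)) := by
  have hn : ∀ᶠ ε : ℝ in l, SturmKernel (profileH p m (c + ε * Complex.I)) 0 (max 1 yc) yc
      (1 + Λ / κ) := Eventually.of_forall fun ε => h.sturmKernel (hF ε).crit
  have hN : ∀ᶠ ε : ℝ in l, ∀ s ∈ Icc 0 (max 1 yc), ‖profileH p m (c + ε * Complex.I) s‖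
      ≤ (Λ * L + (|c| + 1)) * (Λ * L + (|c| + 1)) :=
    (h.eventually_norm_profileH_le hl c).mono fun ε hε s hs => hε s (h.subset hf.crit hs)
  exact ⟨SturmKernel.tendsto_isSturmSol hn (h.sturmKernel hf.crit) hN
      (fun s _ => tendsto_profileH hl s) (Eventually.of_forall fun ε => (hF ε).sol) hf.sol hy,
    SturmKernel.tendsto_derivWithin_isSturmSol hn (h.sturmKernel hf.crit) hN
      (fun s _ => tendsto_profileH hl s) (Eventually.of_forall fun ε => (hF ε).sol) hf.sol hy⟩

theorem sigma_ne_zero (h : HalfProfile κ Λ L p m dp dm) (hc : 0 < c) (k : CritPoint p L c yc)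
    (he : p yc = c) : halfSigma p m dp dm c yc ≠ 0 := by
  have hκ := h.κ_pos
  have hΛ := h.Λ_pos
  have := h.norm_sigma_ge k (δ := c) le_rfl (by rw [he, sub_self, norm_zero]; positivity)
  exact norm_pos_iff.1 (lt_of_lt_of_le (by positivity) this)

/-- The boundary values of `I` at the critical layer `p yc = c`. In the splitting `sigma_mul_halfI` the
integrals converge by bounded convergence, and `θ` is the jump part of the boundary value of
`log (c - p 1)`. -/
theorem tendsto_halfI [l.IsCountablyGenerated] (h : HalfProfile κ Λ L p m dp dm) (hl : l ≤ 𝓝[≠] 0) (hc : 0 < c)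
    (he : p yc = c) (hF : ∀ ε : ℝ, HalfSol α p m L (c + ε * Complex.I) yc (F ε))
    (hf : HalfSol α p m L c yc f) {θ : ℂ}
    (hlog : Tendsto (fun ε : ℝ => Complex.log ((c - p 1 : ℝ) + ε * Complex.I)) l
      (𝓝 (Real.log |c - p 1| + θ))) :
    Tendsto (fun ε : ℝ => halfI p m (c + ε * Complex.I) (F ε)) l
      (𝓝 (halfIre p m dp dm c yc f + θ / halfSigma p m dp dm c yc)) := by
  obtain ⟨M, hM1, hM⟩ := h.exists_regularBounds α
  have hl0 : l ≤ 𝓝 0 := hl.trans nhdsWithin_le_nhds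
  have hne : ∀ᶠ ε : ℝ in l, ε ≠ 0 := hl self_mem_nhdsWithin
  have hu : uIcc (0 : ℝ) 1 = Icc 0 1 := uIcc_of_le zero_le_one
  have hre : ∀ ε : ℝ, ((c : ℂ) + ε * Complex.I).re = c := fun ε => by simp
  have him : ∀ ε : ℝ, ((c : ℂ) + ε * Complex.I).im = ε := fun ε => by simp
  have hoff : ∀ ε : ℝ, ε ≠ 0 → ((c : ℂ) + ε * Complex.I).im ≠ 0 ∨
      p 1 < ((c : ℂ) + ε * Complex.I).re := fun ε hε => Or.inl (by rwa [him])
  have hb := fun ε => hM _ _ _ (hF ε)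
  have hcont := hne.mono fun ε hε => h.continuousOn_integrands (hF ε) (hb ε) (hoff ε hε)
  have hct : Tendsto (fun ε : ℝ => (c : ℂ) + ε * Complex.I) l (𝓝 c) := by
    have : Continuous fun ε : ℝ => (c : ℂ) + ε * Complex.I := by fun_prop
    simpa using (this.tendsto 0).mono_left hl0
  have hσ := h.sigma_ne_zero hc hf.crit he
  have hσt : Tendsto (fun ε : ℝ => halfSigma p m dp dm (c + ε * Complex.I) yc) l
      (𝓝 (halfSigma p m dp dm c yc)) :=
    (tendsto_const_nhds.mul (tendsto_const_nhds.sub hct)).sub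
      (tendsto_const_nhds.mul (tendsto_const_nhds.sub hct))
  have hkern : ∀ y ∈ Icc (0 : ℝ) 1, y ≠ yc → (p y : ℂ) - c ≠ 0 ∧ (m y : ℂ) - c ≠ 0 := by
    intro y hy hyc
    have := (h.sturmKernel hf.crit).ne y (unit_subset_span hy) hyc
    exact ⟨left_ne_zero_of_mul this, right_ne_zero_of_mul this⟩
  have t1 : Tendsto (fun ε : ℝ => ∫ y in (0 : ℝ)..1, piIntegrand p m (c + ε * Complex.I) (F ε) y) l
      (𝓝 (∫ y in (0 : ℝ)..1, piIntegrand p m c f y)) := by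
    refine tendsto_intervalIntegral_of_bounded (y₀ := yc) (B := 2 * M ^ 2 * L / (κ * c))
      (by rw [hu]; exact hcont.mono fun ε hε => hε.1) (Eventually.of_forall fun ε x hx =>
        h.norm_piIntegrand_le (hF ε).crit (hb ε) hM1 hc (hre ε).ge (hu ▸ hx)) fun y hy hyc => ?_
    rw [hu] at hy
    obtain ⟨n1, n2⟩ := hkern y hy hyc
    have ft := (h.tendsto_halfSol hl hF hf (unit_subset_span hy)).1
    exact (tendsto_const_nhds.div (tendsto_profileH hl y) (mul_ne_zero n1 n2)).mul
      ((tendsto_const_nhds.div (ft.pow 2)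
        (pow_ne_zero 2 ((hM _ _ _ hf).ne_zero (unit_subset_span hy)))).sub tendsto_const_nhds)
  have t2 : Tendsto (fun ε : ℝ =>
        ∫ y in (0 : ℝ)..1, r1Integrand p m dp dm (c + ε * Complex.I) yc y) l
      (𝓝 (∫ y in (0 : ℝ)..1, r1Integrand p m dp dm c yc y)) := by
    refine tendsto_intervalIntegral_of_bounded (y₀ := yc) (B := 2 * Λ ^ 2 / (κ * c))
      (by rw [hu]; exact hcont.mono fun ε hε => hε.2.1) (Eventually.of_forall fun ε x hx =>
        h.norm_r1Integrand_le (hF ε).crit hc (hre ε).ge (hu ▸ hx)) fun y hy hyc => ?_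
    rw [hu] at hy
    obtain ⟨n1, n2⟩ := hkern y hy hyc
    exact tendsto_const_nhds.div (tendsto_profileH hl y) (mul_ne_zero n1 n2)
  have t3 : Tendsto (fun ε : ℝ =>
        ∫ y in (0 : ℝ)..1, r2Integrand p m dp dm (c + ε * Complex.I) yc y) l
      (𝓝 (∫ y in (0 : ℝ)..1, r2Integrand p m dp dm c yc y)) := by
    refine tendsto_intervalIntegral_of_bounded (y₀ := yc) (B := Λ / κ + Λ * L / c)
      (by rw [hu]; exact hcont.mono fun ε hε => hε.2.2.1) (Eventually.of_forall fun ε x hx =>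
        h.norm_r2Integrand_le (hF ε).crit hc (hre ε).ge (hu ▸ hx)) fun y hy hyc => ?_
    rw [hu] at hy
    obtain ⟨n1, n2⟩ := hkern y hy hyc
    exact (tendsto_const_nhds.div (tendsto_const_nhds.sub hct) n1).sub
      (tendsto_const_nhds.div (tendsto_const_nhds.sub hct) n2)
  have hm1 : 0 < c - m 1 := by linarith [h.m_nonpos h.one_mem, h.κ_pos]
  have t4 : Tendsto (fun ε : ℝ => Complex.log ((c : ℂ) + ε * Complex.I - p 1)) l
      (𝓝 (Real.log |c - p 1| + θ)) := by
    refine hlog.congr fun ε => ?_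
    push_cast; congr 1; ring
  have t5 : Tendsto (fun ε : ℝ => Complex.log ((c : ℂ) + ε * Complex.I - m 1)) l
      (𝓝 (Real.log |c - m 1| : ℝ)) := by
    rw [abs_of_pos hm1, Complex.ofReal_log hm1.le]
    push_cast
    refine (continuousAt_clog (Or.inl ?_)).tendsto.comp (hct.sub_const _)
    simpa using hm1
  have key : (fun ε : ℝ => (∫ y in (0 : ℝ)..1, piIntegrand p m (c + ε * Complex.I) (F ε) y)
      + ((∫ y in (0 : ℝ)..1, r1Integrand p m dp dm (c + ε * Complex.I) yc y)
        + (∫ y in (0 : ℝ)..1, r2Integrand p m dp dm (c + ε * Complex.I) yc y)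
        + (Complex.log ((c : ℂ) + ε * Complex.I - p 1)
          - Complex.log ((c : ℂ) + ε * Complex.I - m 1)))
        / halfSigma p m dp dm (c + ε * Complex.I) yc)
      =ᶠ[l] fun ε => halfI p m (c + ε * Complex.I) (F ε) := by
    filter_upwards [hne, hσt.eventually_ne hσ] with ε hε hσε
    have := h.sigma_mul_halfI (hF ε) (hb ε) (hoff ε hε)
    field_simp
    rw [this]
    ring
  refine Tendsto.congr' key ?_
  have hlim := t1.add (((t2.add t3).add (t4.sub t5)).div hσt hσ)
  have e : halfIre p m dp dm c yc f + θ / halfSigma p m dp dm c yc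
      = (∫ y in (0 : ℝ)..1, piIntegrand p m c f y)
        + ((∫ y in (0 : ℝ)..1, r1Integrand p m dp dm c yc y)
          + (∫ y in (0 : ℝ)..1, r2Integrand p m dp dm c yc y)
          + ((Real.log |c - p 1| : ℝ) + θ - (Real.log |c - m 1| : ℝ)))
          / halfSigma p m dp dm c yc := by
    rw [halfIre]
    push_cast
    field_simp
    ring
  rw [e]
  exact hlim

section Real

theorem im_eq_zero (h : HalfProfile κ Λ L p m dp dm) (hc : 0 < c) (hf : HalfSol α p m L c yc f)
    {y : ℝ} (hy : y ∈ Icc 0 (max 1 yc)) : (f y).im = 0 := by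
  obtain ⟨C, -, hC⟩ := h.exists_abs_im_le α hc
  have := hC c yc f hf le_rfl y hy
  rw [Complex.ofReal_im, abs_zero, mul_zero] at this
  exact abs_nonpos_iff.1 this

theorem derivWithin_im_eq_zero (h : HalfProfile κ Λ L p m dp dm) (hc : 0 < c)
    (hf : HalfSol α p m L c yc f) {y : ℝ} (hy : y ∈ Icc 0 (max 1 yc)) :
    (derivWithin f (Icc 0 (max 1 yc)) y).im = 0 := by
  have h1 := hf.sol.hasDerivWithinAt hy
  have h2 : HasDerivWithinAt f ((starRingEnd ℂ) (derivWithin f (Icc 0 (max 1 yc)) y))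
      (Icc 0 (max 1 yc)) y := by
    have hcj : ∀ t ∈ Icc 0 (max 1 yc), f t = (starRingEnd ℂ) (f t) := fun t ht =>
      (Complex.conj_eq_iff_im.2 (h.im_eq_zero hc hf ht)).symm
    exact HasDerivWithinAt.congr h1.star hcj (hcj y hy)
  exact Complex.conj_eq_iff_im.1
    ((uniqueDiffOn_Icc (by positivity) y hy).eq_deriv _ h2 h1)

theorem halfIre_im_eq_zero (h : HalfProfile κ Λ L p m dp dm) (hc : 0 < c)
    (hf : HalfSol α p m L c yc f) : (halfIre p m dp dm c yc f).im = 0 := by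
  have hint (g : ℝ → ℂ) (hg : ∀ y ∈ Icc (0 : ℝ) 1, (g y).im = 0) :
      ∃ r : ℝ, ∫ y in (0 : ℝ)..1, g y = r := by
    refine ⟨∫ y in (0 : ℝ)..1, (g y).re, ?_⟩
    rw [← intervalIntegral.integral_ofReal]
    refine intervalIntegral.integral_congr fun y hy => ?_
    rw [uIcc_of_le zero_le_one] at hy
    exact Complex.ext rfl (by simpa using hg y hy)
  obtain ⟨r, hr⟩ := hint (piIntegrand p m c f) fun y hy => by
    obtain ⟨x, hx⟩ : ∃ x : ℝ, f y = x :=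
      ⟨(f y).re, Complex.ext rfl (by simpa using h.im_eq_zero hc hf (unit_subset_span hy))⟩
    rw [piIntegrand, profileH, hx]
    norm_cast
  obtain ⟨r1, hr1⟩ := hint (r1Integrand p m dp dm c yc) fun y hy => by
    rw [r1Integrand, profileH]
    norm_cast
  obtain ⟨r2, hr2⟩ := hint (r2Integrand p m dp dm c yc) fun y hy => by
    rw [r2Integrand]
    norm_cast
  rw [halfIre, hr, hr1, hr2, halfSigma]
  norm_cast

end Real

end HalfProfile

/-! ### The two halves of the channel -/

theorem exists_bounds_of_contDiffOn {g : ℝ → ℝ} {L : ℝ} (hL : 0 < L)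
    (hg : ContDiffOn ℝ 1 g (Icc 0 L)) (hpos : ∀ y ∈ Icc 0 L, 0 < g y) :
    ∃ κ Λ, 0 < κ ∧ (∀ y ∈ Icc 0 L, κ ≤ g y ∧ g y ≤ Λ) ∧
      ∀ x ∈ Icc 0 L, ∀ y ∈ Icc 0 L, |g x - g y| ≤ Λ * |x - y| := by
  have hne : (Icc 0 L).Nonempty := ⟨0, le_rfl, hL.le⟩
  obtain ⟨y₁, h₁, hmin⟩ := isCompact_Icc.exists_isMinOn hne hg.continuousOn
  obtain ⟨y₂, h₂, hmax⟩ := isCompact_Icc.exists_isMaxOn hne hg.continuousOn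
  obtain ⟨B, hB⟩ := isCompact_Icc.exists_bound_of_continuousOn
    (hg.continuousOn_derivWithin (uniqueDiffOn_Icc hL) le_rfl)
  refine ⟨g y₁, max (g y₂) B, hpos y₁ h₁, fun y hy => ⟨hmin hy, (hmax hy).trans (le_max_left _ _)⟩,
    fun x hx y hy => ?_⟩
  have := (convex_Icc 0 L).norm_image_sub_le_of_norm_derivWithin_le
    (hg.differentiableOn one_ne_zero) (fun z hz => (hB z hz).trans (le_max_right (g y₂) B)) hy hx
  simpa only [Real.norm_eq_abs] using this

theorem exists_halfProfile {p m dp dm : ℝ → ℝ} {L : ℝ} (hL : 1 ≤ L) (hp0 : p 0 = 0)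
    (hm0 : m 0 = 0) (hp : ∀ y ∈ Icc 0 L, HasDerivWithinAt p (dp y) (Icc 0 L) y)
    (hm : ∀ y ∈ Icc 0 L, HasDerivWithinAt m (dm y) (Icc 0 L) y)
    (hdp : ContDiffOn ℝ 1 dp (Icc 0 L)) (hdm : ContDiffOn ℝ 1 dm (Icc 0 L))
    (hpos : ∀ y ∈ Icc 0 L, 0 < dp y) (hneg : ∀ y ∈ Icc 0 L, dm y < 0) :
    ∃ κ Λ, HalfProfile κ Λ L p m dp dm := by
  have hL0 : 0 < L := by linarith
  obtain ⟨κ₁, Λ₁, k₁, b₁, l₁⟩ := exists_bounds_of_contDiffOn hL0 hdp hpos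
  obtain ⟨κ₂, Λ₂, k₂, b₂, l₂⟩ := exists_bounds_of_contDiffOn hL0 hdm.neg
    (fun y hy => by simpa using hneg y hy)
  refine ⟨min κ₁ κ₂, max Λ₁ Λ₂, lt_min k₁ k₂, hL, hp0, hm0, hp, hm, fun y hy => ?_, fun y hy => ?_,
    fun x hx y hy => ?_, fun x hx y hy => ?_⟩
  · exact ⟨(min_le_left _ _).trans (b₁ y hy).1, (b₁ y hy).2.trans (le_max_left _ _)⟩
  · exact ⟨(min_le_right _ _).trans (b₂ y hy).1, (b₂ y hy).2.trans (le_max_right _ _)⟩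
  · exact (l₁ x hx y hy).trans (by gcongr; exact le_max_left _ _)
  · have := l₂ x hx y hy
    rw [neg_sub_neg, abs_sub_comm] at this
    exact this.trans (by gcongr; exact le_max_right _ _)

theorem neg_mem_Icc_of_mem {a b y : ℝ} (hy : y ∈ Icc (-b) (-a)) : -y ∈ Icc a b :=
  ⟨by linarith [hy.2], by linarith [hy.1]⟩

theorem hasDerivWithinAt_comp_neg {F : Type*} [NormedAddCommGroup F] [NormedSpace ℝ F] {g : ℝ → F}
    {g' : F} {a b y : ℝ} (hg : HasDerivWithinAt g g' (Icc a b) (-y)) :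
    HasDerivWithinAt (fun t => g (-t)) (-g') (Icc (-b) (-a)) y := by
  have := HasDerivWithinAt.scomp (h := fun t : ℝ => -t) (h' := -1) y hg
    ((hasDerivWithinAt_id y (Icc (-b) (-a))).neg) fun t ht => neg_mem_Icc_of_mem ht
  simpa [Function.comp_def] using this

namespace IsSturmSol

variable {α a b y₀ : ℝ} {H : ℝ → ℂ} {f : ℝ → ℂ}

theorem derivWithin_comp_neg_Icc (hf : DifferentiableOn ℝ f (Icc a b)) (hab : a < b) {y : ℝ}
    (hy : y ∈ Icc (-b) (-a)) : derivWithin (fun t => f (-t)) (Icc (-b) (-a)) y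
      = -derivWithin f (Icc a b) (-y) :=
  (hasDerivWithinAt_comp_neg (hf _ (neg_mem_Icc_of_mem hy)).hasDerivWithinAt).derivWithin
    (uniqueDiffOn_Icc (by linarith) y hy)

/-- The Sturm problem is invariant under reflection. -/
theorem comp_neg (hf : IsSturmSol α H (Icc a b) y₀ f) (hab : a < b) (h0 : y₀ ∈ Icc a b) :
    IsSturmSol α (fun y => H (-y)) (Icc (-b) (-a)) (-y₀) (fun y => f (-y)) := by
  have hmaps : MapsTo (fun y : ℝ => -y) (Icc (-b) (-a)) (Icc a b) := fun y hy =>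
    neg_mem_Icc_of_mem hy
  have hd : ∀ y ∈ Icc (-b) (-a), derivWithin (fun t => f (-t)) (Icc (-b) (-a)) y
      = -derivWithin f (Icc a b) (-y) := fun y hy =>
    derivWithin_comp_neg_Icc hf.differentiableOn hab hy
  have h0' : -y₀ ∈ Icc (-b) (-a) := ⟨neg_le_neg h0.2, neg_le_neg h0.1⟩
  refine ⟨fun y hy => (hasDerivWithinAt_comp_neg
    (hf.hasDerivWithinAt (hmaps hy))).differentiableWithinAt, ?_, fun y hy => ?_, ?_, ?_⟩
  · refine ContinuousOn.congr ?_ hd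
    exact (hf.continuousOn_deriv.comp continuousOn_neg hmaps).neg
  · have h1 := (hasDerivWithinAt_comp_neg (hf.ode (-y) (hmaps hy))).neg
    rw [neg_neg] at h1
    refine h1.congr (fun t ht => ?_) ?_
    · rw [hd t ht, mul_neg]; rfl
    · rw [hd y hy, mul_neg]; rfl
  · rw [neg_neg, hf.value]
  · rw [hd _ h0', neg_neg, hf.slope, neg_zero]

end IsSturmSol

/-- `r`, the real part of `z` clamped to the range of the branch, has a critical point. -/
theorem CritPoint.of_clamp {κ Λ L : ℝ} {p m dp dm : ℝ → ℝ} (h : HalfProfile κ Λ L p m dp dm)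
    {z : ℂ} {y r : ℝ} (hy : y ∈ Icc 0 L) (hr : p y = r) (hle : r ≤ z.re)
    (hend : r < z.re → p 1 ≤ r) : CritPoint p L z y := by
  refine ⟨hy, hr ▸ hle, fun h1 => ?_⟩
  rw [hr]
  by_contra hne
  have h2 := hend (lt_of_le_of_ne hle (Ne.symm hne))
  have h3 := h.p_lower hy h.one_mem h1.le
  have := mul_pos h.κ_pos (sub_pos.2 h1)
  linarith

namespace WExtension

variable {u b : ℝ → ℝ} (E : WExtension u b)

theorem am_lt_ap : E.am < E.ap := by linarith [E.am_le, E.le_ap]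

theorem right_subset : Icc 0 E.ap ⊆ Icc E.am E.ap :=
  Icc_subset_Icc_left (by linarith [E.am_le])

theorem neg_mem_of_mem {y : ℝ} (hy : y ∈ Icc 0 (-E.am)) : -y ∈ Icc E.am E.ap :=
  ⟨by linarith [hy.2], by linarith [hy.1, E.le_ap]⟩

theorem hasDerivWithinAt_Wp {y : ℝ} (hy : y ∈ Icc E.am E.ap) :
    HasDerivWithinAt E.Wp (E.dWp y) (Icc E.am E.ap) y :=
  (E.contDiffOn_Wp.differentiableOn (by norm_num) y hy).hasDerivWithinAt

theorem hasDerivWithinAt_Wm {y : ℝ} (hy : y ∈ Icc E.am E.ap) :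
    HasDerivWithinAt E.Wm (E.dWm y) (Icc E.am E.ap) y :=
  (E.contDiffOn_Wm.differentiableOn (by norm_num) y hy).hasDerivWithinAt

theorem contDiffOn_dWp : ContDiffOn ℝ 1 E.dWp (Icc E.am E.ap) :=
  E.contDiffOn_Wp.derivWithin (uniqueDiffOn_Icc E.am_lt_ap) (by norm_num)

theorem contDiffOn_dWm : ContDiffOn ℝ 1 E.dWm (Icc E.am E.ap) :=
  E.contDiffOn_Wm.derivWithin (uniqueDiffOn_Icc E.am_lt_ap) (by norm_num)

theorem exists_halfProfile_right (hp : E.Wp 0 = 0) (hm : E.Wm 0 = 0) :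
    ∃ κ Λ, HalfProfile κ Λ E.ap E.Wp E.Wm E.dWp E.dWm :=
  exists_halfProfile E.le_ap hp hm
    (fun _ hy => (E.hasDerivWithinAt_Wp (E.right_subset hy)).mono E.right_subset)
    (fun _ hy => (E.hasDerivWithinAt_Wm (E.right_subset hy)).mono E.right_subset)
    (E.contDiffOn_dWp.mono E.right_subset) (E.contDiffOn_dWm.mono E.right_subset)
    (fun y hy => E.deriv_Wp_pos y (E.right_subset hy))
    (fun y hy => E.deriv_Wm_neg y (E.right_subset hy))

theorem exists_halfProfile_left (hp : E.Wp 0 = 0) (hm : E.Wm 0 = 0) :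
    ∃ κ Λ, HalfProfile κ Λ (-E.am) (fun y => E.Wm (-y)) (fun y => E.Wp (-y))
      (fun y => -E.dWm (-y)) (fun y => -E.dWp (-y)) := by
  have hmaps : MapsTo (fun y : ℝ => -y) (Icc 0 (-E.am)) (Icc E.am E.ap) := fun y hy =>
    E.neg_mem_of_mem hy
  have hs : Icc 0 (-E.am) ⊆ Icc (-E.ap) (-E.am) := Icc_subset_Icc_left (by linarith [E.le_ap])
  refine exists_halfProfile (by linarith [E.am_le]) (by simpa using hm) (by simpa using hp)
    (fun y hy => ?_) (fun y hy => ?_) ?_ ?_ (fun y hy => ?_) (fun y hy => ?_)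
  · exact (hasDerivWithinAt_comp_neg (E.hasDerivWithinAt_Wm (hmaps hy))).mono hs
  · exact (hasDerivWithinAt_comp_neg (E.hasDerivWithinAt_Wp (hmaps hy))).mono hs
  · exact (E.contDiffOn_dWm.comp contDiff_neg.contDiffOn hmaps).neg
  · exact (E.contDiffOn_dWp.comp contDiff_neg.contDiffOn hmaps).neg
  · exact neg_pos.2 (E.deriv_Wm_neg _ (hmaps hy))
  · exact neg_neg_iff_pos.2 (E.deriv_Wp_pos _ (hmaps hy))

section Range

theorem Wm_one_neg (hp : E.Wp 0 = 0) (hm : E.Wm 0 = 0) : E.Wm 1 < 0 := by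
  obtain ⟨κ, Λ, h⟩ := E.exists_halfProfile_right hp hm
  have := h.m_nonpos h.one_mem
  linarith [h.κ_pos]

theorem Wp_one_pos (hp : E.Wp 0 = 0) (hm : E.Wm 0 = 0) : 0 < E.Wp 1 := by
  obtain ⟨κ, Λ, h⟩ := E.exists_halfProfile_right hp hm
  exact h.p_one_pos

theorem Wp_neg_one_neg (hp : E.Wp 0 = 0) (hm : E.Wm 0 = 0) : E.Wp (-1) < 0 := by
  obtain ⟨κ, Λ, h⟩ := E.exists_halfProfile_left hp hm
  have := h.m_nonpos h.one_mem
  linarith [h.κ_pos]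

theorem cMin_neg (hp : E.Wp 0 = 0) (hm : E.Wm 0 = 0) : E.cMin < 0 :=
  (min_le_left _ _).trans_lt (E.Wm_one_neg hp hm)

theorem cMax_pos (hp : E.Wp 0 = 0) (hm : E.Wm 0 = 0) : 0 < E.cMax :=
  (E.Wp_one_pos hp hm).trans_le (le_max_left _ _)

theorem cMin_le_cMax (hp : E.Wp 0 = 0) (hm : E.Wm 0 = 0) : E.cMin ≤ E.cMax :=
  ((E.cMin_neg hp hm).trans (E.cMax_pos hp hm)).le

theorem cr_mem (hp : E.Wp 0 = 0) (hm : E.Wm 0 = 0) (z : ℂ) : E.cr z ∈ Icc E.cMin E.cMax :=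
  ⟨le_max_left _ _, max_le (E.cMin_le_cMax hp hm) (min_le_right _ _)⟩

theorem cr_eq_of_mem {z : ℂ} (hz : z.re ∈ Icc E.cMin E.cMax) : E.cr z = z.re := by
  rw [cr, min_eq_left hz.2, max_eq_right hz.1]

theorem cr_le_re (hp : E.Wp 0 = 0) (hm : E.Wm 0 = 0) {z : ℂ} (hz : 0 ≤ E.cr z) :
    E.cr z ≤ z.re := by
  have := E.cMin_neg hp hm
  rcases max_choice E.cMin (min z.re E.cMax) with h | h
  · have : E.cr z = E.cMin := h
    linarith
  · have : E.cr z = min z.re E.cMax := h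
    rw [this]; exact min_le_left _ _

theorem cr_eq_cMax (hp : E.Wp 0 = 0) (hm : E.Wm 0 = 0) {z : ℂ}
    (h : E.cr z < z.re) : E.cr z = E.cMax := by
  refine le_antisymm (E.cr_mem hp hm z).2 ?_
  by_contra hcon
  have h1 : z.re < E.cMax := by
    by_contra h2
    refine hcon ?_
    rw [cr, min_eq_right (not_lt.1 h2)]
    exact le_max_right _ _
  rw [cr, min_eq_left h1.le] at h
  exact (le_max_right E.cMin z.re).not_gt h

/-- The extensions reach far enough for the critical points to exist. -/
theorem yp_spec (hp : E.Wp 0 = 0) (hm : E.Wm 0 = 0) {z : ℂ} (hz : 0 ≤ E.cr z) :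
    E.yp z ∈ Icc 0 E.ap ∧ E.Wp (E.yp z) = E.cr z := by
  obtain ⟨κ, Λ, h⟩ := E.exists_halfProfile_right hp hm
  have hap : E.cMax ≤ E.Wp E.ap := by
    have h1 := h.p_mono h.one_mem ⟨zero_le_one.trans h.one_le, le_rfl⟩ h.one_le
    refine max_le h1 ?_
    rcases lt_or_ge (E.Wp 1) (E.Wm (-1)) with h2 | h2
    · exact (E.Wp_ap h2).ge
    · exact h2.trans h1
  have hex : ∃ y ∈ Icc 0 E.ap, E.Wp y = E.cr z :=
    intermediate_value_Icc (zero_le_one.trans h.one_le) h.continuousOn_p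
      ⟨hp.trans_le hz, (E.cr_mem hp hm z).2.trans hap⟩
  rw [yp, if_pos hz]
  exact Function.invFunOn_pos hex

theorem ym_spec (hp : E.Wp 0 = 0) (hm : E.Wm 0 = 0) {z : ℂ} (hz : 0 ≤ E.cr z) :
    E.ym z ∈ Icc E.am 0 ∧ E.Wm (E.ym z) = E.cr z := by
  obtain ⟨κ, Λ, h⟩ := E.exists_halfProfile_left hp hm
  have ham : E.cMax ≤ E.Wm E.am := by
    have h1 := h.p_mono h.one_mem ⟨zero_le_one.trans h.one_le, le_rfl⟩ h.one_le
    rw [neg_neg] at h1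
    refine max_le ?_ h1
    rcases lt_or_ge (E.Wm (-1)) (E.Wp 1) with h2 | h2
    · exact (E.Wm_am h2).ge
    · exact h2.trans h1
  have hex : ∃ y ∈ Icc E.am 0, E.Wm y = E.cr z := by
    obtain ⟨y, hy, hy'⟩ := intermediate_value_Icc (zero_le_one.trans h.one_le) h.continuousOn_p
      (show E.cr z ∈ Icc (E.Wm (-0)) (E.Wm (-(-E.am))) by
        rw [neg_zero, neg_neg, hm]; exact ⟨hz, (E.cr_mem hp hm z).2.trans ham⟩)
    exact ⟨-y, ⟨by linarith [hy.2], by linarith [hy.1]⟩, hy'⟩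
  rw [ym, if_pos hz]
  exact Function.invFunOn_pos hex

theorem critPoint_yp (hp : E.Wp 0 = 0) (hm : E.Wm 0 = 0) {z : ℂ} (hz : 0 ≤ E.cr z) :
    CritPoint E.Wp E.ap z (E.yp z) := by
  obtain ⟨κ, Λ, h⟩ := E.exists_halfProfile_right hp hm
  obtain ⟨h1, h2⟩ := E.yp_spec hp hm hz
  refine CritPoint.of_clamp h h1 h2 (E.cr_le_re hp hm hz) fun hlt => ?_
  rw [E.cr_eq_cMax hp hm hlt]
  exact le_max_left _ _

theorem critPoint_ym (hp : E.Wp 0 = 0) (hm : E.Wm 0 = 0) {z : ℂ} (hz : 0 ≤ E.cr z) :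
    CritPoint (fun y => E.Wm (-y)) (-E.am) z (-E.ym z) := by
  obtain ⟨κ, Λ, h⟩ := E.exists_halfProfile_left hp hm
  obtain ⟨h1, h2⟩ := E.ym_spec hp hm hz
  refine CritPoint.of_clamp h (r := E.cr z) ⟨by linarith [h1.2], by linarith [h1.1]⟩
    (by simpa using h2) (E.cr_le_re hp hm hz) fun hlt => ?_
  rw [E.cr_eq_cMax hp hm hlt]
  exact le_max_right _ _

end Range

/-- The regular solution of the right half, for `c_r ≥ 0`. -/
theorem halfSol_phip (hp : E.Wp 0 = 0) (hm : E.Wm 0 = 0) (α : ℝ) {z : ℂ} (hz : 0 ≤ E.cr z) :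
    HalfSol α E.Wp E.Wm E.ap z (E.yp z) (E.phip α z) := by
  obtain ⟨κ, Λ, h⟩ := E.exists_halfProfile_right hp hm
  have hc := E.critPoint_yp hp hm hz
  exact ⟨hc, Classical.epsilon_spec ((h.sturmKernel hc).exists_isSturmSol α)⟩

theorem neg_span (z : ℂ) :
    Icc (0 : ℝ) (max 1 (-E.ym z)) = Icc (-0) (-min (-1) (E.ym z)) := by
  rw [neg_zero, ← max_neg_neg, neg_neg]

theorem H_neg (z : ℂ) (y : ℝ) :
    profileH (fun y => E.Wm (-y)) (fun y => E.Wp (-y)) z y = E.H z (-y) := mul_comm _ _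

theorem ym_mem_span {z : ℂ} (h : E.ym z ≤ 0) : E.ym z ∈ Icc (min (-1) (E.ym z)) 0 :=
  ⟨min_le_right _ _, h⟩

theorem min_neg_one_lt (z : ℂ) : min (-1) (E.ym z) < 0 :=
  (min_le_left _ _).trans_lt (by norm_num)

theorem isSturmSol_phim (hp : E.Wp 0 = 0) (hm : E.Wm 0 = 0) (α : ℝ) {z : ℂ} (hz : 0 ≤ E.cr z) :
    IsSturmSol α (E.H z) (E.Jm z) (E.ym z) (E.phim α z) := by
  obtain ⟨κ, Λ, h⟩ := E.exists_halfProfile_left hp hm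
  have hc := E.critPoint_ym hp hm hz
  refine Classical.epsilon_spec (p := fun f => IsSturmSol α (E.H z) (E.Jm z) (E.ym z) f) ?_
  obtain ⟨f, hf⟩ := (h.sturmKernel hc).exists_isSturmSol α
  have := hf.comp_neg (by positivity) ⟨hc.mem.1, le_max_right _ _⟩
  rw [← min_neg_neg, neg_neg, neg_zero] at this
  simp only [H_neg, neg_neg] at this
  exact ⟨_, this⟩

/-- The regular solution of the left half, reflected, for `c_r ≥ 0`. -/
theorem halfSol_phim (hp : E.Wp 0 = 0) (hm : E.Wm 0 = 0) (α : ℝ) {z : ℂ} (hz : 0 ≤ E.cr z) :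
    HalfSol α (fun y => E.Wm (-y)) (fun y => E.Wp (-y)) (-E.am) z (-E.ym z)
      (fun y => E.phim α z (-y)) := by
  refine ⟨E.critPoint_ym hp hm hz, ?_⟩
  have := (E.isSturmSol_phim hp hm α hz).comp_neg (E.min_neg_one_lt z)
    (E.ym_mem_span (E.ym_spec hp hm hz).1.2)
  rw [E.neg_span z]
  have e : profileH (fun y => E.Wm (-y)) (fun y => E.Wp (-y)) z = fun y => E.H z (-y) :=
    funext fun y => E.H_neg z y
  rw [e]
  exact this

theorem derivWithin_phim_zero (hp : E.Wp 0 = 0) (hm : E.Wm 0 = 0) (α : ℝ) {z : ℂ}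
    (hz : 0 ≤ E.cr z) : derivWithin (fun y => E.phim α z (-y)) (Icc 0 (max 1 (-E.ym z))) 0
      = -derivWithin (E.phim α z) (E.Jm z) 0 := by
  have hlt := E.min_neg_one_lt z
  rw [E.neg_span z, IsSturmSol.derivWithin_comp_neg_Icc
    (E.isSturmSol_phim hp hm α hz).differentiableOn hlt ⟨by simp, by linarith⟩, neg_zero]
  rfl

theorem Ip_eq_halfI (α : ℝ) (z : ℂ) : E.Ip α z = halfI E.Wp E.Wm z (E.phip α z) := rfl

theorem integral_left_eq {F : Type*} [NormedAddCommGroup F] [NormedSpace ℝ F] (g : ℝ → F) :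
    ∫ y in (-1 : ℝ)..0, g y = ∫ y in (0 : ℝ)..1, g (-y) := by
  rw [intervalIntegral.integral_comp_neg, neg_zero]

theorem Im_eq_halfI (α : ℝ) (z : ℂ) : E.Im α z
    = halfI (fun y => E.Wm (-y)) (fun y => E.Wp (-y)) z (fun y => E.phim α z (-y)) := by
  rw [Im, halfI, integral_left_eq]
  simp only [H_neg]

theorem phip_zero_ne (hp : E.Wp 0 = 0) (hm : E.Wm 0 = 0) (α : ℝ) {z : ℂ} (hz : 0 ≤ E.cr z) :
    E.phip α z 0 ≠ 0 := by
  obtain ⟨κ, Λ, h⟩ := E.exists_halfProfile_right hp hm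
  obtain ⟨C, -, hC⟩ := h.exists_regularBounds α
  exact (hC _ _ _ (E.halfSol_phip hp hm α hz)).ne_zero zero_mem_span

theorem phim_zero_ne (hp : E.Wp 0 = 0) (hm : E.Wm 0 = 0) (α : ℝ) {z : ℂ} (hz : 0 ≤ E.cr z) :
    E.phim α z 0 ≠ 0 := by
  obtain ⟨κ, Λ, h⟩ := E.exists_halfProfile_left hp hm
  obtain ⟨C, -, hC⟩ := h.exists_regularBounds α
  simpa using (hC _ _ _ (E.halfSol_phim hp hm α hz)).ne_zero zero_mem_span

/-- The Wronskian in terms of the reduced quantities of the two halves. -/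
theorem wronskian_eq_neg_reducedWronskian (hp : E.Wp 0 = 0) (hm : E.Wm 0 = 0) (α : ℝ) {z : ℂ}
    (hz : 0 ≤ E.cr z) : E.wronskian α z = -reducedWronskian (halfX E.Wp E.Wm z (E.phip α z))
      (halfX (fun y => E.Wm (-y)) (fun y => E.Wp (-y)) z (fun y => E.phim α z (-y)))
      (halfA z (E.yp z) (E.phip α z)) (halfA z (-E.ym z) (fun y => E.phim α z (-y))) := by
  have h1 := E.phip_zero_ne hp hm α hz
  have h2 := E.phim_zero_ne hp hm α hz
  rw [wronskian, reducedWronskian, halfX, halfX, halfA, halfA, ← Ip_eq_halfI, ← Im_eq_halfI,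
    E.derivWithin_phim_zero hp hm α hz, neg_zero, P, Jp]
  field_simp
  ring

/-- The lower bound on the side `c_r ≥ 0`. -/
theorem exists_lower_bound_of_nonneg (hp : E.Wp 0 = 0) (hm : E.Wm 0 = 0) {α : ℝ} (hα : 1 ≤ |α|) :
    ∃ ε₀ C, 0 < ε₀ ∧ 0 < C ∧ ∀ z : ℂ, ‖z - E.cr z‖ ≤ ε₀ → z ∉ E.D0 → 0 ≤ E.cr z →
      logWeight (z - (E.Wm (-1) : ℂ)) * logWeight ((E.Wp (-1) : ℂ) - z)
        * logWeight (z - (E.Wm 1 : ℂ)) * logWeight ((E.Wp 1 : ℂ) - z)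
        ≤ C * (‖z‖ * ‖E.wronskian α z‖) := by
  obtain ⟨κ₁, Λ₁, h₁⟩ := E.exists_halfProfile_right hp hm
  obtain ⟨κ₂, Λ₂, h₂⟩ := E.exists_halfProfile_left hp hm
  obtain ⟨ε₀, C, hε₀, hC, key⟩ := h₁.exists_lower_bound h₂ hα
  have hq1 := E.Wm_one_neg hp hm
  have hq2 := E.Wp_neg_one_neg hp hm
  -- the weights at the two end points on the other side of the origin are bounded
  set K₁ := Real.log (Real.exp 1 + (-E.Wm 1)⁻¹) with hK₁
  set K₂ := Real.log (Real.exp 1 + (-E.Wp (-1))⁻¹) with hK₂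
  have hfar {z : ℂ} {w : ℝ} (hz : 0 ≤ z.re) (hw : w < 0) : -w ≤ ‖z - w‖ := by
    refine le_trans ?_ (Complex.re_le_norm _)
    simp only [Complex.sub_re, Complex.ofReal_re]; linarith
  have hrev (x y : ℂ) : logWeight (x - y) = logWeight (y - x) := by
    rw [logWeight, logWeight, norm_sub_rev]
  have hKpos {w : ℝ} (hw : w < 0) : 0 < Real.log (Real.exp 1 + (-w)⁻¹) := by
    refine Real.log_pos ?_
    have := Real.add_one_lt_exp one_ne_zero
    have : 0 < (-w)⁻¹ := inv_pos.2 (neg_pos.2 hw)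
    linarith
  refine ⟨ε₀, K₂ * K₁ * C, hε₀, mul_pos (mul_pos (hKpos hq2) (hKpos hq1)) hC,
    fun z hzε hz0 hz => ?_⟩
  have hre := E.cr_le_re hp hm hz
  have hoff : z.im ≠ 0 ∨ max (E.Wp 1) (E.Wm (-1)) < z.re := by
    by_contra hcon
    push Not at hcon
    refine hz0 ⟨z.re, ⟨?_, hcon.2⟩, Complex.ext rfl (by simpa using hcon.1)⟩
    exact ((E.cMin_neg hp hm).le.trans hz).trans hre
  have hce : z.re ≤ max (E.Wp 1) (E.Wm (-1)) + ε₀ := by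
    have h1 := (Complex.re_le_norm (z - E.cr z)).trans hzε
    have h2 : E.cr z ≤ max (E.Wp 1) (E.Wm (-1)) := (E.cr_mem hp hm z).2
    simp only [Complex.sub_re, Complex.ofReal_re] at h1
    linarith
  have hmain := key z _ _ _ _ (E.halfSol_phip hp hm α hz) (E.halfSol_phim hp hm α hz)
    (by rw [(E.yp_spec hp hm hz).2]; exact hzε)
    (by simp only [neg_neg]; rw [(E.ym_spec hp hm hz).2]; exact hzε) hoff hce
  rw [← norm_neg (reducedWronskian _ _ _ _), ← E.wronskian_eq_neg_reducedWronskian hp hm α hz]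
    at hmain
  have w1 : logWeight (z - (E.Wm 1 : ℂ)) ≤ K₁ :=
    logWeight_le_of_le (neg_pos.2 hq1) (hfar (hz.trans hre) hq1)
  have w2 : logWeight ((E.Wp (-1) : ℂ) - z) ≤ K₂ := by
    rw [hrev]; exact logWeight_le_of_le (neg_pos.2 hq2) (hfar (hz.trans hre) hq2)
  have l0 (x : ℂ) : 0 ≤ logWeight x := zero_le_one.trans (one_le_logWeight x)
  rw [hrev (E.Wp 1 : ℂ) z]
  calc _ = logWeight ((E.Wp (-1) : ℂ) - z) * logWeight (z - (E.Wm 1 : ℂ))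
        * (logWeight (z - (E.Wp 1 : ℂ)) * logWeight (z - (E.Wm (-1) : ℂ))) := by ring
    _ ≤ K₂ * K₁ * (C * (‖z‖ * ‖E.wronskian α z‖)) := by
        refine mul_le_mul (mul_le_mul w2 w1 (l0 _) ((l0 _).trans w2)) hmain
          (mul_nonneg (l0 _) (l0 _)) (mul_nonneg ((l0 _).trans w2) ((l0 _).trans w1))
    _ = _ := by ring

end WExtension

/-! ### Boundary values on the segment -/

namespace WExtension

variable {u b : ℝ → ℝ} (E : WExtension u b)

theorem cr_add_mul_I (c ε : ℝ) : E.cr (c + ε * Complex.I) = E.cr c := by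
  simp [cr]

theorem yp_add_mul_I (c ε : ℝ) : E.yp (c + ε * Complex.I) = E.yp c := by
  rw [yp, yp, cr_add_mul_I]

theorem ym_add_mul_I (c ε : ℝ) : E.ym (c + ε * Complex.I) = E.ym c := by
  rw [ym, ym, cr_add_mul_I]

theorem half_log_sq_div {x y : ℝ} (hx : x ≠ 0) (hy : y ≠ 0) :
    1 / 2 * Real.log ((x / y) ^ 2) = Real.log |x| - Real.log |y| := by
  rw [Real.log_pow, Real.log_div hx hy, Real.log_abs, Real.log_abs]
  push_cast; ring

theorem halfSigma_right (c : ℝ) :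
    halfSigma E.Wp E.Wm E.dWp E.dWm c (E.yp c) = E.sigmap c := rfl

theorem halfSigma_left (c : ℝ) :
    halfSigma (fun y => E.Wm (-y)) (fun y => E.Wp (-y)) (fun y => -E.dWm (-y))
      (fun y => -E.dWp (-y)) c (-E.ym c) = E.sigmam c := by
  simp only [halfSigma, sigmam, neg_neg]
  push_cast; ring

/-- `halfIre` of the right half is `I₊ʳᵉ`. -/
theorem halfIre_right (α : ℝ) {c : ℝ} (h1 : E.Wp 1 - c ≠ 0) (h2 : c - E.Wm 1 ≠ 0) :
    halfIre E.Wp E.Wm E.dWp E.dWm c (E.yp c) (E.phip α c) = E.Ipre α c := by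
  have e1 : ∫ y in (0 : ℝ)..1, r1Integrand E.Wp E.Wm E.dWp E.dWm c (E.yp c) y = (E.Rp1 c : ℝ) := by
    rw [Rp1, ← intervalIntegral.integral_ofReal]
    refine intervalIntegral.integral_congr fun y _ => ?_
    simp only [r1Integrand, profileH]
    push_cast; rfl
  have e2 : ∫ y in (0 : ℝ)..1, r2Integrand E.Wp E.Wm E.dWp E.dWm c (E.yp c) y = (E.Rp2 c : ℝ) := by
    rw [Rp2, ← intervalIntegral.integral_ofReal]
    refine intervalIntegral.integral_congr fun y _ => ?_
    simp only [r2Integrand]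
    push_cast; rfl
  rw [halfIre, Ipre, e1, e2, halfSigma_right, half_log_sq_div h1 h2, abs_sub_comm (E.Wp 1)]
  push_cast
  rfl

/-- `halfIre` of the reflected left half is `I₋ʳᵉ`. -/
theorem halfIre_left (α : ℝ) {c : ℝ} (h1 : E.Wm (-1) - c ≠ 0) (h2 : c - E.Wp (-1) ≠ 0) :
    halfIre (fun y => E.Wm (-y)) (fun y => E.Wp (-y)) (fun y => -E.dWm (-y))
      (fun y => -E.dWp (-y)) c (-E.ym c) (fun y => E.phim α c (-y)) = E.Imre α c := by
  have e0 : ∫ y in (0 : ℝ)..1, piIntegrand (fun y => E.Wm (-y)) (fun y => E.Wp (-y)) c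
      (fun y => E.phim α c (-y)) y = E.Pim α c := by
    rw [Pim, integral_left_eq]
    simp only [piIntegrand, H_neg]
  have e1 : ∫ y in (0 : ℝ)..1, r1Integrand (fun y => E.Wm (-y)) (fun y => E.Wp (-y))
      (fun y => -E.dWm (-y)) (fun y => -E.dWp (-y)) c (-E.ym c) y = (E.Rm1 c : ℝ) := by
    rw [Rm1, integral_left_eq, ← intervalIntegral.integral_ofReal]
    refine intervalIntegral.integral_congr fun y _ => ?_
    simp only [r1Integrand, profileH, neg_neg]
    push_cast
    congr 1
    · ring
    · ring
  have e2 : ∫ y in (0 : ℝ)..1, r2Integrand (fun y => E.Wm (-y)) (fun y => E.Wp (-y))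
      (fun y => -E.dWm (-y)) (fun y => -E.dWp (-y)) c (-E.ym c) y = (E.Rm2 c : ℝ) := by
    rw [Rm2, integral_left_eq, ← intervalIntegral.integral_ofReal]
    refine intervalIntegral.integral_congr fun y _ => ?_
    simp only [r2Integrand, neg_neg]
    push_cast
    ring
  rw [halfIre, Imre, e0, e1, e2, halfSigma_left, half_log_sq_div h1 h2, abs_sub_comm (E.Wm (-1))]
  push_cast
  rfl

/-- Boundary values of `𝓓`, real and imaginary parts, on the side `c > 0` of the segment. -/
theorem boundary_of_pos (hp : E.Wp 0 = 0) (hm : E.Wm 0 = 0) (α : ℝ) {c : ℝ} (hc : 0 < c)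
    (hcM : c ≤ E.cMax) (h1 : c ≠ E.Wp 1) (h2 : c ≠ E.Wm (-1)) :
    Tendsto (fun ε : ℝ => E.wronskian α ((c : ℂ) + (ε : ℂ) * Complex.I)) (𝓝[>] 0)
        (𝓝 (E.Dre α c + Complex.I * E.Dim α c)) ∧
      Tendsto (fun ε : ℝ => E.wronskian α ((c : ℂ) + (ε : ℂ) * Complex.I)) (𝓝[<] 0)
        (𝓝 (E.Dre α c - Complex.I * E.Dim α c)) ∧
      (E.Dre α c).im = 0 ∧ (E.Dim α c).im = 0 := by
  obtain ⟨κ₁, Λ₁, k₁⟩ := E.exists_halfProfile_right hp hm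
  obtain ⟨κ₂, Λ₂, k₂⟩ := E.exists_halfProfile_left hp hm
  have hcr : E.cr c = c :=
    E.cr_eq_of_mem (z := c) ⟨((E.cMin_neg hp hm).trans hc).le, hcM⟩
  have hz0 : 0 ≤ E.cr c := hcr.symm ▸ hc.le
  have hz : ∀ ε : ℝ, 0 ≤ E.cr (c + ε * Complex.I) := fun ε => by rwa [E.cr_add_mul_I]
  have f₁ := E.halfSol_phip hp hm α hz0
  have f₂ := E.halfSol_phim hp hm α hz0
  have F₁ : ∀ ε : ℝ, HalfSol α E.Wp E.Wm E.ap (c + ε * Complex.I) (E.yp c)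
      (E.phip α (c + ε * Complex.I)) := fun ε => by
    have := E.halfSol_phip hp hm α (hz ε)
    rwa [E.yp_add_mul_I] at this
  have F₂ : ∀ ε : ℝ, HalfSol α (fun y => E.Wm (-y)) (fun y => E.Wp (-y)) (-E.am)
      (c + ε * Complex.I) (-E.ym c) (fun y => E.phim α (c + ε * Complex.I) (-y)) := fun ε => by
    have := E.halfSol_phim hp hm α (hz ε)
    rwa [E.ym_add_mul_I] at this
  have g₁ : E.Wp (E.yp c) = c := (E.yp_spec hp hm hz0).2.trans hcr
  have g₂ : E.Wm (-(-E.ym c)) = c := by rw [neg_neg]; exact (E.ym_spec hp hm hz0).2.trans hcr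
  have n₁ : c - E.Wm 1 ≠ 0 := by linarith [E.Wm_one_neg hp hm]
  have n₂ : c - E.Wp (-1) ≠ 0 := by linarith [E.Wp_neg_one_neg hp hm]
  have r₁ := E.halfIre_right α (sub_ne_zero.2 h1.symm) n₁
  have r₂ := E.halfIre_left α (sub_ne_zero.2 h2.symm) n₂
  have s₁ := k₁.sigma_ne_zero hc f₁.crit g₁
  have s₂ := k₂.sigma_ne_zero hc f₂.crit g₂
  rw [halfSigma_right] at s₁
  rw [halfSigma_left] at s₂
  have x₁ : E.chip c = if c - E.Wp 1 < 0 then 1 else 0 := by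
    rw [chip]
    have : c ∈ Ioo (E.Wm 1) (E.Wp 1) ↔ c - E.Wp 1 < 0 :=
      ⟨fun h => sub_neg.2 h.2, fun h => ⟨(E.Wm_one_neg hp hm).trans hc, sub_neg.1 h⟩⟩
    simp only [this]
  have x₂ : E.chim c = if c - E.Wm (-1) < 0 then 1 else 0 := by
    rw [chim]
    have : c ∈ Ioo (E.Wp (-1)) (E.Wm (-1)) ↔ c - E.Wm (-1) < 0 :=
      ⟨fun h => sub_neg.2 h.2, fun h => ⟨(E.Wp_neg_one_neg hp hm).trans hc, sub_neg.1 h⟩⟩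
    simp only [this]
  -- the limit along a filter on which both logarithms have boundary values; `s = 1` from above and
  -- `s = -1` from below
  have main (l : Filter ℝ) [l.IsCountablyGenerated] (hl : l ≤ 𝓝[≠] 0) (s : ℂ) (hs : s ^ 2 = 1)
      (t₁ : Tendsto (fun ε : ℝ => Complex.log ((c - E.Wp 1 : ℝ) + ε * Complex.I)) l
        (𝓝 (Real.log |c - E.Wp 1| + s * (Complex.I * (Real.pi * E.chip c)))))
      (t₂ : Tendsto (fun ε : ℝ => Complex.log ((c - E.Wm (-1) : ℝ) + ε * Complex.I)) l
        (𝓝 (Real.log |c - E.Wm (-1)| + s * (Complex.I * (Real.pi * E.chim c))))) :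
      Tendsto (fun ε : ℝ => E.wronskian α ((c : ℂ) + (ε : ℂ) * Complex.I)) l
        (𝓝 (E.Dre α c + s * (Complex.I * E.Dim α c))) := by
    have I₁ := k₁.tendsto_halfI hl hc g₁ F₁ f₁ t₁
    have I₂ := k₂.tendsto_halfI hl hc g₂ F₂ f₂ t₂
    rw [r₁, halfSigma_right] at I₁
    rw [r₂, halfSigma_left] at I₂
    simp only [← Im_eq_halfI] at I₂
    simp only [← Ip_eq_halfI] at I₁
    obtain ⟨v₁, d₁⟩ := k₁.tendsto_halfSol hl F₁ f₁ zero_mem_span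
    obtain ⟨v₂, d₂⟩ := k₂.tendsto_halfSol hl F₂ f₂ zero_mem_span
    have d₂' : Tendsto (fun ε : ℝ => derivWithin (E.phim α (c + ε * Complex.I))
        (E.Jm (c + ε * Complex.I)) 0) l (𝓝 (derivWithin (E.phim α c) (E.Jm c) 0)) := by
      have := d₂.neg
      rw [E.derivWithin_phim_zero hp hm α hz0, neg_neg] at this
      refine this.congr fun ε => ?_
      have h3 := E.derivWithin_phim_zero hp hm α (hz ε)
      rw [E.ym_add_mul_I] at h3
      rw [h3, neg_neg]
    have d₁' : Tendsto (fun ε : ℝ => derivWithin (E.phip α (c + ε * Complex.I))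
        (E.Jp (c + ε * Complex.I)) 0) l (𝓝 (derivWithin (E.phip α c) (E.Jp c) 0)) := by
      refine d₁.congr fun ε => ?_
      rw [Jp, E.yp_add_mul_I]
    simp only [neg_zero] at v₂
    have hct : Tendsto (fun ε : ℝ => (c : ℂ) + ε * Complex.I) l (𝓝 c) := by
      have : Continuous fun ε : ℝ => (c : ℂ) + ε * Complex.I := by fun_prop
      simpa using (this.tendsto 0).mono_left (hl.trans nhdsWithin_le_nhds)
    have hP : Tendsto (fun ε : ℝ => E.P α (c + ε * Complex.I)) l (𝓝 (E.P α c)) :=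
      ((v₂.pow 2).mul (v₁.mul d₁')).sub ((v₁.pow 2).mul (v₂.mul d₂'))
    have hD := (((((hct.pow 2).mul hP).mul I₁).mul I₂).sub ((v₁.pow 2).mul I₁)).sub
      ((v₂.pow 2).mul I₂)
    have e : E.Dre α c + s * (Complex.I * E.Dim α c)
        = (c : ℂ) ^ 2 * E.P α c
            * (E.Ipre α c + s * (Complex.I * (Real.pi * E.chip c)) / E.sigmap c)
            * (E.Imre α c + s * (Complex.I * (Real.pi * E.chim c)) / E.sigmam c)
          - E.phip α c 0 ^ 2
            * (E.Ipre α c + s * (Complex.I * (Real.pi * E.chip c)) / E.sigmap c)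
          - E.phim α c 0 ^ 2
            * (E.Imre α c + s * (Complex.I * (Real.pi * E.chim c)) / E.sigmam c) := by
      rw [Dre, Dim]
      field_simp
      linear_combination (-(c : ℂ) ^ 2 * E.P α c * (Real.pi : ℂ) ^ 2 * E.chip c * E.chim c)
        * (Complex.I ^ 2 * hs + Complex.I_sq)
    rw [e]
    exact hD
  refine ⟨?_, ?_, ?_⟩
  · have := main (𝓝[>] 0) (nhdsWithin_mono _ fun x hx => ne_of_gt hx) 1 (by norm_num)
      (by rw [one_mul, x₁]; exact tendsto_log_add_mul_I_right (sub_ne_zero.2 h1))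
      (by rw [one_mul, x₂]; exact tendsto_log_add_mul_I_right (sub_ne_zero.2 h2))
    rwa [one_mul] at this
  · have := main (𝓝[<] 0) (nhdsWithin_mono _ fun x hx => ne_of_lt hx) (-1) (by norm_num)
      (by rw [neg_one_mul, ← sub_eq_add_neg, x₁]
          exact tendsto_log_add_mul_I_left (sub_ne_zero.2 h1))
      (by rw [neg_one_mul, ← sub_eq_add_neg, x₂]
          exact tendsto_log_add_mul_I_left (sub_ne_zero.2 h2))
    rwa [neg_one_mul, ← sub_eq_add_neg] at this
  · have real {w : ℂ} (hw : w.im = 0) : ∃ r : ℝ, w = r := ⟨w.re, Complex.ext rfl (by simpa using hw)⟩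
    obtain ⟨i₁, hi₁⟩ := real (r₁ ▸ k₁.halfIre_im_eq_zero hc f₁)
    obtain ⟨i₂, hi₂⟩ := real (r₂ ▸ k₂.halfIre_im_eq_zero hc f₂)
    obtain ⟨a₁, ha₁⟩ := real (k₁.im_eq_zero hc f₁ zero_mem_span)
    obtain ⟨a₂, ha₂⟩ := real (k₂.im_eq_zero hc f₂ zero_mem_span)
    obtain ⟨b₁, hb₁⟩ := real (k₁.derivWithin_im_eq_zero hc f₁ zero_mem_span)
    obtain ⟨b₂, hb₂⟩ := real (k₂.derivWithin_im_eq_zero hc f₂ zero_mem_span)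
    rw [E.derivWithin_phim_zero hp hm α hz0, neg_eq_iff_eq_neg] at hb₂
    rw [neg_zero] at ha₂
    obtain ⟨y₁, hy₁⟩ : ∃ r : ℝ, E.chip c = r := ⟨if c - E.Wp 1 < 0 then 1 else 0, by
      rw [x₁]; split_ifs <;> simp⟩
    obtain ⟨y₂, hy₂⟩ : ∃ r : ℝ, E.chim c = r := ⟨if c - E.Wm (-1) < 0 then 1 else 0, by
      rw [x₂]; split_ifs <;> simp⟩
    obtain ⟨z₁, hz₁⟩ : ∃ r : ℝ, E.sigmap c = r := ⟨_, by rw [sigmap]; norm_cast⟩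
    obtain ⟨z₂, hz₂⟩ : ∃ r : ℝ, E.sigmam c = r := ⟨_, by rw [sigmam]; norm_cast⟩
    obtain ⟨P, hP⟩ : ∃ r : ℝ, E.P α c = r :=
      ⟨a₂ ^ 2 * (a₁ * b₁) - a₁ ^ 2 * (a₂ * -b₂), by
        rw [P, ha₁, ha₂, hb₂, Jp, hb₁]; push_cast; ring⟩
    rw [Dre, Dim, hi₁, hi₂, ha₁, ha₂, hy₁, hy₂, hz₁, hz₂, hP]
    constructor <;> norm_cast

end WExtension

/-! ### The symmetry `(u, c) ↦ (-u, -c)` -/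

/-- The critical points are values of `Function.invFunOn`, so they agree exactly after the change of sign:
the predicates that the choice is made from are equal. -/
theorem invFunOn_neg_apply (f : ℝ → ℝ) (s : Set ℝ) (r : ℝ) :
    Function.invFunOn (fun y => -f y) s (-r) = Function.invFunOn f s r := by
  classical
  have key : ∀ q q' : ℝ → Prop, q = q' →
      (if h : ∃ a, q a then Classical.choose h else Classical.choice ⟨(0 : ℝ)⟩)
        = if h : ∃ a, q' a then Classical.choose h else Classical.choice ⟨(0 : ℝ)⟩ := by
    rintro q _ rfl; rfl
  unfold Function.invFunOn
  convert key _ _ (funext fun a => propext (and_congr_right fun _ => neg_inj)) using 1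

namespace WExtension

variable {u b : ℝ → ℝ}

/-- The extension `(-W₋, -W₊)` that belongs to `(-u, b)`. -/
def negate (E : WExtension u b) : WExtension (fun y => -u y) b where
  am := E.am
  ap := E.ap
  Wp := fun y => -E.Wm y
  Wm := fun y => -E.Wp y
  am_le := E.am_le
  le_ap := E.le_ap
  contDiffOn_Wp := E.contDiffOn_Wm.neg
  contDiffOn_Wm := E.contDiffOn_Wp.neg
  Wp_eq y hy := by rw [E.Wm_eq y hy]; ring
  Wm_eq y hy := by rw [E.Wp_eq y hy]; ring
  deriv_Wp_pos y hy := by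
    rw [derivWithin.fun_neg]; exact neg_pos.2 (E.deriv_Wm_neg y hy)
  deriv_Wm_neg y hy := by
    rw [derivWithin.fun_neg]; exact neg_neg_iff_pos.2 (E.deriv_Wp_pos y hy)
  Wp_ap h := by rw [E.Wm_ap (neg_lt_neg_iff.1 h)]
  Wm_ap h := by rw [E.Wp_ap (neg_lt_neg_iff.1 h)]
  ap_eq h h' := E.ap_eq (neg_le_neg_iff.1 h') (neg_le_neg_iff.1 h)
  Wm_am h := by rw [E.Wp_am (neg_lt_neg_iff.1 h)]
  Wp_am h := by rw [E.Wm_am (neg_lt_neg_iff.1 h)]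
  am_eq h h' := E.am_eq (neg_le_neg_iff.1 h') (neg_le_neg_iff.1 h)

variable (E : WExtension u b)

theorem dWp_negate (y : ℝ) : E.negate.dWp y = -E.dWm y := derivWithin.fun_neg

theorem dWm_negate (y : ℝ) : E.negate.dWm y = -E.dWp y := derivWithin.fun_neg

theorem cMin_negate : E.negate.cMin = -E.cMax := by
  rw [cMin, cMax, max_comm, ← min_neg_neg]; exact min_comm _ _

theorem cMax_negate : E.negate.cMax = -E.cMin := by
  rw [cMin, cMax, min_comm, ← max_neg_neg]; exact max_comm _ _

theorem cr_negate (h : E.cMin ≤ E.cMax) (z : ℂ) : E.negate.cr (-z) = -E.cr z := by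
  rw [cr, cr, cMin_negate, cMax_negate, Complex.neg_re, min_neg_neg, max_neg_neg,
    min_max_distrib_left, min_eq_right h, min_comm E.cMax, max_comm]

theorem mem_D0_negate {z : ℂ} : -z ∈ E.negate.D0 ↔ z ∈ E.D0 := by
  simp only [D0, mem_ofPred_eq, cMin_negate, cMax_negate]
  constructor
  · rintro ⟨c, hc, h⟩
    exact ⟨-c, ⟨by linarith [hc.2], by linarith [hc.1]⟩, by rw [← neg_neg z, h]; push_cast; rfl⟩
  · rintro ⟨c, hc, h⟩
    exact ⟨-c, ⟨by linarith [hc.2], by linarith [hc.1]⟩, by rw [h]; push_cast; rfl⟩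

theorem H_negate (z : ℂ) : E.negate.H (-z) = E.H z := by
  funext y
  simp only [H, negate]
  push_cast; ring

variable {z : ℂ}

theorem yp_negate (h : E.cMin ≤ E.cMax) (hz : E.cr z < 0) : E.negate.yp (-z) = E.yp z := by
  rw [yp, yp, E.cr_negate h, if_pos (by linarith), if_neg (by linarith)]
  exact invFunOn_neg_apply _ _ _

theorem ym_negate (h : E.cMin ≤ E.cMax) (hz : E.cr z < 0) : E.negate.ym (-z) = E.ym z := by
  rw [ym, ym, E.cr_negate h, if_pos (by linarith), if_neg (by linarith)]
  exact invFunOn_neg_apply _ _ _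

theorem phip_negate (α : ℝ) (h : E.cMin ≤ E.cMax) (hz : E.cr z < 0) :
    E.negate.phip α (-z) = E.phip α z := by
  rw [phip, phip, Jp, Jp, E.yp_negate h hz, E.H_negate]

theorem phim_negate (α : ℝ) (h : E.cMin ≤ E.cMax) (hz : E.cr z < 0) :
    E.negate.phim α (-z) = E.phim α z := by
  rw [phim, phim, Jm, Jm, E.ym_negate h hz, E.H_negate]

theorem P_negate (α : ℝ) (h : E.cMin ≤ E.cMax) (hz : E.cr z < 0) :
    E.negate.P α (-z) = E.P α z := by
  rw [P, P, Jm, Jm, Jp, Jp, E.ym_negate h hz, E.yp_negate h hz, E.phip_negate α h hz,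
    E.phim_negate α h hz]

theorem wronskian_negate (α : ℝ) (h : E.cMin ≤ E.cMax) (hz : E.cr z < 0) :
    E.negate.wronskian α (-z) = E.wronskian α z := by
  rw [wronskian, wronskian, Ip, Ip, Im, Im, E.P_negate α h hz, E.phip_negate α h hz,
    E.phim_negate α h hz, E.H_negate, neg_sq]

theorem sigmap_negate (h : E.cMin ≤ E.cMax) (hz : E.cr z < 0) :
    E.negate.sigmap (-z) = -E.sigmap z := by
  rw [sigmap, sigmap, E.yp_negate h hz, dWp_negate, dWm_negate]
  simp only [negate]
  push_cast; ring

theorem sigmam_negate (h : E.cMin ≤ E.cMax) (hz : E.cr z < 0) :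
    E.negate.sigmam (-z) = -E.sigmam z := by
  rw [sigmam, sigmam, E.ym_negate h hz, dWp_negate, dWm_negate]
  simp only [negate]
  push_cast; ring

variable {c : ℝ}

theorem log_sq_div_neg (x y c : ℝ) :
    Real.log (((-x - -c) / (-c - -y)) ^ 2) = -Real.log (((y - c) / (c - x)) ^ 2) := by
  rw [← Real.log_inv, ← inv_pow, inv_div]
  congr 2
  rw [show -x - -c = c - x by ring, show -c - -y = y - c by ring]

theorem Ipre_negate (α : ℝ) (h : E.cMin ≤ E.cMax) (hz : E.cr c < 0) :
    E.negate.Ipre α (-c) = E.Ipre α c := by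
  have hy := E.yp_negate h hz
  have e1 : E.negate.Rp1 (-c) = -E.Rp1 c := by
    rw [Rp1, Rp1, ← intervalIntegral.integral_neg]
    refine intervalIntegral.integral_congr fun y _ => ?_
    push_cast
    rw [hy]
    simp only [dWp_negate, dWm_negate]
    simp only [negate]
    rw [show (-E.Wm y - -c) * (-E.Wp y - -c) = (E.Wp y - c) * (E.Wm y - c) by ring, ← neg_div]
    congr 1; ring
  have e2 : E.negate.Rp2 (-c) = -E.Rp2 c := by
    rw [Rp2, Rp2, ← intervalIntegral.integral_neg]
    refine intervalIntegral.integral_congr fun y _ => ?_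
    push_cast
    rw [hy]
    simp only [dWp_negate, dWm_negate]
    simp only [negate]
    rw [show -E.Wm y - -c = -(E.Wm y - c) by ring, show -E.Wp y - -c = -(E.Wp y - c) by ring,
      ← neg_sub', ← neg_sub', neg_div_neg_eq, neg_div_neg_eq]
    ring
  have e3 : E.negate.Pip α ((-c : ℝ) : ℂ) = E.Pip α c := by
    rw [Complex.ofReal_neg, Pip, Pip, E.phip_negate α h hz, E.H_negate]
  have e4 : E.negate.sigmap ((-c : ℝ) : ℂ) = -E.sigmap c := by
    rw [Complex.ofReal_neg, E.sigmap_negate h hz]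
  have e5 : Real.log (((E.negate.Wp 1 - -c) / (-c - E.negate.Wm 1)) ^ 2)
      = -Real.log (((E.Wp 1 - c) / (c - E.Wm 1)) ^ 2) := log_sq_div_neg _ _ _
  rw [Ipre, Ipre, e1, e2, e3, e4, e5]
  push_cast
  ring

theorem Imre_negate (α : ℝ) (h : E.cMin ≤ E.cMax) (hz : E.cr c < 0) :
    E.negate.Imre α (-c) = E.Imre α c := by
  have hy := E.ym_negate h hz
  have e1 : E.negate.Rm1 (-c) = -E.Rm1 c := by
    rw [Rm1, Rm1, ← intervalIntegral.integral_neg]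
    refine intervalIntegral.integral_congr fun y _ => ?_
    push_cast
    rw [hy]
    simp only [dWp_negate, dWm_negate]
    simp only [negate]
    rw [show (-E.Wm y - -c) * (-E.Wp y - -c) = (E.Wp y - c) * (E.Wm y - c) by ring, ← neg_div]
    congr 1; ring
  have e2 : E.negate.Rm2 (-c) = -E.Rm2 c := by
    rw [Rm2, Rm2, ← intervalIntegral.integral_neg]
    refine intervalIntegral.integral_congr fun y _ => ?_
    push_cast
    rw [hy]
    simp only [dWp_negate, dWm_negate]
    simp only [negate]
    rw [show -E.Wm y - -c = -(E.Wm y - c) by ring, show -E.Wp y - -c = -(E.Wp y - c) by ring,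
      ← neg_sub', ← neg_sub', neg_div_neg_eq, neg_div_neg_eq]
    ring
  have e3 : E.negate.Pim α ((-c : ℝ) : ℂ) = E.Pim α c := by
    rw [Complex.ofReal_neg, Pim, Pim, E.phim_negate α h hz, E.H_negate]
  have e4 : E.negate.sigmam ((-c : ℝ) : ℂ) = -E.sigmam c := by
    rw [Complex.ofReal_neg, E.sigmam_negate h hz]
  have e5 : Real.log (((E.negate.Wm (-1) - -c) / (-c - E.negate.Wp (-1))) ^ 2)
      = -Real.log (((E.Wm (-1) - c) / (c - E.Wp (-1))) ^ 2) := log_sq_div_neg _ _ _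
  rw [Imre, Imre, e1, e2, e3, e4, e5]
  push_cast
  ring

theorem chip_negate (c : ℝ) : E.negate.chip (-c) = E.chip c := by
  have : -c ∈ Ioo (E.negate.Wm 1) (E.negate.Wp 1) ↔ c ∈ Ioo (E.Wm 1) (E.Wp 1) :=
    ⟨fun h => ⟨neg_lt_neg_iff.1 h.2, neg_lt_neg_iff.1 h.1⟩,
      fun h => ⟨neg_lt_neg h.2, neg_lt_neg h.1⟩⟩
  simp only [chip, this]

theorem chim_negate (c : ℝ) : E.negate.chim (-c) = E.chim c := by
  have : -c ∈ Ioo (E.negate.Wp (-1)) (E.negate.Wm (-1)) ↔ c ∈ Ioo (E.Wp (-1)) (E.Wm (-1)) :=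
    ⟨fun h => ⟨neg_lt_neg_iff.1 h.2, neg_lt_neg_iff.1 h.1⟩,
      fun h => ⟨neg_lt_neg h.2, neg_lt_neg h.1⟩⟩
  simp only [chim, this]

theorem Dre_negate (α : ℝ) (h : E.cMin ≤ E.cMax) (hz : E.cr c < 0) :
    E.negate.Dre α (-c) = E.Dre α c := by
  rw [Dre, Dre, E.Ipre_negate α h hz, E.Imre_negate α h hz, chip_negate, chim_negate,
    Complex.ofReal_neg, E.P_negate α h hz, E.sigmap_negate h hz, E.sigmam_negate h hz,
    E.phip_negate α h hz, E.phim_negate α h hz, neg_mul_neg, neg_sq]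

theorem Dim_negate (α : ℝ) (h : E.cMin ≤ E.cMax) (hz : E.cr c < 0) :
    E.negate.Dim α (-c) = -E.Dim α c := by
  rw [Dim, Dim, E.Ipre_negate α h hz, E.Imre_negate α h hz, chip_negate, chim_negate,
    Complex.ofReal_neg, E.P_negate α h hz, E.sigmap_negate h hz, E.sigmam_negate h hz,
    E.phip_negate α h hz, E.phim_negate α h hz]
  ring

end WExtension

/-! ### Points of `Ω` and the final estimate -/

namespace WExtension

variable {u b : ℝ → ℝ} (E : WExtension u b)

theorem norm_mul_exp_mul_I {ε θ : ℝ} (hε : 0 < ε) :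
    ‖(ε : ℂ) * Complex.exp ((θ : ℂ) * Complex.I)‖ = ε := by
  rw [norm_mul, Complex.norm_exp_ofReal_mul_I, mul_one, Complex.norm_real, Real.norm_of_nonneg hε.le]

theorem re_mul_exp_mul_I_nonpos {ε θ : ℝ} (hε : 0 < ε) (h1 : Real.pi / 2 ≤ θ)
    (h2 : θ ≤ 3 * Real.pi / 2) : ((ε : ℂ) * Complex.exp ((θ : ℂ) * Complex.I)).re ≤ 0 := by
  rw [Complex.re_ofReal_mul, Complex.exp_ofReal_mul_I_re]
  exact mul_nonpos_of_nonneg_of_nonpos hε.le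
    (Real.cos_nonpos_of_pi_div_two_le_of_le h1 (by linarith))

/-- In `Ω`, including the half discs, `c_r` is within `ε₀` of `c`. -/
theorem norm_sub_cr_le (h : E.cMin ≤ E.cMax) {ε₀ : ℝ} (hε₀ : 0 < ε₀) {z : ℂ}
    (hz : z ∈ E.Omega ε₀) : ‖z - E.cr z‖ ≤ ε₀ := by
  rcases hz with ((⟨c, hc, rfl⟩ | ⟨c, hc, ε, -, hε, rfl⟩) | ⟨ε, θ, hε, hε', h1, h2, rfl⟩) |
    ⟨ε, θ, hε, hε', h1, h2, rfl⟩
  · rw [E.cr_eq_of_mem (z := c) hc, Complex.ofReal_re, sub_self, norm_zero]; exact hε₀.le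
  · rw [E.cr_add_mul_I, E.cr_eq_of_mem (z := c) hc, Complex.ofReal_re, add_sub_cancel_left, norm_mul,
      Complex.norm_I, mul_one, Complex.norm_real, Real.norm_eq_abs]
    exact hε.le
  · have hre := re_mul_exp_mul_I_nonpos hε h1 h2
    have : E.cr ((E.cMin : ℂ) + (ε : ℂ) * Complex.exp ((θ : ℂ) * Complex.I)) = E.cMin := by
      rw [cr]
      refine max_eq_left ((min_le_left _ _).trans ?_)
      rw [Complex.add_re, Complex.ofReal_re]; linarith
    rw [this, add_sub_cancel_left, norm_mul_exp_mul_I hε]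
    exact hε'.le
  · have hre := re_mul_exp_mul_I_nonpos hε h1 h2
    have : E.cr ((E.cMax : ℂ) - (ε : ℂ) * Complex.exp ((θ : ℂ) * Complex.I)) = E.cMax := by
      rw [cr, min_eq_right, max_eq_right h]
      rw [Complex.sub_re, Complex.ofReal_re]; linarith
    rw [this, sub_sub_cancel_left, norm_neg, norm_mul_exp_mul_I hε]
    exact hε'.le

/-- The weighted lower bound for the Wronskian off the segment. -/
theorem exists_lower_bound (hp : E.Wp 0 = 0) (hm : E.Wm 0 = 0) {α : ℝ} (hα : 1 ≤ |α|) :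
    ∃ ε₀ C, 0 < ε₀ ∧ 0 < C ∧ ∀ z : ℂ, ‖z - E.cr z‖ ≤ ε₀ → z ∉ E.D0 →
      logWeight (z - (E.Wm (-1) : ℂ)) * logWeight ((E.Wp (-1) : ℂ) - z)
        * logWeight (z - (E.Wm 1 : ℂ)) * logWeight ((E.Wp 1 : ℂ) - z)
        ≤ C * (‖z‖ * ‖E.wronskian α z‖) := by
  have hle := E.cMin_le_cMax hp hm
  obtain ⟨ε₁, C₁, hε₁, hC₁, B₁⟩ := E.exists_lower_bound_of_nonneg hp hm hα
  obtain ⟨ε₂, C₂, hε₂, hC₂, B₂⟩ := E.negate.exists_lower_bound_of_nonneg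
    (by simp [negate, hm]) (by simp [negate, hp]) hα
  refine ⟨min ε₁ ε₂, max C₁ C₂, lt_min hε₁ hε₂, lt_max_of_lt_left hC₁, fun z hz hz0 => ?_⟩
  rcases le_or_gt 0 (E.cr z) with h | h
  · refine (B₁ z (hz.trans (min_le_left _ _)) hz0 h).trans ?_
    gcongr
    exact le_max_left _ _
  · have hcr := E.cr_negate hle z
    have := B₂ (-z) (by
        rw [hcr, Complex.ofReal_neg, neg_sub_neg, norm_sub_rev]
        exact hz.trans (min_le_right _ _)) (by rwa [E.mem_D0_negate]) (by rw [hcr]; linarith)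
    rw [norm_neg, E.wronskian_negate α hle h] at this
    simp only [negate, Complex.ofReal_neg, sub_neg_eq_add, neg_add_eq_sub] at this
    refine le_trans (le_of_eq ?_) (this.trans ?_)
    · ring
    · gcongr
      exact le_max_right _ _

/-- Boundary values of `𝓓`, real and imaginary parts, on the segment. -/
theorem boundary (hp : E.Wp 0 = 0) (hm : E.Wm 0 = 0) (α : ℝ) {c : ℝ}
    (hc : c ∈ Icc E.cMin E.cMax \ {0, E.Wp 1, E.Wm 1, E.Wp (-1), E.Wm (-1)}) :
    Tendsto (fun ε : ℝ => E.wronskian α ((c : ℂ) + (ε : ℂ) * Complex.I)) (𝓝[>] 0)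
        (𝓝 (E.Dre α c + Complex.I * E.Dim α c)) ∧
      Tendsto (fun ε : ℝ => E.wronskian α ((c : ℂ) + (ε : ℂ) * Complex.I)) (𝓝[<] 0)
        (𝓝 (E.Dre α c - Complex.I * E.Dim α c)) ∧
      (E.Dre α c).im = 0 ∧ (E.Dim α c).im = 0 := by
  obtain ⟨hcI, hne⟩ := hc
  simp only [mem_insert_iff, mem_singleton_iff, not_or] at hne
  obtain ⟨n0, n1, n2, n3, n4⟩ := hne
  have hle := E.cMin_le_cMax hp hm
  rcases lt_or_gt_of_ne n0 with h | h
  · have hcr : E.cr c < 0 := by rw [E.cr_eq_of_mem (z := c) hcI]; exact h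
    obtain ⟨t1, t2, i1, i2⟩ := E.negate.boundary_of_pos (by simp [negate, hm])
      (by simp [negate, hp]) α (neg_pos.2 h) (by rw [cMax_negate]; exact neg_le_neg hcI.1)
      (fun h => n2 (neg_inj.1 h)) (fun h => n3 (neg_inj.1 h))
    rw [E.Dre_negate α hle hcr, E.Dim_negate α hle hcr] at t1 t2
    rw [E.Dre_negate α hle hcr] at i1
    rw [E.Dim_negate α hle hcr, Complex.neg_im, neg_eq_zero] at i2
    have e : (fun ε : ℝ => E.wronskian α ((c : ℂ) + (ε : ℂ) * Complex.I))
        = (fun ε : ℝ => E.negate.wronskian α (((-c : ℝ) : ℂ) + (ε : ℂ) * Complex.I))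
          ∘ fun ε : ℝ => -ε := by
      funext ε
      rw [← E.wronskian_negate α hle (by rwa [E.cr_add_mul_I])]
      simp only [Function.comp_apply]
      congr 1
      push_cast; ring
    have k1 : Tendsto (fun ε : ℝ => -ε) (𝓝[>] 0) (𝓝[<] 0) := by
      simpa using tendsto_neg_nhdsGT (a := (0 : ℝ))
    have k2 : Tendsto (fun ε : ℝ => -ε) (𝓝[<] 0) (𝓝[>] 0) := by
      simpa using tendsto_neg_nhdsLT (a := (0 : ℝ))
    rw [e]
    rw [mul_neg, ← sub_eq_add_neg] at t1
    rw [mul_neg, sub_neg_eq_add] at t2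
    exact ⟨t2.comp k1, t1.comp k2, i1, i2⟩
  · exact E.boundary_of_pos hp hm α h hcI.2 n1 n4

end WExtension

theorem mainTheorem2 (u b : ℝ → ℝ)
    (hu : ContDiffOn ℝ 5 u (Icc (-1) 1)) (hb : ContDiffOn ℝ 5 b (Icc (-1) 1))
    (hu0 : u 0 = 0) (hb0 : b 0 = 0)
    (c₀ : ℝ) (hc₀ : 0 < c₀)
    (hM : ∀ y ∈ Icc (-1 : ℝ) 1,
      c₀ ≤ derivWithin b (Icc (-1) 1) y - |derivWithin u (Icc (-1) 1) y|)
    (α : ℝ) (hα : 1 ≤ |α|) (E : WExtension u b) :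
    ∃ ε₀ δ₀ C : ℝ, 0 < ε₀ ∧ ε₀ < 1 ∧ 0 < δ₀ ∧ 1 ≤ C ∧
      -- boundary values on the segment
      (∀ c ∈ Icc E.cMin E.cMax \ {0, E.Wp 1, E.Wm 1, E.Wp (-1), E.Wm (-1)},
        Tendsto (fun ε : ℝ => E.wronskian α ((c : ℂ) + (ε : ℂ) * Complex.I)) (𝓝[>] 0)
          (𝓝 (E.Dre α c + Complex.I * E.Dim α c)) ∧
        Tendsto (fun ε : ℝ => E.wronskian α ((c : ℂ) + (ε : ℂ) * Complex.I)) (𝓝[<] 0)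
          (𝓝 (E.Dre α c - Complex.I * E.Dim α c)) ∧
        (E.Dre α c).im = 0 ∧ (E.Dim α c).im = 0 ∧
        C⁻¹ ≤ (E.Dre α c).re ^ 2 + (E.Dim α c).re ^ 2) ∧
      -- near the origin
      (∀ c ε : ℝ, |c| < δ₀ → 0 < |ε| → |ε| < ε₀ →
        (c : ℂ) + (ε : ℂ) * Complex.I ∈ E.Omega ε₀ \ E.D0 →
        C⁻¹ / ‖(c : ℂ) + (ε : ℂ) * Complex.I‖
          ≤ ‖E.wronskian α ((c : ℂ) + (ε : ℂ) * Complex.I)‖) ∧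
      -- off the segment
      (∀ z ∈ E.Omega ε₀ \ E.D0,
        logWeight (z - (E.Wm (-1) : ℂ)) * logWeight ((E.Wp (-1) : ℂ) - z)
            * logWeight (z - (E.Wm 1 : ℂ)) * logWeight ((E.Wp 1 : ℂ) - z) / (C * ‖z‖)
          ≤ ‖E.wronskian α z‖) := by
  have h0 : (0 : ℝ) ∈ Icc (-1 : ℝ) 1 := by norm_num
  have hp : E.Wp 0 = 0 := by rw [E.Wp_eq 0 h0, hu0, hb0, add_zero]
  have hm : E.Wm 0 = 0 := by rw [E.Wm_eq 0 h0, hu0, hb0, sub_zero]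
  have hle := E.cMin_le_cMax hp hm
  obtain ⟨ε₁, C₁, hε₁, hC₁, key⟩ := E.exists_lower_bound hp hm hα
  set R := |E.cMin| + |E.cMax| + 1 with hR
  have hR1 : 1 ≤ R := by have := abs_nonneg E.cMin; have := abs_nonneg E.cMax; linarith
  set K := max C₁ 1 with hK
  have hK1 : 1 ≤ K := le_max_right _ _
  have hKR : 1 ≤ K * R := one_le_mul_of_one_le_of_one_le hK1 hR1
  have hKC : K ≤ (K * R) ^ 2 := by
    calc K ≤ K * R := le_mul_of_one_le_right (by linarith) hR1
      _ ≤ (K * R) ^ 2 := le_self_pow₀ hKR two_ne_zero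
  have keyK : ∀ z : ℂ, ‖z - E.cr z‖ ≤ ε₁ → z ∉ E.D0 →
      logWeight (z - (E.Wm (-1) : ℂ)) * logWeight ((E.Wp (-1) : ℂ) - z)
        * logWeight (z - (E.Wm 1 : ℂ)) * logWeight ((E.Wp 1 : ℂ) - z)
        ≤ K * (‖z‖ * ‖E.wronskian α z‖) := fun z h1 h2 =>
    (key z h1 h2).trans (by gcongr; exact le_max_left _ _)
  have hzero : (0 : ℂ) ∈ E.D0 := ⟨0, ⟨(E.cMin_neg hp hm).le, (E.cMax_pos hp hm).le⟩, by simp⟩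
  have hpos : ∀ z : ℂ, z ∉ E.D0 → 0 < ‖z‖ := fun z hz =>
    norm_pos_iff.2 fun h => hz (h ▸ hzero)
  have keyone : ∀ z : ℂ, ‖z - E.cr z‖ ≤ ε₁ → z ∉ E.D0 → 1 ≤ K * (‖z‖ * ‖E.wronskian α z‖) :=
    fun z h1 h2 => (one_le_mul_of_one_le_of_one_le (one_le_mul_of_one_le_of_one_le
      (one_le_mul_of_one_le_of_one_le (one_le_logWeight _) (one_le_logWeight _))
      (one_le_logWeight _)) (one_le_logWeight _)).trans (keyK z h1 h2)
  have hmin : 0 < min ε₁ (1 / 2) := by positivity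
  -- `R` bounds `|c + i ε|` near the segment; the square in the constant comes from the sum of squares
  -- in the bound for the boundary values.
  refine ⟨min ε₁ (1 / 2), 1, (K * R) ^ 2, hmin, (min_le_right _ _).trans_lt (by norm_num),
    one_pos, one_le_pow₀ hKR, fun c hc => ?_, fun c ε _ _ _ hz => ?_, fun z hz => ?_⟩
  · obtain ⟨t1, t2, i1, i2⟩ := E.boundary hp hm α hc
    refine ⟨t1, t2, i1, i2, ?_⟩
    have hlow : (K * R)⁻¹ ≤ ‖E.Dre α c + Complex.I * E.Dim α c‖ := by
      refine ge_of_tendsto t1.norm ?_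
      have hsmall : ∀ᶠ ε : ℝ in 𝓝[>] 0, ε < min ε₁ (1 / 2) :=
        nhdsWithin_le_nhds (Iio_mem_nhds hmin)
      filter_upwards [hsmall, self_mem_nhdsWithin] with ε hε hε0
      have hε0 : 0 < ε := hε0
      have hnorm : ‖(ε : ℂ) * Complex.I‖ = ε := by
        rw [norm_mul, Complex.norm_I, mul_one, Complex.norm_real, Real.norm_of_nonneg hε0.le]
      have hz0 : (c : ℂ) + ε * Complex.I ∉ E.D0 := by
        rintro ⟨x, -, hx⟩
        have := congrArg Complex.im hx
        simp at this
        exact hε0.ne' this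
      have h1 := keyone (c + ε * Complex.I) (by
        rw [E.cr_add_mul_I, E.cr_eq_of_mem (z := c) hc.1, Complex.ofReal_re, add_sub_cancel_left,
          hnorm]
        exact hε.le.trans (min_le_left _ _)) hz0
      have h2 : ‖(c : ℂ) + ε * Complex.I‖ ≤ R := by
        refine (norm_add_le _ _).trans ?_
        rw [hnorm, Complex.norm_real, Real.norm_eq_abs]
        have h3 : |c| ≤ |E.cMin| + |E.cMax| := by
          rw [abs_le]
          constructor
          · linarith [neg_abs_le E.cMin, abs_nonneg E.cMax, hc.1.1]
          · linarith [le_abs_self E.cMax, abs_nonneg E.cMin, hc.1.2]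
        linarith [min_le_right ε₁ (1 / 2)]
      rw [inv_le_iff_one_le_mul₀ (by positivity)]
      calc 1 ≤ K * (‖(c : ℂ) + ε * Complex.I‖ * ‖E.wronskian α (c + ε * Complex.I)‖) := h1
        _ ≤ K * (R * ‖E.wronskian α (c + ε * Complex.I)‖) := by gcongr
        _ = _ := by ring
    have hsq : ‖E.Dre α c + Complex.I * E.Dim α c‖ ^ 2
        = (E.Dre α c).re ^ 2 + (E.Dim α c).re ^ 2 := by
      rw [← Complex.normSq_eq_norm_sq, Complex.normSq_apply]
      simp only [Complex.add_re, Complex.add_im, Complex.mul_re, Complex.mul_im, Complex.I_re,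
        Complex.I_im, i1, i2]
      ring
    rw [← hsq, ← inv_pow]
    gcongr
  · have h1 := keyone _ ((E.norm_sub_cr_le hle hmin hz.1).trans (min_le_left _ _)) hz.2
    have h2 := hpos _ hz.2
    rw [div_le_iff₀ h2, inv_le_iff_one_le_mul₀ (by positivity)]
    calc 1 ≤ K * (‖(c : ℂ) + ε * Complex.I‖ * ‖E.wronskian α (c + ε * Complex.I)‖) := h1
      _ ≤ (K * R) ^ 2 * (‖(c : ℂ) + ε * Complex.I‖ * ‖E.wronskian α (c + ε * Complex.I)‖) := by
        gcongr
      _ = _ := by ring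
  · have h1 := keyK z ((E.norm_sub_cr_le hle hmin hz.1).trans (min_le_left _ _)) hz.2
    have h2 := hpos _ hz.2
    rw [div_le_iff₀ (by positivity)]
    calc _ ≤ K * (‖z‖ * ‖E.wronskian α z‖) := h1
      _ ≤ (K * R) ^ 2 * (‖z‖ * ‖E.wronskian α z‖) := by gcongr
      _ = _ := by ring
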